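/- Conventions. Complex manifolds are Hausdorff, second countable and connected. A function $\varphi:D\to[-\infty,\infty)$ on an open set $D\subset\mathbb C^n$ is psh if it is upper semicontinuous and, for every $z\in D$, $\varphi(z)\le\int_0^{2\pi}\varphi(z+e^{i\theta}\xi)\,\frac{d\theta}{2\pi}$ for all sufficiently small $\xi\in\mathbb C^n$ (the function $-\infty$ is allowed); psh functions on open subsets of manifolds are defined through charts. Let $E$ be a holomorphic vector bundle of finite rank on a complex manifold $X$. A singular Hermitian metric $h$ on $E$ assigns to each $x\in X$ a semi-positive, possibly unbounded Hermitian form on $E_x$ (a positive semidefinite Hermitian form on a linear subspace of $E_x$, with $|v|_h^2=\infty$ off this subspace), such that $|v|_h^2$ is Lebesgue measurable for every local holomorphic section $v$ of $E$, and $0<\det h<+\infty$ almost everywhere, that is, $0<|v|_h^2<\infty$ for all $v\in E_x\setminus\{0\}$ and almost all $x$. The metric $h$ is semi-negatively curved if $\log|v|_h^2$ is psh for every local holomorphic section $v$ of $E$. It is semi-positively curved if the dual metric $h^\star$ on $E^\star$, $|\xi|_{h^\star}^2=\sup_{v\in E_x}|\xi(v)|^2/|v|_h^2$ (with $0/0=0$,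 $a/0=\infty$ for $a>0$, $a/\infty=0$; this is ${}^th^{-1}$ where $0<\det h<\infty$), is semi-negatively curved. A Zariski open subset of $X$ is the complement of a closed analytic subset. Lemma. Let $f:Y\to X$ be a proper surjective holomorphic map between two complex manifolds, and let $E$ be a holomorphic vector bundle on $X$. (1) Let $h$ be a singular Hermitian metric on $E$ that is semi-negatively (resp. semi-positively) curved. Then $f^\star h$ is a singular Hermitian metric on $f^\star E$, and it is semi-negatively (resp. semi-positively) curved. (2) Let $X_1\subset X$ be a non-empty Zariski open subset, $Y_1=f^{-1}(X_1)$, and let $h_1$ be a singular Hermitian metric on $E|_{X_1}$. Assume that there is a semi-negatively (resp. semi-positively) curved singular Hermitian metric $h_Y$ on $f^\star E$ with $h_Y|_{Y_1}=f^\star h_1$. Then there is a semi-negatively (resp. semi-positively) curved singular Hermitian metric $h$ on $E$ with $h|_{X_1}=h_1$. -/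

import Mathlib

open Set MeasureTheory Bundle
open scoped Manifold ContDiff ENNReal

noncomputable section

/-! ### Plurisubharmonic functions -/

/-- The mean `∫₀^{2π} φ(z + e^{iθ} ξ) dθ/2π` of an extended real valued function over a circle, as the
mean of the positive part minus the mean of the negative part. When `φ` is bounded above on the circle
this is the usual integral with values in `[-∞, ∞)`. -/
def circleMean {V : Type*} [AddCommGroup V] [Module ℂ V] (φ : V → EReal) (z ξ : V) : EReal :=
  ((ENNReal.ofReal (2 * Real.pi)⁻¹ *
      ∫⁻ θ in Ioc (0 : ℝ) (2 * Real.pi),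
        (φ (z + Complex.exp (θ * Complex.I) • ξ)).toENNReal : ℝ≥0∞) : EReal) -
  ((ENNReal.ofReal (2 * Real.pi)⁻¹ *
      ∫⁻ θ in Ioc (0 : ℝ) (2 * Real.pi),
        (-φ (z + Complex.exp (θ * Complex.I) • ξ)).toENNReal : ℝ≥0∞) : EReal)

/-- `φ` is plurisubharmonic on the (open) subset `D` of `ℂⁿ`: it takes values in `[-∞, ∞)`, is upper
semicontinuous, and satisfies the mean value inequality on all small circles in complex lines through
each point of `D`. The function `-∞` is allowed. -/
structure IsPshInCoordinates {n : ℕ} (φ : (Fin n → ℂ) → EReal) (D : Set (Fin n → ℂ)) : Prop where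
  lt_top : ∀ z ∈ D, φ z < ⊤
  usc : UpperSemicontinuousOn φ D
  mean_value : ∀ z ∈ D, ∃ r > 0, ∀ ξ : Fin n → ℂ, ‖ξ‖ < r →
    (∀ θ : ℝ, z + Complex.exp (θ * Complex.I) • ξ ∈ D) ∧ φ z ≤ circleMean φ z ξ

/-- `φ` is plurisubharmonic on the open subset `U` of the complex manifold `X`: it is so in every
holomorphic coordinate chart of the atlas. -/
def IsPshOn {n : ℕ} {X : Type*} [TopologicalSpace X] [ChartedSpace (Fin n → ℂ) X]
    (φ : X → EReal) (U : Set X) : Prop :=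
  ∀ e ∈ atlas (Fin n → ℂ) X,
    IsPshInCoordinates (fun z => φ (e.symm z)) (e.target ∩ e.symm ⁻¹' U)

/-! ### Zariski open subsets -/

/-- `A` is a closed analytic subset of the complex manifold `X`: near every point of `X` it is the set
of common zeros of finitely many holomorphic functions. -/
def IsClosedAnalyticSubset {n : ℕ} {X : Type*} [TopologicalSpace X] [ChartedSpace (Fin n → ℂ) X]
    (A : Set X) : Prop :=
  ∀ x : X, ∃ U : Set X, IsOpen U ∧ x ∈ U ∧ ∃ (k : ℕ) (g : Fin k → X → ℂ),
    (∀ i, ContMDiffOn 𝓘(ℂ, Fin n → ℂ) 𝓘(ℂ, ℂ) ω (g i) U) ∧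
    A ∩ U = {p | p ∈ U ∧ ∀ i, g i p = 0}

/-- Zariski open subsets are the complements of closed analytic subsets. -/
def IsAnalyticZariskiOpen {n : ℕ} {X : Type*} [TopologicalSpace X] [ChartedSpace (Fin n → ℂ) X]
    (X₁ : Set X) : Prop :=
  IsClosedAnalyticSubset (n := n) X₁ᶜ

/-! ### Singular Hermitian metrics

A possibly unbounded semi-positive Hermitian form on a vector space `V` is recorded by its squared norm
`q v = |v|² ∈ [0, ∞]`. -/

/-- `q` is the squared norm of a semi-positive, possibly unbounded Hermitian form on `V`: it is given
by a positive semidefinite Hermitian form `B` on some complex subspace `W`, and is `∞` off `W`. -/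
def IsUnboundedHermitianForm {V : Type*} [AddCommGroup V] [Module ℂ V] (q : V → ℝ≥0∞) : Prop :=
  ∃ (W : Submodule ℂ V) (B : W →ₗ⋆[ℂ] W →ₗ[ℂ] ℂ),
    (∀ v w, B v w = starRingEnd ℂ (B w v)) ∧
    (∀ v, 0 ≤ (B v v).re) ∧
    (∀ v : W, q v = ENNReal.ofReal (B v v).re) ∧
    ∀ v, v ∉ W → q v = ⊤

/-- The dual form on the space of linear functionals, `|ξ|² = sup_v |ξ(v)|² / |v|²`, where `a / ∞ = 0`,
`0 / 0 = 0` and `a / 0 = ∞` for `a ≠ 0`. If the form is given by an invertible matrix `H`, the dual form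
is given by the matrix `ᵗH⁻¹`. -/
def dualForm {V : Type*} [AddCommGroup V] [Module ℂ V] [TopologicalSpace V] (q : V → ℝ≥0∞) :
    (V →L[ℂ] ℂ) → ℝ≥0∞ :=
  fun ξ => ⨆ v : V, ‖ξ v‖ₑ ^ 2 / q v

section Metrics

variable {n : ℕ} {X : Type*} [TopologicalSpace X] [ChartedSpace (Fin n → ℂ) X]
  (F : Type*) [NormedAddCommGroup F] [NormedSpace ℂ F]
  {E : X → Type*} [∀ x, AddCommGroup (E x)] [∀ x, Module ℂ (E x)]
  [∀ x, TopologicalSpace (E x)] [TopologicalSpace (TotalSpace F E)]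
  [FiberBundle F E] [VectorBundle ℂ F E]

/-- `v` is a holomorphic section of the vector bundle `E` (with model fibre `F`) over the open set
`U` (its values outside `U` are irrelevant). -/
def IsHolomorphicSectionOn (v : ∀ x, E x) (U : Set X) : Prop :=
  ContMDiffOn 𝓘(ℂ, Fin n → ℂ) (𝓘(ℂ, Fin n → ℂ).prod 𝓘(ℂ, F)) ω
    (fun x => TotalSpace.mk' F x (v x)) U

/-- `h` is (the squared norm of) a singular Hermitian metric on the restriction of `E` to the open set
`Ω`. Values of `h` outside `Ω` are irrelevant. Measurability and "almost everywhere" refer to Lebesgue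
measure in the coordinate charts, and `0 < det h < ∞` says that the form is finite and nondegenerate. -/
structure IsSingularHermitianMetricOn (h : ∀ x, E x → ℝ≥0∞) (Ω : Set X) : Prop where
  form : ∀ x ∈ Ω, IsUnboundedHermitianForm (h x)
  measurable : ∀ U : Set X, IsOpen U → U ⊆ Ω → ∀ v : ∀ x, E x,
    IsHolomorphicSectionOn (n := n) F v U → ∀ e ∈ atlas (Fin n → ℂ) X,
      AEMeasurable (fun z => h (e.symm z) (v (e.symm z)))
        (volume.restrict (e.target ∩ e.symm ⁻¹' U))
  det : ∀ e ∈ atlas (Fin n → ℂ) X, ∀ᵐ z ∂(volume.restrict (e.target ∩ e.symm ⁻¹' Ω)),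
    ∀ v : E (e.symm z), v ≠ 0 → 0 < h (e.symm z) v ∧ h (e.symm z) v < ⊤

/-- `h` is semi-negatively curved over the open set `Ω`: `log |v|²` is plurisubharmonic for every
holomorphic section `v` of `E` over an open subset of `Ω`. -/
def IsSemiNegativelyCurvedOn (h : ∀ x, E x → ℝ≥0∞) (Ω : Set X) : Prop :=
  ∀ U : Set X, IsOpen U → U ⊆ Ω → ∀ v : ∀ x, E x, IsHolomorphicSectionOn (n := n) F v U →
    IsPshOn (n := n) (fun x => ENNReal.log (h x (v x))) U

/-- `h` is semi-positively curved over the open set `Ω`: the dual metric on the dual bundle (the bundle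
with fibres `E x →L[ℂ] ℂ`) is semi-negatively curved over `Ω`. -/
def IsSemiPositivelyCurvedOn (h : ∀ x, E x → ℝ≥0∞) (Ω : Set X) : Prop :=
  IsSemiNegativelyCurvedOn (n := n) (F →L[ℂ] ℂ)
    (E := fun x => E x →L[ℂ] Bundle.Trivial X ℂ x) (fun x => dualForm (h x)) Ω

end Metrics

/-! ### Pull-back -/

instance pullbackFiberAddCommGroup {X Y : Type*} (f : Y → X) (E : X → Type*)
    [∀ x, AddCommGroup (E x)] (y : Y) : AddCommGroup ((f *ᵖ E) y) :=
  inferInstanceAs (AddCommGroup (E (f y)))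

/-- The pull-back `f^* h` on the pull-back bundle `f^* E`, whose fibre over `y` is `E (f y)`. -/
def pullbackMetric {X Y : Type*} (f : Y → X) {E : X → Type*} (h : ∀ x, E x → ℝ≥0∞) :
    ∀ y, (f *ᵖ E) y → ℝ≥0∞ :=
  fun y => h (f y)

end

/-! ### Circle means and real parts of polynomials -/

section CircleMeans

open Filter Topology Metric

/-! Both curvature conditions say that the logarithm of a family of forms is psh along holomorphic
sections, for `h` itself or for its dual. Unbounded Hermitian forms and dual forms share one
property, `IsSupForm`: they are suprema of `|l|²` over linear functionals `l`. So one argument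
serves both signs.

Pull-back. A section of `f^*E` need not come from a section on `X`; in a trivialization it is a map
`z ↦ (f z, b z)` into base times fibre. Hence `log |w|²` is studied as a function of base point and
vector together. Along a non-vertical line the submean inequality is the hypothesis for an affine
section whose graph contains the line (`hasSmallSubmeans_of_psh_sections`); along a vertical line it
follows from the maximum principle (`IsSupForm.log_le_of_polynomial`). Joint semicontinuity comes
from the triangle inequality. The radii obtained depend on the line, but
`le_circleMean_comp_of_hasSmallSubmeans` still passes from lines to analytic discs, so composition
with holomorphic maps preserves plurisubharmonicity. Measurability and non-degeneracy almost
everywhere pull back because preimages of null sets are null: by Sard's theorem the critical points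
form a proper analytic subset, and elsewhere `f` is a submersion.

Descent (`IsPshOn.exists_descent`). For a section `s` on `X`, let `u` be the log-norm upstairs and
`φ` its maximum over the fibres of the proper map `f`. Over `X₁` the function `u` is constant on
fibres, so near a point of `X₁` with a regular preimage `φ` is `u` composed with a local section of
`f`, hence psh. By an analytic Sard theorem the other points lie in countably many local
hypersurfaces, and such a set is removable here because `φ` is upper semicontinuous and its values
are approached from outside the set (`isPshInCoordinates_of_removable`). Finally `φ ∘ f` and `u` are
psh and agree off a null set, hence everywhere. So norms of sections from `X` are constant on all
fibres, and the form at any one point of each fibre defines `h`. -/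

theorem circleMap_zero_one_eq_exp (θ : ℝ) : circleMap 0 1 θ = Complex.exp (θ * Complex.I) := by
  simp [circleMap]

theorem coe_real_mul_toReal_eq_coe_ennreal {c : ℝ} (hc : 0 ≤ c) {A : ℝ≥0∞} (hA : A ≠ ⊤) :
    ((c * A.toReal : ℝ) : EReal) = ((ENNReal.ofReal c * A : ℝ≥0∞) : EReal) := by
  lift A to NNReal using hA
  lift c to NNReal using hc
  rw [EReal.coe_mul, ENNReal.coe_toReal, ENNReal.ofReal_coe_nnreal, EReal.coe_ennreal_mul]
  rfl

/-- An almost everywhere bound of `φ` on a circle by an integrable real function bounds its mean. -/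
theorem circleMean_le_circleAverage_of_ae {V : Type*} [AddCommGroup V] [Module ℂ V]
    {φ : V → EReal} {z ξ : V} {b : ℂ → ℝ} (hb : CircleIntegrable b 0 1)
    (h : ∀ᵐ θ : ℝ ∂(volume.restrict (Ioc 0 (2 * Real.pi))),
      φ (z + Complex.exp (θ * Complex.I) • ξ) ≤ (b (circleMap 0 1 θ) : EReal)) :
    circleMean φ z ξ ≤ ((Real.circleAverage b 0 1 : ℝ) : EReal) := by
  have hpi : (0 : ℝ) < (2 * Real.pi)⁻¹ := by positivity
  have hint : Integrable (fun θ => b (circleMap 0 1 θ)) (volume.restrict (Ioc 0 (2 * Real.pi))) := by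
    have := hb.def'
    rwa [IntegrableOn, uIoc_of_le (by positivity)] at this
  have hn : ∫⁻ θ in Ioc 0 (2 * Real.pi), ENNReal.ofReal (-b (circleMap 0 1 θ)) ≠ ⊤ :=
    hint.neg.lintegral_lt_top.ne
  rw [Real.circleAverage_def, intervalIntegral.integral_of_le (by positivity),
    integral_eq_lintegral_pos_part_sub_lintegral_neg_part hint, smul_eq_mul, mul_sub, EReal.coe_sub,
    coe_real_mul_toReal_eq_coe_ennreal hpi.le hint.lintegral_lt_top.ne,
    coe_real_mul_toReal_eq_coe_ennreal hpi.le hn]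
  refine EReal.sub_le_sub ?_ ?_
  · refine EReal.coe_ennreal_le_coe_ennreal_iff.2 (mul_le_mul_right (lintegral_mono_ae ?_) _)
    filter_upwards [h] with θ hθ
    exact (EReal.toENNReal_le_toENNReal hθ).trans_eq (EReal.real_coe_toENNReal _)
  · refine EReal.coe_ennreal_le_coe_ennreal_iff.2 (mul_le_mul_right (lintegral_mono_ae ?_) _)
    filter_upwards [h] with θ hθ
    refine (EReal.real_coe_toENNReal _).symm.trans_le (EReal.toENNReal_le_toENNReal ?_)
    rw [EReal.coe_neg]
    exact EReal.neg_le_neg_iff.2 hθ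

theorem circleMean_le_circleAverage {V : Type*} [AddCommGroup V] [Module ℂ V]
    {φ : V → EReal} {z ξ : V} {b : ℂ → ℝ} (hb : ContinuousOn b (sphere 0 1))
    (h : ∀ t ∈ sphere (0 : ℂ) 1, φ (z + t • ξ) ≤ (b t : EReal)) :
    circleMean φ z ξ ≤ ((Real.circleAverage b 0 1 : ℝ) : EReal) := by
  refine circleMean_le_circleAverage_of_ae (hb.circleIntegrable zero_le_one)
    (Eventually.of_forall fun θ => ?_)
  rw [← circleMap_zero_one_eq_exp]
  exact h _ (circleMap_mem_sphere 0 zero_le_one θ)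

theorem circleMean_eq_comp_line {V : Type*} [AddCommGroup V] [Module ℂ V] (φ : V → EReal) (z ξ : V) :
    circleMean φ z ξ = circleMean (fun t : ℂ => φ (z + t • ξ)) 0 1 := by
  simp [circleMean]

theorem circleMean_comp_line_smul {V : Type*} [AddCommGroup V] [Module ℂ V] (φ : V → EReal)
    (z ξ : V) (t₀ s : ℂ) :
    circleMean φ (z + t₀ • ξ) (s • ξ) = circleMean (fun t : ℂ => φ (z + t • ξ)) t₀ s := by
  simp [circleMean, add_smul, mul_smul, add_assoc]

theorem circleMean_congr {V : Type*} [AddCommGroup V] [Module ℂ V] {φ ψ : V → EReal} {z ξ : V}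
    (h : ∀ t ∈ sphere (0 : ℂ) 1, φ (z + t • ξ) = ψ (z + t • ξ)) :
    circleMean φ z ξ = circleMean ψ z ξ := by
  have (θ : ℝ) : φ (z + Complex.exp (θ * Complex.I) • ξ) = ψ (z + Complex.exp (θ * Complex.I) • ξ) :=
    h _ (by simp)
  simp [circleMean, this]

/-- Upper semicontinuous functions on the unit circle have continuous majorants with almost the same
mean. -/
theorem exists_continuous_ge_of_circleMean_lt {c : ℂ → EReal}
    (husc : UpperSemicontinuousOn c (sphere 0 1)) (htop : ∀ t ∈ sphere (0 : ℂ) 1, c t < ⊤) {m : ℝ}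
    (hm : circleMean c 0 1 < m) :
    ∃ b : ℂ → ℝ, Continuous b ∧ (∀ t ∈ sphere (0 : ℂ) 1, c t ≤ b t) ∧
      Real.circleAverage b 0 1 < m := by
  obtain ⟨C, hC0, hC⟩ : ∃ C : ℝ, 0 ≤ C ∧ ∀ t ∈ sphere (0 : ℂ) 1, c t ≤ C := by
    obtain ⟨a, ha, hmax⟩ := husc.exists_isMaxOn (NormedSpace.sphere_nonempty.2 zero_le_one)
      (isCompact_sphere (0 : ℂ) 1)
    refine ⟨max (c a).toReal 0, le_max_right _ _, fun t ht => (hmax ht).trans ?_⟩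
    exact (EReal.le_coe_toReal (htop a ha).ne).trans (EReal.coe_le_coe_iff.2 (le_max_left _ _))
  -- Truncation at `-k` makes the values real; on the circle these functions decrease to `c`.
  set d : ℕ → ℂ → ℝ := fun k s => (max (c s) ((-k : ℝ) : EReal)).toReal with hd
  have hdcoe (k : ℕ) (s : ℂ) (hs : s ∈ sphere (0 : ℂ) 1) :
      (d k s : EReal) = max (c s) ((-k : ℝ) : EReal) := by
    refine EReal.coe_toReal ?_ ?_
    · exact (max_lt (htop s hs) (EReal.coe_lt_top _)).ne
    · exact ((EReal.bot_lt_coe _).trans_le (le_max_right _ _)).ne'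
  have hdC (k : ℕ) (s : ℂ) (hs : s ∈ sphere (0 : ℂ) 1) : d k s ≤ C := by
    rw [← EReal.coe_le_coe_iff, hdcoe k s hs]
    refine max_le (hC s hs) (EReal.coe_le_coe_iff.2 ?_)
    have : (0 : ℝ) ≤ k := Nat.cast_nonneg k
    linarith
  -- Sup-convolution with slope `k`: a `k`-Lipschitz function, above `c` on the circle, and for
  -- large `k` below any given real number larger than `c t`.
  set β : ℕ → ℂ → ℝ := fun k t => ⨆ s : sphere (0 : ℂ) 1, (d k s - k * dist t s) with hβ
  have : Nonempty (sphere (0 : ℂ) 1) := ⟨⟨1, by simp⟩⟩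
  have hbdd (k : ℕ) (t : ℂ) : BddAbove (range fun s : sphere (0 : ℂ) 1 => d k s - k * dist t s) := by
    refine ⟨C, ?_⟩
    rintro _ ⟨s, rfl⟩
    have := hdC k s s.2
    have : 0 ≤ (k : ℝ) * dist t s := by positivity
    simp only
    linarith
  have hβC (k : ℕ) (t : ℂ) : β k t ≤ C := ciSup_le fun s => by
    have := hdC k s s.2
    have : 0 ≤ (k : ℝ) * dist t s := by positivity
    linarith
  have hβcont (k : ℕ) : Continuous (β k) := by
    refine (LipschitzWith.of_le_add_mul (k : NNReal) fun x y => ?_).continuous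
    refine ciSup_le fun s => ?_
    have h1 := le_ciSup (hbdd k y) s
    have h2 : (k : ℝ) * dist y s ≤ k * dist x y + k * dist x s := by
      rw [← mul_add]
      exact mul_le_mul_of_nonneg_left (by linarith [dist_triangle y x s, dist_comm x y])
        (Nat.cast_nonneg k)
    simp only [NNReal.coe_natCast]
    change d k s - k * dist y s ≤ β k y at h1
    linarith
  have hcβ (k : ℕ) (t : ℂ) (ht : t ∈ sphere (0 : ℂ) 1) : c t ≤ β k t := by
    have h1 := le_ciSup (hbdd k t) ⟨t, ht⟩
    simp only [dist_self, mul_zero, sub_zero] at h1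
    exact (le_max_left _ _).trans ((hdcoe k t ht).symm.trans_le (EReal.coe_le_coe_iff.2 h1))
  have hlim (t : ℂ) (ht : t ∈ sphere (0 : ℂ) 1) (α : ℝ) (hα : c t < α) :
      ∀ᶠ k in atTop, β k t ≤ α := by
    have h1 := husc t ht α hα
    rw [eventually_nhdsWithin_iff, Metric.eventually_nhds_iff] at h1
    obtain ⟨δ, hδ, h1⟩ := h1
    obtain ⟨N, hN⟩ := exists_nat_ge (max (-α) ((C - α) / δ))
    filter_upwards [eventually_ge_atTop N] with k hk
    have hkN : (N : ℝ) ≤ k := by exact_mod_cast hk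
    have hk1 : -α ≤ k := (le_max_left _ _).trans (hN.trans hkN)
    have hk2 : C - α ≤ k * δ := (div_le_iff₀ hδ).1 ((le_max_right _ _).trans (hN.trans hkN))
    refine ciSup_le fun s => ?_
    by_cases hs : dist (s : ℂ) t < δ
    · have h2 : d k s ≤ α := by
        rw [← EReal.coe_le_coe_iff, hdcoe k s s.2]
        exact max_le (h1 hs s.2).le (EReal.coe_le_coe_iff.2 (by linarith))
      have : 0 ≤ (k : ℝ) * dist t s := by positivity
      linarith
    · have h2 : (k : ℝ) * δ ≤ k * dist t s :=
        mul_le_mul_of_nonneg_left (by rw [dist_comm]; exact not_lt.1 hs) (Nat.cast_nonneg k)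
      linarith [hdC k s s.2]
  by_contra hcon
  push Not at hcon
  have hmean (k : ℕ) : m ≤ Real.circleAverage (β k) 0 1 :=
    hcon (β k) (hβcont k) (hcβ k)
  set μ : Measure ℝ := volume.restrict (Ioc 0 (2 * Real.pi)) with hμ
  have hμu : μ univ = ENNReal.ofReal (2 * Real.pi) := by simp [hμ]
  have hpi : (0 : ℝ) < 2 * Real.pi := by positivity
  have hsph (θ : ℝ) : circleMap 0 1 θ ∈ sphere (0 : ℂ) 1 := circleMap_mem_sphere 0 zero_le_one θ
  set w : ℝ → ℝ≥0∞ := fun θ => ((C : EReal) - c (circleMap 0 1 θ)).toENNReal with hw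
  -- Fatou's lemma for the nonnegative functions `C - β k`: if all the `β k` had mean at least `m`,
  -- so would `c`.
  have hW : ∫⁻ θ, w θ ∂μ ≤ ENNReal.ofReal (2 * Real.pi * (C - m)) := by
    calc ∫⁻ θ, w θ ∂μ ≤ ∫⁻ θ, liminf (fun k => ENNReal.ofReal (C - β k (circleMap 0 1 θ))) atTop ∂μ := by
          refine lintegral_mono fun θ => ?_
          refine le_of_forall_lt fun a ha => ?_
          have hat : a ≠ ⊤ := ha.ne_top
          lift a to NNReal using hat
          obtain ⟨a', ha1, ha2⟩ := ENNReal.lt_iff_exists_nnreal_btwn.1 ha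
          have h3 : c (circleMap 0 1 θ) < ((C - a' : ℝ) : EReal) := by
            rw [← EReal.toENNReal_coe (x := (a' : ℝ≥0∞))] at ha2
            have h4 : ((a' : ℝ≥0∞) : EReal) < (C : EReal) - c (circleMap 0 1 θ) := by
              by_contra hle
              exact absurd ha2 (not_lt.2 (EReal.toENNReal_le_toENNReal (not_lt.1 hle)))
            induction hcc : c (circleMap 0 1 θ) with
            | bot => exact EReal.bot_lt_coe _
            | top => exact absurd (htop _ (hsph θ)) (by simp [hcc])
            | coe x =>
              rw [hcc, ← EReal.coe_sub] at h4
              have h4' : ((a' : ℝ) : EReal) < ((C - x : ℝ) : EReal) := h4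
              rw [EReal.coe_lt_coe_iff] at h4' ⊢
              linarith
          refine ha1.trans_le (le_liminf_of_le (by isBoundedDefault) ?_)
          filter_upwards [hlim _ (hsph θ) _ h3] with k hk
          rw [← ENNReal.ofReal_coe_nnreal]
          exact ENNReal.ofReal_le_ofReal (by linarith)
      _ ≤ liminf (fun k => ∫⁻ θ, ENNReal.ofReal (C - β k (circleMap 0 1 θ)) ∂μ) atTop :=
          lintegral_liminf_le fun k =>
            (continuous_const.sub ((hβcont k).comp (continuous_circleMap 0 1))).measurable.ennreal_ofReal
      _ ≤ ENNReal.ofReal (2 * Real.pi * (C - m)) := by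
          refine (liminf_le_liminf (v := fun _ => ENNReal.ofReal (2 * Real.pi * (C - m)))
            (Eventually.of_forall fun k => ?_)).trans_eq (liminf_const _)
          have hi : Integrable (fun θ => β k (circleMap 0 1 θ)) μ :=
            (((hβcont k).comp (continuous_circleMap 0 1)).integrableOn_Icc).mono_set Ioc_subset_Icc_self
          have hi2 : Integrable (fun θ => C - β k (circleMap 0 1 θ)) μ := (integrable_const C).sub hi
          rw [← ofReal_integral_eq_lintegral_ofReal hi2
            (Eventually.of_forall fun θ => sub_nonneg.2 (hβC k _)),
            integral_sub (integrable_const C) hi]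
          refine ENNReal.ofReal_le_ofReal ?_
          have h5 := hmean k
          rw [Real.circleAverage_def, intervalIntegral.integral_of_le hpi.le, smul_eq_mul,
            ← div_eq_inv_mul, le_div_iff₀ hpi] at h5
          simp [hμ, hpi.le] at h5 ⊢
          linarith
  have hmeas : Measurable fun θ : ℝ => c (circleMap 0 1 θ) := by
    refine UpperSemicontinuous.measurable fun θ a ha => ?_
    have h6 := husc _ (hsph θ) a ha
    exact (tendsto_nhdsWithin_iff.2 ⟨(continuous_circleMap 0 1).continuousAt,
      Eventually.of_forall hsph⟩).eventually h6
  set P := ∫⁻ θ, (c (circleMap 0 1 θ)).toENNReal ∂μ with hP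
  set N := ∫⁻ θ, (-c (circleMap 0 1 θ)).toENNReal ∂μ with hN
  -- `(C - c) + c⁺ = C + c⁻` pointwise. This avoids subtracting infinities and shows that the
  -- negative part is integrable.
  have hid : ∫⁻ θ, w θ ∂μ + P = ENNReal.ofReal (C * (2 * Real.pi)) + N := by
    rw [hP, hN, ENNReal.ofReal_mul hC0, ← hμu, ← lintegral_const,
      ← lintegral_add_right _ hmeas.ereal_toENNReal, ← lintegral_add_left measurable_const]
    refine lintegral_congr fun θ => ?_
    have h7 := hC _ (hsph θ)
    simp only [hw]
    induction hcc : c (circleMap 0 1 θ) with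
    | bot => simp
    | top => exact absurd (htop _ (hsph θ)) (by simp [hcc])
    | coe x =>
      rw [hcc, EReal.coe_le_coe_iff] at h7
      rw [← EReal.coe_sub, ← EReal.coe_neg]
      simp only [EReal.real_coe_toENNReal]
      rcases le_total 0 x with hx | hx
      · rw [ENNReal.ofReal_of_nonpos (neg_nonpos.2 hx), ← ENNReal.ofReal_add (by linarith) hx]
        simp
      · rw [ENNReal.ofReal_of_nonpos hx, ← ENNReal.ofReal_add hC0 (by linarith)]
        simp [sub_eq_add_neg]
  have hPfin : P ≠ ⊤ := by
    refine ne_top_of_le_ne_top ?_ (lintegral_mono fun θ => EReal.toENNReal_le_toENNReal (hC _ (hsph θ)))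
    simp [hμ, ENNReal.mul_eq_top]
  have hWfin : ∫⁻ θ, w θ ∂μ ≠ ⊤ := ne_top_of_le_ne_top ENNReal.ofReal_ne_top hW
  have hNfin : N ≠ ⊤ := by
    intro h
    rw [h, add_top] at hid
    exact ENNReal.add_ne_top.2 ⟨hWfin, hPfin⟩ hid
  have hcm : circleMean c 0 1 = (((2 * Real.pi)⁻¹ * P.toReal - (2 * Real.pi)⁻¹ * N.toReal : ℝ) : EReal) := by
    rw [EReal.coe_sub, coe_real_mul_toReal_eq_coe_ennreal (by positivity) hPfin,
      coe_real_mul_toReal_eq_coe_ennreal (by positivity) hNfin]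
    simp [circleMean, hP, hN, hμ, circleMap_zero_one_eq_exp]
  rw [hcm, EReal.coe_lt_coe_iff] at hm
  have h8 := congrArg ENNReal.toReal hid
  rw [ENNReal.toReal_add hWfin hPfin, ENNReal.toReal_add ENNReal.ofReal_ne_top hNfin,
    ENNReal.toReal_ofReal (by positivity)] at h8
  have h9 : (∫⁻ θ, w θ ∂μ).toReal ≤ 2 * Real.pi * (C - m) := by
    refine ENNReal.toReal_le_of_le_ofReal ?_ hW
    have h10 := hmean 0
    have h11 : Real.circleAverage (β 0) 0 1 ≤ C :=
      Real.circleAverage_mono_on_of_le_circle ((hβcont 0).continuousOn.circleIntegrable zero_le_one)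
        fun x _ => hβC 0 x
    exact mul_nonneg hpi.le (by linarith)
  rw [← mul_sub, inv_mul_lt_iff₀ hpi] at hm
  linarith

/-- A continuous real function on the unit circle is uniformly close to the real part of a complex
polynomial. -/
theorem exists_polynomial_re_near_on_circle {b : ℂ → ℝ} (hb : Continuous b) {ε : ℝ} (hε : 0 < ε) :
    ∃ p : Polynomial ℂ, ∀ t ∈ sphere (0 : ℂ) 1, |(p.eval t).re - b t| < ε := by
  have : Fact (0 < 2 * Real.pi) := ⟨by positivity⟩
  let B : C(AddCircle (2 * Real.pi), ℂ) :=
    ⟨fun x => (b (AddCircle.toCircle x : ℂ) : ℂ), by fun_prop⟩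
  have hB : B ∈ (Submodule.span ℂ (range <| @fourier (2 * Real.pi))).topologicalClosure := by
    rw [span_fourier_closure_eq_top]; trivial
  obtain ⟨g, hg, hgB⟩ := Metric.mem_closure_iff.1 hB ε hε
  -- On the circle a trigonometric polynomial is `p + conj q`, and its real part is that of the
  -- honest polynomial `p + q`.
  have key : ∃ p q : Polynomial ℂ, ∀ x : AddCircle (2 * Real.pi),
      g x = p.eval (AddCircle.toCircle x : ℂ) + starRingEnd ℂ (q.eval (AddCircle.toCircle x : ℂ)) := by
    clear hgB
    refine Submodule.span_induction ?_ ?_ ?_ ?_ hg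
    · rintro _ ⟨n, rfl⟩
      rcases Int.eq_nat_or_neg n with ⟨k, rfl | rfl⟩
      · refine ⟨Polynomial.X ^ k, 0, fun x => ?_⟩
        simp [fourier_apply, AddCircle.toCircle_nsmul]
      · refine ⟨0, Polynomial.X ^ k, fun x => ?_⟩
        rw [fourier_neg]
        simp [fourier_apply, AddCircle.toCircle_nsmul]
    · exact ⟨0, 0, by simp⟩
    · rintro f₁ f₂ _ _ ⟨p₁, q₁, h₁⟩ ⟨p₂, q₂, h₂⟩
      refine ⟨p₁ + p₂, q₁ + q₂, fun x => ?_⟩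
      simp only [ContinuousMap.add_apply, h₁, h₂, Polynomial.eval_add, map_add]
      ring
    · rintro a f₁ _ ⟨p₁, q₁, h₁⟩
      refine ⟨Polynomial.C a * p₁, Polynomial.C (starRingEnd ℂ a) * q₁, fun x => ?_⟩
      simp [h₁, mul_add]
  obtain ⟨p, q, hpq⟩ := key
  refine ⟨p + q, fun t ht => ?_⟩
  obtain ⟨x, hx⟩ : ∃ x : AddCircle (2 * Real.pi), (AddCircle.toCircle x : ℂ) = t := by
    obtain ⟨x, hx⟩ := (AddCircle.homeomorphCircle (T := 2 * Real.pi) (by positivity)).surjective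
      ⟨t, by simpa [Submonoid.unitSphere, mem_sphere_iff_norm] using ht⟩
    exact ⟨x, by rw [AddCircle.homeomorphCircle_apply] at hx; rw [hx]⟩
  have h1 := (ContinuousMap.dist_apply_le_dist (f := B) (g := g) x).trans_lt hgB
  rw [dist_comm, dist_eq_norm] at h1
  have h2 := (Complex.abs_re_le_norm _).trans_lt h1
  simpa [B, hpq, hx] using h2

/-- Comparison of an upper semicontinuous function on the unit circle with real parts of
polynomials. -/
theorem exists_polynomial_of_circleMean_lt {c : ℂ → EReal}
    (husc : UpperSemicontinuousOn c (sphere 0 1)) (htop : ∀ t ∈ sphere (0 : ℂ) 1, c t < ⊤) {m : ℝ}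
    (hm : circleMean c 0 1 < m) :
    ∃ p : Polynomial ℂ, (∀ t ∈ sphere (0 : ℂ) 1, c t < ((p.eval t).re : EReal)) ∧
      (p.eval 0).re < m := by
  obtain ⟨b, hb, hcb, hbm⟩ := exists_continuous_ge_of_circleMean_lt husc htop hm
  -- One `ε` is the approximation error, a second lifts the polynomial above `b`, and the third
  -- keeps the value at the centre below `m`.
  set ε := (m - Real.circleAverage b 0 1) / 3 with hε
  obtain ⟨p, hp⟩ := exists_polynomial_re_near_on_circle hb (show 0 < ε by linarith)
  have hpe : ∀ t, ((p + Polynomial.C (ε : ℂ)).eval t).re = (p.eval t).re + ε := by simp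
  refine ⟨p + Polynomial.C (ε : ℂ), fun t ht => (hcb t ht).trans_lt ?_, ?_⟩
  · rw [EReal.coe_lt_coe_iff, hpe]
    have := abs_lt.1 (hp t ht)
    linarith
  · have h1 : Real.circleAverage (fun t => (p.eval t).re) 0 1 = (p.eval 0).re := by
      have h2 : Real.circleAverage (fun t => p.eval t) 0 1 = p.eval 0 :=
        DiffContOnCl.circleAverage p.differentiable.diffContOnCl
      rw [← h2]
      exact (Complex.reCLM.circleAverage_comp_comm
        (p.continuous.continuousOn.circleIntegrable zero_le_one))
    have h3 : Real.circleAverage (fun t => (p.eval t).re) 0 1 ≤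
        Real.circleAverage (fun t => b t + ε) 0 1 := by
      refine Real.circleAverage_mono
        ((Complex.continuous_re.comp p.continuous).continuousOn.circleIntegrable zero_le_one)
        ((hb.add continuous_const).continuousOn.circleIntegrable zero_le_one) fun x hx => ?_
      have := abs_lt.1 (hp x (by simpa using hx))
      linarith
    rw [Real.circleAverage_fun_add (hb.continuousOn.circleIntegrable zero_le_one)
      (circleIntegrable_const _ _ _), Real.circleAverage_const] at h3
    rw [hpe]
    linarith

theorem polynomial_circleAverage_re (p : Polynomial ℂ) (c : ℂ) (r : ℝ) :
    Real.circleAverage (fun t => (p.eval t).re) c r = (p.eval c).re := by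
  have h2 : Real.circleAverage (fun t => p.eval t) c r = p.eval c :=
    DiffContOnCl.circleAverage p.differentiable.diffContOnCl
  rw [← h2]
  exact (Complex.reCLM.circleAverage_comp_comm (p.continuous.continuousOn.circleIntegrable'))

/-- To bound a number by the mean of an upper semicontinuous function it suffices to compare it with
real parts of polynomials that are larger on the circle. -/
theorem le_circleMean_of_forall_polynomial {V : Type*} [AddCommGroup V] [Module ℂ V]
    {φ : V → EReal} {z ξ : V} {a : EReal}
    (husc : UpperSemicontinuousOn (fun t : ℂ => φ (z + t • ξ)) (sphere 0 1))
    (htop : ∀ t ∈ sphere (0 : ℂ) 1, φ (z + t • ξ) < ⊤)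
    (h : ∀ p : Polynomial ℂ, (∀ t ∈ sphere (0 : ℂ) 1, φ (z + t • ξ) < ((p.eval t).re : EReal)) →
      a ≤ ((p.eval 0).re : EReal)) :
    a ≤ circleMean φ z ξ := by
  rw [circleMean_eq_comp_line]
  by_contra hlt
  obtain ⟨m, hm1, hm2⟩ := EReal.lt_iff_exists_real_btwn.1 (not_le.1 hlt)
  obtain ⟨p, hp1, hp2⟩ := exists_polynomial_of_circleMean_lt husc htop hm1
  exact absurd (hm2.trans_le (h p hp1)) (not_lt.2 (EReal.coe_le_coe_iff.2 hp2.le))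

end CircleMeans

/-! ### From submeans on complex lines to submeans on analytic discs -/

section WeaklyPsh

open Filter Topology Metric

/-- The mean value inequality on small circles in complex lines, where the bound on the radius may
depend on the line. -/
def HasSmallSubmeans {W : Type*} [AddCommGroup W] [Module ℂ W] (u : W → EReal) (p : W) : Prop :=
  ∀ η : W, ∃ r₀ > 0, ∀ r : ℝ, 0 < r → r < r₀ → u p ≤ circleMean u p ((r : ℂ) • η)

/-- `h - h c` has mean zero by the mean value property, so the cross term in `|h c + (h - h c)|²`
averages out. -/
theorem circleAverage_norm_sq_eq {h : ℂ → ℂ} {c : ℂ} {r : ℝ} (hr : 0 < r)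
    (hh : DiffContOnCl ℂ h (ball c r)) :
    Real.circleAverage (fun τ => ‖h τ‖ ^ 2) c r =
      ‖h c‖ ^ 2 + Real.circleAverage (fun τ => ‖h τ - h c‖ ^ 2) c r := by
  have hcont : ContinuousOn h (sphere c r) :=
    hh.continuousOn.mono (by rw [closure_ball _ hr.ne']; exact sphere_subset_closedBall)
  have h1 : DiffContOnCl ℂ (fun τ => starRingEnd ℂ (h c) * (h τ - h c)) (ball c r) := by
    have := (hh.sub_const (h c)).const_smul (starRingEnd ℂ (h c))
    exact this
  have hr' : |r| = r := abs_of_pos hr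
  have h2 : Real.circleAverage (fun τ => starRingEnd ℂ (h c) * (h τ - h c)) c r = 0 := by
    rw [DiffContOnCl.circleAverage (by rwa [hr'])]
    simp
  have hi1 : CircleIntegrable (fun τ => starRingEnd ℂ (h c) * (h τ - h c)) c r :=
    ContinuousOn.circleIntegrable hr.le (by fun_prop)
  have h3 : Real.circleAverage (fun τ => (starRingEnd ℂ (h c) * (h τ - h c)).re) c r = 0 := by
    have := Complex.reCLM.circleAverage_comp_comm hi1
    rw [h2, map_zero] at this
    exact this
  have h4 : (fun τ => ‖h τ‖ ^ 2) = fun τ => (‖h c‖ ^ 2 + ‖h τ - h c‖ ^ 2) +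
      (2 : ℝ) • (starRingEnd ℂ (h c) * (h τ - h c)).re := by
    ext τ
    simp only [← Complex.normSq_eq_norm_sq, Complex.normSq_apply, Complex.mul_re, Complex.conj_re,
      Complex.conj_im, Complex.sub_re, Complex.sub_im, smul_eq_mul]
    ring
  have hi2 : CircleIntegrable (fun τ => (2 : ℝ) • (starRingEnd ℂ (h c) * (h τ - h c)).re) c r :=
    ContinuousOn.circleIntegrable hr.le (by fun_prop)
  have hi3 : CircleIntegrable (fun τ => ‖h τ - h c‖ ^ 2) c r :=
    ContinuousOn.circleIntegrable hr.le (by fun_prop)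
  have hi4 : CircleIntegrable (fun τ => ‖h c‖ ^ 2 + ‖h τ - h c‖ ^ 2) c r :=
    (circleIntegrable_const _ _ _).add hi3
  rw [h4, Real.circleAverage_fun_add hi4 hi2,
    Real.circleAverage_fun_add (circleIntegrable_const _ _ _) hi3, Real.circleAverage_const,
    Real.circleAverage_fun_smul, h3]
  simp

theorem circleAverage_norm_sq (c : ℂ) {r : ℝ} (hr : 0 < r) :
    Real.circleAverage (fun τ : ℂ => ‖τ‖ ^ 2) c r = ‖c‖ ^ 2 + r ^ 2 := by
  have h1 := circleAverage_norm_sq_eq (h := fun τ => τ) (c := c) hr differentiable_id.diffContOnCl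
  rw [h1, Real.circleAverage_const_on_circle (a := r ^ 2)]
  intro x hx
  rw [mem_sphere_iff_norm, abs_of_pos hr] at hx
  rw [hx]

theorem UpperSemicontinuousOn.add_coe_real {α : Type*} [TopologicalSpace α] {K : Set α}
    {u : α → EReal} (hu : UpperSemicontinuousOn u K) {R : α → ℝ} (hR : ContinuousOn R K) :
    UpperSemicontinuousOn (fun x => u x + (R x : EReal)) K := by
  refine UpperSemicontinuousOn.add' hu (fun x hx => ?_) fun x _ => ?_
  · exact ((continuous_coe_real_ereal.continuousAt.comp_continuousWithinAt
      (hR x hx))).upperSemicontinuousWithinAt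
  · exact EReal.continuousAt_add (Or.inr (by simp)) (Or.inr (by simp))

theorem isClosed_setOf_coe_le_of_upperSemicontinuousOn {α : Type*} [TopologicalSpace α] {K : Set α}
    (hK : IsClosed K) {u : α → EReal} (hu : UpperSemicontinuousOn u K) {R : α → ℝ}
    (hR : ContinuousOn R K) : IsClosed {x | x ∈ K ∧ (R x : EReal) ≤ u x} := by
  rw [← closure_subset_iff_isClosed]
  intro z hz
  have hzK : z ∈ K := hK.closure_subset (closure_mono (fun x hx => hx.1) hz)
  refine ⟨hzK, not_lt.1 fun hlt => ?_⟩
  obtain ⟨m, hm1, hm2⟩ := EReal.lt_iff_exists_real_btwn.1 hlt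
  have h1 := hu z hzK m hm1
  have h2 : ∀ᶠ x in 𝓝[K] z, m < R x := (hR z hzK).eventually_const_lt (EReal.coe_lt_coe_iff.1 hm2)
  have h3 := eventually_nhdsWithin_iff.1 (h1.and h2)
  obtain ⟨x, hx1, hx2⟩ := mem_closure_iff_nhds.1 hz _ h3
  obtain ⟨h4, h5⟩ := hx1 hx2.1
  exact absurd (hx2.2.trans_lt h4) (not_lt.2 (EReal.coe_le_coe_iff.2 h5.le))

theorem norm_sub_tangent_le {W : Type*} [NormedAddCommGroup W] [NormedSpace ℂ W] {γ : ℂ → W} {t : ℂ}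
    (hγ : AnalyticAt ℂ γ t) :
    ∃ C > 0, ∃ ρ > 0, ∀ τ : ℂ, ‖τ - t‖ < ρ →
      ‖γ τ - γ t - (τ - t) • deriv γ t‖ ≤ C * ‖τ - t‖ ^ 2 := by
  obtain ⟨p, hp⟩ := hγ
  obtain ⟨C, hC, h1⟩ := (hp.isBigO_sub_partialSum_pow 2).exists_pos
  rw [Asymptotics.IsBigOWith] at h1
  obtain ⟨ρ, hρ, h2⟩ := Metric.eventually_nhds_iff.1 h1
  refine ⟨C, hC, ρ, hρ, fun τ hτ => ?_⟩
  have h3 := h2 (y := τ - t) (by simpa using hτ)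
  have h4 : p.partialSum 2 (τ - t) = γ t + (τ - t) • deriv γ t := by
    rw [FormalMultilinearSeries.partialSum, Finset.sum_range_succ, Finset.sum_range_one,
      hp.coeff_zero, hp.deriv, FormalMultilinearSeries.apply_eq_pow_smul_coeff]
    rw [pow_one]
    rfl
  rw [h4, add_sub_cancel] at h3
  simpa [sub_sub] using h3

/-- A function with small submeans on complex lines satisfies the mean value inequality on all
analytic discs. -/
theorem le_circleMean_comp_of_hasSmallSubmeans {W : Type*} [NormedAddCommGroup W] [NormedSpace ℂ W]
    [FiniteDimensional ℂ W] {u : W → EReal} {D : Set W} (hD : IsOpen D)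
    (husc : UpperSemicontinuousOn u D) (htop : ∀ x ∈ D, u x < ⊤)
    (hu : ∀ x ∈ D, HasSmallSubmeans u x) {γ : ℂ → W}
    (hγ : AnalyticOnNhd ℂ γ (closedBall 0 1)) (hγD : MapsTo γ (closedBall 0 1) D) :
    u (γ 0) ≤ circleMean (fun t => u (γ t)) 0 1 := by
  have : ProperSpace W := FiniteDimensional.proper ℂ W
  have hγc : ContinuousOn γ (closedBall 0 1) := hγ.continuousOn
  have hsub : sphere (0 : ℂ) 1 ⊆ closedBall 0 1 := sphere_subset_closedBall
  refine le_circleMean_of_forall_polynomial ?_ ?_ ?_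
  · simp only [smul_eq_mul, mul_one, zero_add]
    intro t ht y hy
    exact (((hγc t (hsub ht)).mono hsub).tendsto_nhdsWithin (hγD.mono_left hsub)).eventually
      (husc _ (hγD (hsub ht)) y hy)
  · intro t ht
    simpa using htop _ (hγD (hsub ht))
  intro p hp
  simp only [smul_eq_mul, mul_one, zero_add] at hp
  by_contra hlt
  obtain ⟨m, hm1, hm2⟩ := EReal.lt_iff_exists_real_btwn.1 (not_le.1 hlt)
  rw [EReal.coe_lt_coe_iff] at hm1
  -- `q` below is a strictly superharmonic modification of `Re p`: equal to it on the unit circle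
  -- and equal to `m` at the centre. Its term `-c |t|²` loses `c r²` on a circle of radius `r`,
  -- which will produce the contradiction.
  set c := m - (p.eval 0).re with hc
  have hcpos : 0 < c := by linarith
  set q : ℂ → ℝ := fun t => (p.eval t).re - c * ‖t‖ ^ 2 + c with hq
  have hpcont : Continuous fun t : ℂ => p.eval t := p.continuous
  have hqcont : Continuous q := by fun_prop
  set b := Module.finBasis ℂ W with hb
  set ℓ : Fin (Module.finrank ℂ W) → W →L[ℂ] ℂ := fun i => LinearMap.toContinuousLinearMap (b.coord i)
    with hℓ
  set S : W → ℝ := fun x => ∑ i, ‖ℓ i x‖ ^ 2 with hS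
  have hScont : Continuous S := by fun_prop
  have hSnn : ∀ x, 0 ≤ S x := fun x => Finset.sum_nonneg fun i _ => by positivity
  have hS0 : ∀ x, S x = 0 → x = 0 := by
    intro x hx
    rw [hS, Finset.sum_eq_zero_iff_of_nonneg (fun i _ => by positivity)] at hx
    refine b.ext_elem fun i => ?_
    have := hx i (Finset.mem_univ i)
    simpa [hℓ] using this
  have hcomp : IsCompact (γ '' closedBall 0 1) := (isCompact_closedBall 0 1).image_of_continuousOn hγc
  obtain ⟨δ, hδ, hK⟩ := hcomp.exists_cthickening_subset_open hD (mapsTo_iff_image_subset.1 hγD)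
  set K := cthickening δ (γ '' closedBall 0 1) with hKdef
  have hKc : IsCompact K := hcomp.cthickening
  set O := thickening δ (γ '' closedBall 0 1) with hO
  have hOo : IsOpen O := isOpen_thickening
  have hOK : O ⊆ K := thickening_subset_cthickening _ _
  have hγO : MapsTo γ (closedBall 0 1) O :=
    fun t ht => self_subset_thickening hδ _ (mem_image_of_mem _ ht)
  set L : Set (W × ℂ) := K ×ˢ closedBall 0 1 with hL
  have hLc : IsCompact L := hKc.prod (isCompact_closedBall 0 1)
  -- The second term penalises the distance to the graph of `γ`. Maximising `u - Q j` off the graph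
  -- replaces any regularization of `u`.
  set Q : ℕ → W × ℂ → ℝ := fun j z => q z.2 + j * S (z.1 - γ z.2) with hQ
  have hγ2 : ContinuousOn (fun z : W × ℂ => γ z.2) L := hγc.comp continuousOn_snd fun z hz => hz.2
  have hQcont (j : ℕ) : ContinuousOn (Q j) L := by
    have h1 : ContinuousOn (fun z : W × ℂ => S (z.1 - γ z.2)) L :=
      hScont.comp_continuousOn (continuousOn_fst.sub hγ2)
    have h2 : Continuous fun z : W × ℂ => q z.2 := hqcont.comp continuous_snd
    exact h2.continuousOn.add (continuousOn_const.mul h1)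
  have huL : UpperSemicontinuousOn (fun z : W × ℂ => u z.1) L := by
    intro z hz y hy
    exact (continuousWithinAt_fst.tendsto_nhdsWithin fun z hz => hK hz.1).eventually
      (husc _ (hK hz.1) y hy)
  -- Boundary points at which `u ≥ Q j`. These compact sets decrease with `j`; a common point would
  -- lie on the graph, hence over the unit circle, where `u < Re p = q`. So for some `j` the maximum
  -- is interior.
  set A : ℕ → Set (W × ℂ) := fun j =>
    {z | z ∈ L ∧ (Q j z : EReal) ≤ u z.1} ∩ {z | 1 ≤ ‖z.2‖ ∨ z.1 ∈ Oᶜ} with hA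
  have hAclosed (j : ℕ) : IsClosed (A j) := by
    refine (isClosed_setOf_coe_le_of_upperSemicontinuousOn hLc.isClosed huL (hQcont j)).inter ?_
    exact (isClosed_le continuous_const continuous_snd.norm).union
      (hOo.isClosed_compl.preimage continuous_fst)
  obtain ⟨j, hj⟩ : ∃ j, A j = ∅ := by
    by_contra hne
    push Not at hne
    obtain ⟨z, hz⟩ := IsCompact.nonempty_iInter_of_sequence_nonempty_isCompact_isClosed A (by
      rintro j z ⟨⟨h1, h2⟩, h3⟩
      refine ⟨⟨h1, le_trans (EReal.coe_le_coe_iff.2 ?_) h2⟩, h3⟩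
      simp only [hQ]
      have := hSnn (z.1 - γ z.2)
      push_cast
      nlinarith) hne
      (hLc.of_isClosed_subset (hAclosed 0) fun z hz => hz.1.1) hAclosed
    rw [mem_iInter] at hz
    have hzL : z ∈ L := (hz 0).1.1
    have hzQ : ∀ j : ℕ, q z.2 + j * S (z.1 - γ z.2) ≤ (u z.1).toReal := fun j => by
      rw [← EReal.coe_le_coe_iff]
      exact (hz j).1.2.trans (EReal.le_coe_toReal (htop _ (hK hzL.1)).ne)
    have hS1 : S (z.1 - γ z.2) = 0 := by
      by_contra hne
      have hpos : 0 < S (z.1 - γ z.2) := lt_of_le_of_ne (hSnn _) (Ne.symm hne)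
      obtain ⟨j, hj⟩ := exists_nat_gt (((u z.1).toReal - q z.2) / S (z.1 - γ z.2))
      rw [div_lt_iff₀ hpos] at hj
      linarith [hzQ j]
    have hz1 : z.1 = γ z.2 := sub_eq_zero.1 (hS0 _ hS1)
    have hz2 : (q z.2 : EReal) ≤ u (γ z.2) := by
      have := (hz 0).1.2
      rw [← hz1]
      simpa [hQ] using this
    rcases (hz 0).2 with h1 | h1
    · have h2 : ‖z.2‖ = 1 := le_antisymm (by simpa using hzL.2) h1
      have h3 := hp z.2 (by simpa using h2)
      refine absurd (hz2.trans_lt h3) (not_lt.2 (EReal.coe_le_coe_iff.2 ?_))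
      simp [hq, h2]
    · exact h1 (by rw [hz1]; exact hγO hzL.2)
  have h0L : (γ 0, (0 : ℂ)) ∈ L := ⟨hOK (hγO (by simp)), by simp⟩
  obtain ⟨z₁, hz₁L, hmax⟩ := (huL.add_coe_real (hQcont j).neg).exists_isMaxOn ⟨_, h0L⟩ hLc
  have hu1 : 0 < u z₁.1 + ((-Q j z₁ : ℝ) : EReal) := by
    refine lt_of_lt_of_le ?_ (hmax h0L)
    have h1 : Q j (γ 0, 0) = m := by simp [hQ, hq, hS, hc]
    simp only [Pi.neg_apply, h1]
    have h2 := EReal.add_lt_add_of_lt_of_le hm2 (le_refl ((-m : ℝ) : EReal)) (by simp) (by simp)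
    rwa [← EReal.coe_add, add_neg_cancel, EReal.coe_zero] at h2
  obtain ⟨a, ha⟩ : ∃ a : ℝ, u z₁.1 = a := by
    induction h : u z₁.1 with
    | bot => rw [h] at hu1; simp at hu1
    | top => exact absurd (htop _ (hK hz₁L.1)) (by simp [h])
    | coe x => exact ⟨x, rfl⟩
  have hQa : Q j z₁ < a := by
    rw [ha, ← EReal.coe_add, ← EReal.coe_zero, EReal.coe_lt_coe_iff] at hu1
    linarith
  have hle : ∀ z ∈ L, u z.1 ≤ ((a - Q j z₁ + Q j z : ℝ) : EReal) := by
    intro z hz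
    have h1 : u z.1 + ((-Q j z : ℝ) : EReal) ≤ u z₁.1 + ((-Q j z₁ : ℝ) : EReal) := hmax hz
    rw [ha] at h1
    induction h : u z.1 with
    | bot => exact bot_le
    | top => exact absurd (htop _ (hK hz.1)) (by simp [h])
    | coe x =>
      rw [h, ← EReal.coe_add, ← EReal.coe_add, EReal.coe_le_coe_iff] at h1
      rw [EReal.coe_le_coe_iff]
      linarith
  have hint : ‖z₁.2‖ < 1 ∧ z₁.1 ∈ O := by
    by_contra hcon
    have : z₁ ∈ A j := by
      refine ⟨⟨hz₁L, by rw [ha]; exact EReal.coe_le_coe_iff.2 hQa.le⟩, ?_⟩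
      by_contra h
      simp only [mem_ofPred_eq, not_or, not_le, mem_compl_iff, not_not] at h
      exact hcon h
    rw [hj] at this
    exact this
  obtain ⟨⟨x₁, t₁⟩, hxt⟩ : ∃ z : W × ℂ, z = z₁ := ⟨z₁, rfl⟩
  rw [← hxt] at hint ha hle hQa
  simp only at hint ha
  set η := deriv γ t₁ with hη
  have ht₁ : t₁ ∈ closedBall (0 : ℂ) 1 := by simpa using hint.1.le
  obtain ⟨C, hC, ρ₁, hρ₁, htan⟩ := norm_sub_tangent_le (hγ t₁ ht₁)
  obtain ⟨ρ₂, hρ₂, hball⟩ : ∃ ρ > 0, ∀ s : ℂ, ‖s‖ < ρ → x₁ + s • η ∈ K ∧ t₁ + s ∈ ball (0 : ℂ) 1 := by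
    have h1 : Tendsto (fun s : ℂ => x₁ + s • η) (𝓝 0) (𝓝 x₁) := by
      have : Continuous fun s : ℂ => x₁ + s • η := by fun_prop
      simpa using this.tendsto 0
    have h2 : Tendsto (fun s : ℂ => t₁ + s) (𝓝 0) (𝓝 t₁) := by
      have : Continuous fun s : ℂ => t₁ + s := by fun_prop
      simpa using this.tendsto 0
    have h3 := (h1.eventually (hOo.mem_nhds hint.2)).and
      (h2.eventually (isOpen_ball.mem_nhds (x := t₁) (s := ball (0 : ℂ) 1) (by simpa using hint.1)))
    obtain ⟨ρ, hρ, h4⟩ := Metric.eventually_nhds_iff.1 h3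
    exact ⟨ρ, hρ, fun s hs => ⟨hOK (h4 (by simpa using hs)).1, (h4 (by simpa using hs)).2⟩⟩
  obtain ⟨r₀, hr₀, hsm⟩ := hu x₁ (hK (hOK hint.2)) η
  set M := (∑ i, ‖ℓ i‖ ^ 2) * C ^ 2 with hM
  have hM0 : 0 ≤ M := mul_nonneg (Finset.sum_nonneg fun i _ => by positivity) (by positivity)
  -- Here `k τ`, the displacement from the graph, has zero derivative at `t₁`. Hence the mean of `S
  -- ∘ k` exceeds its central value by at most `M r⁴`, against the loss `c r²` in `q`.
  have key : ∀ r : ℝ, 0 < r → r < r₀ → r < ρ₁ → r < ρ₂ → c * r ^ 2 ≤ j * (M * r ^ 4) := by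
    intro r hr h1 h2 h3
    set k : ℂ → W := fun τ => x₁ + (τ - t₁) • η - γ τ with hk
    set B : ℂ → ℝ := fun τ => (a - Q j (x₁, t₁)) + ((p.eval τ).re + (-c) • ‖τ‖ ^ 2 + c) +
      (j : ℝ) • S (k τ) with hB
    have hcb : closedBall t₁ r ⊆ ball (0 : ℂ) 1 := by
      intro τ hτ
      have := (hball (τ - t₁) (lt_of_le_of_lt (by simpa [dist_eq_norm] using hτ) h3)).2
      simpa using this
    have hkd : DifferentiableOn ℂ k (closedBall t₁ r) := by
      have : DifferentiableOn ℂ γ (closedBall t₁ r) :=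
        hγ.differentiableOn.mono (hcb.trans ball_subset_closedBall)
      fun_prop
    have hkc : ContinuousOn k (sphere t₁ r) := hkd.continuousOn.mono sphere_subset_closedBall
    have hmean : circleMean u x₁ ((r : ℂ) • η) ≤ ((Real.circleAverage B t₁ r : ℝ) : EReal) := by
      rw [Real.circleAverage_eq_circleAverage_zero_one]
      have hmap : MapsTo (fun z : ℂ => (r : ℂ) * z + t₁) (sphere 0 1) (sphere t₁ r) := by
        intro z hz
        have : ‖z‖ = 1 := by simpa using hz
        simp [this, abs_of_pos hr]
      refine circleMean_le_circleAverage ?_ ?_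
      · have hBc : ContinuousOn B (sphere t₁ r) := by fun_prop
        exact hBc.comp (by fun_prop) hmap
      · intro t ht
        have hb1 := hball ((r : ℂ) * t) (by
          have : ‖t‖ = 1 := by simpa using ht
          simpa [this, abs_of_pos hr] using h3)
        have hb2 := hle (x₁ + ((r : ℂ) * t) • η, t₁ + (r : ℂ) * t)
          ⟨hb1.1, ball_subset_closedBall hb1.2⟩
        simp only at hb2
        rw [smul_smul, mul_comm t]
        refine hb2.trans_eq ?_
        simp only [hB, hQ, hk, hq, smul_eq_mul, EReal.coe_eq_coe_iff]
        rw [show (r : ℂ) * t + t₁ - t₁ = r * t by ring, show (r : ℂ) * t + t₁ = t₁ + r * t by ring]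
        ring
    have hS2 : Real.circleAverage (fun τ => S (k τ)) t₁ r ≤ S (k t₁) + M * r ^ 4 := by
      have e1 : Real.circleAverage (fun τ => S (k τ)) t₁ r =
          ∑ i, Real.circleAverage (fun τ => ‖ℓ i (k τ)‖ ^ 2) t₁ r :=
        Real.circleAverage_fun_sum (fun i _ => ContinuousOn.circleIntegrable hr.le (by fun_prop))
      rw [e1, hS, hM, Finset.sum_mul, Finset.sum_mul, ← Finset.sum_add_distrib]
      refine Finset.sum_le_sum fun i _ => ?_
      rw [circleAverage_norm_sq_eq hr (h := fun τ => ℓ i (k τ))]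
      · refine add_le_add le_rfl ?_
        refine Real.circleAverage_mono_on_of_le_circle
          (ContinuousOn.circleIntegrable hr.le (by fun_prop)) ?_
        intro τ hτ
        rw [abs_of_pos hr, mem_sphere_iff_norm] at hτ
        have h5 := htan τ (by rw [hτ]; exact h2)
        rw [hτ] at h5
        have h6 : k τ - k t₁ = -(γ τ - γ t₁ - (τ - t₁) • η) := by simp only [hk]; simp; abel
        have h7 : ‖ℓ i (k τ) - ℓ i (k t₁)‖ ≤ ‖ℓ i‖ * (C * r ^ 2) := by
          rw [← map_sub, h6]
          refine ((ℓ i).le_opNorm _).trans ?_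
          rw [norm_neg]
          gcongr
        calc ‖ℓ i (k τ) - ℓ i (k t₁)‖ ^ 2 ≤ (‖ℓ i‖ * (C * r ^ 2)) ^ 2 := by gcongr
          _ = ‖ℓ i‖ ^ 2 * C ^ 2 * r ^ 4 := by ring
      · have : DifferentiableOn ℂ (fun τ => ℓ i (k τ)) (closedBall t₁ r) := by fun_prop
        exact DifferentiableOn.diffContOnCl (by rwa [closure_ball _ hr.ne'])
    have hi1 : CircleIntegrable (fun τ : ℂ => (p.eval τ).re) t₁ r :=
      Continuous.continuousOn (by fun_prop) |>.circleIntegrable hr.le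
    have hi2 : CircleIntegrable (fun τ : ℂ => (-c) • ‖τ‖ ^ 2) t₁ r :=
      Continuous.continuousOn (by fun_prop) |>.circleIntegrable hr.le
    have hi3 : CircleIntegrable (fun τ : ℂ => (j : ℝ) • S (k τ)) t₁ r :=
      ContinuousOn.circleIntegrable hr.le (by fun_prop)
    have hBavg : Real.circleAverage B t₁ r = (a - Q j (x₁, t₁)) +
        ((p.eval t₁).re + (-c) * (‖t₁‖ ^ 2 + r ^ 2) + c) +
        j * Real.circleAverage (fun τ => S (k τ)) t₁ r := by
      have hi4 : CircleIntegrable (fun τ : ℂ => (p.eval τ).re + (-c) • ‖τ‖ ^ 2) t₁ r := hi1.add hi2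
      have hi5 : CircleIntegrable (fun τ : ℂ => (p.eval τ).re + (-c) • ‖τ‖ ^ 2 + c) t₁ r :=
        hi4.add (circleIntegrable_const _ _ _)
      have hi6 : CircleIntegrable (fun τ : ℂ => (a - Q j (x₁, t₁)) +
          ((p.eval τ).re + (-c) • ‖τ‖ ^ 2 + c)) t₁ r := (circleIntegrable_const _ _ _).add hi5
      rw [hB, Real.circleAverage_fun_add hi6 hi3,
        Real.circleAverage_fun_add (circleIntegrable_const _ _ _) hi5,
        Real.circleAverage_fun_add hi4 (circleIntegrable_const _ _ _),
        Real.circleAverage_fun_add hi1 hi2, Real.circleAverage_const, Real.circleAverage_const,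
        Real.circleAverage_fun_smul, Real.circleAverage_fun_smul, polynomial_circleAverage_re,
        circleAverage_norm_sq _ hr]
      simp
    have hfin := (hsm r hr h1).trans hmean
    rw [ha, EReal.coe_le_coe_iff, hBavg] at hfin
    have hQ1 : Q j (x₁, t₁) = (p.eval t₁).re - c * ‖t₁‖ ^ 2 + c + j * S (k t₁) := by
      simp [hQ, hq, hk]
    have hj0 : (0 : ℝ) ≤ j := Nat.cast_nonneg j
    have := mul_le_mul_of_nonneg_left hS2 hj0
    rw [hQ1] at hfin
    linarith
  -- For `r = R / 2` the bounds `r < 1` and `r < c / (j M + 1)` give `j M r² < c`.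
  set R := min (min r₀ ρ₁) (min ρ₂ (c / (j * M + 1) ⊓ 1)) with hR
  have hjM : 0 ≤ j * M := mul_nonneg (Nat.cast_nonneg j) hM0
  have hRpos : 0 < R := by
    refine lt_min (lt_min hr₀ hρ₁) (lt_min hρ₂ (lt_min (by positivity) one_pos))
  have hR1 : R / 2 < R := half_lt_self hRpos
  have := key (R / 2) (by positivity)
    (hR1.trans_le ((min_le_left _ _).trans (min_le_left _ _)))
    (hR1.trans_le ((min_le_left _ _).trans (min_le_right _ _)))
    (hR1.trans_le ((min_le_right _ _).trans (min_le_left _ _)))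
  have h8 : R / 2 < c / (j * M + 1) :=
    hR1.trans_le ((min_le_right _ _).trans ((min_le_right _ _).trans (min_le_left _ _)))
  have h9 : R / 2 < 1 :=
    hR1.trans_le ((min_le_right _ _).trans ((min_le_right _ _).trans (min_le_right _ _)))
  rw [lt_div_iff₀ (by positivity)] at h8
  have hr0 : 0 < R / 2 := by positivity
  generalize R / 2 = r at *
  have h10 : c * r ^ 2 ≤ (j * M * r ^ 2) * r ^ 2 := by linarith
  have h11 : c ≤ j * M * r ^ 2 := le_of_mul_le_mul_right h10 (by positivity)
  nlinarith

end WeaklyPsh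

/-! ### Countable exceptional sets in the disc -/

section Removable

open Filter Topology Metric

/-- The nonnegative logarithmic potential `-log (|t - e| / 2)` on the unit disc. -/
noncomputable def negLogPotential (e t : ℂ) : ℝ≥0∞ := (-ENNReal.log (ENNReal.ofReal (‖t - e‖ / 2))).toENNReal

theorem continuous_negLogPotential (e : ℂ) : Continuous (negLogPotential e) := by
  unfold negLogPotential
  have h1 : Continuous fun t : ℂ => ENNReal.ofReal (‖t - e‖ / 2) :=
    ENNReal.continuous_ofReal.comp (by fun_prop)
  exact EReal.continuous_toENNReal.comp (continuous_neg.comp (ENNReal.continuous_log.comp h1))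

theorem negLogPotential_self (e : ℂ) : negLogPotential e e = ⊤ := by
  simp [negLogPotential]

theorem negLogPotential_of_ne {e t : ℂ} (h : t ≠ e) :
    negLogPotential e t = ENNReal.ofReal (Real.log 2 - Real.log ‖t - e‖) := by
  have h1 : 0 < ‖t - e‖ := norm_pos_iff.2 (sub_ne_zero.2 h)
  rw [negLogPotential, ENNReal.log_ofReal_of_pos (by positivity), ← EReal.coe_neg,
    EReal.real_coe_toENNReal, Real.log_div h1.ne' two_ne_zero, neg_sub]

/-- This is superharmonicity of the potential, from the explicit mean of `log |t - e|` over a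
circle. The division by `2` in `negLogPotential` keeps its logarithm nonpositive on the closed unit
disc, so no truncation at `0` takes place there. -/
theorem lintegral_negLogPotential_le {e t₀ : ℂ} {r : ℝ} (hr : 0 < r) (he : ‖e‖ ≤ 1)
    (hball : closedBall t₀ r ⊆ closedBall 0 1) :
    ENNReal.ofReal (2 * Real.pi)⁻¹ * ∫⁻ θ in Ioc 0 (2 * Real.pi), negLogPotential e (circleMap t₀ r θ) ≤
      negLogPotential e t₀ := by
  by_cases het : t₀ = e
  · rw [het, negLogPotential_self]; exact le_top
  have hpi : (0 : ℝ) < 2 * Real.pi := by positivity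
  have hci : CircleIntegrable (fun t => Real.log ‖t - e‖) t₀ r := 
    MeromorphicOn.circleIntegrable_log_norm (fun _ _ => by fun_prop)
  have hint : IntegrableOn (fun θ => Real.log ‖circleMap t₀ r θ - e‖) (Ioc 0 (2 * Real.pi)) := by
    have := hci.def'
    rwa [uIoc_of_le hpi.le] at this
  have hint2 : IntegrableOn (fun θ => Real.log 2 - Real.log ‖circleMap t₀ r θ - e‖)
    (Ioc 0 (2 * Real.pi)) := (integrable_const _).sub hint
  have hnn (θ : ℝ) : 0 ≤ Real.log 2 - Real.log ‖circleMap t₀ r θ - e‖ := by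
    by_cases h0 : ‖circleMap t₀ r θ - e‖ = 0
    · rw [h0, Real.log_zero]; simpa using Real.log_nonneg (by norm_num)
    · have h1 := hball (sphere_subset_closedBall (circleMap_mem_sphere t₀ hr.le θ))
      rw [sub_nonneg]
      refine Real.log_le_log (lt_of_le_of_ne (norm_nonneg _) (Ne.symm h0)) ?_
      refine (norm_sub_le _ _).trans ?_
      rw [mem_closedBall_zero_iff] at h1
      linarith
  have hae : ∀ᵐ θ ∂(volume.restrict (Ioc 0 (2 * Real.pi))), circleMap t₀ r θ ≠ e := by
    refine ae_restrict_of_ae ?_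
    have : (circleMap t₀ r ⁻¹' {e}).Countable := (countable_singleton e).preimage_circleMap t₀ hr.ne'
    exact this.ae_notMem volume
  have h2 : ∫⁻ θ in Ioc 0 (2 * Real.pi), negLogPotential e (circleMap t₀ r θ) =
      ∫⁻ θ in Ioc 0 (2 * Real.pi), ENNReal.ofReal (Real.log 2 - Real.log ‖circleMap t₀ r θ - e‖) := by
    refine lintegral_congr_ae ?_
    filter_upwards [hae] with θ hθ using negLogPotential_of_ne hθ
  rw [h2, ← ofReal_integral_eq_lintegral_ofReal hint2 (Eventually.of_forall hnn),
    ← ENNReal.ofReal_mul (by positivity), negLogPotential_of_ne het]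
  refine ENNReal.ofReal_le_ofReal ?_
  have h3 : Real.circleAverage (fun t => Real.log ‖t - e‖) t₀ r = (2 * Real.pi)⁻¹ *
      ∫ θ in Ioc 0 (2 * Real.pi), Real.log ‖circleMap t₀ r θ - e‖ := by
    rw [Real.circleAverage_def, intervalIntegral.integral_of_le hpi.le, smul_eq_mul]
  have h4 : Real.log ‖t₀ - e‖ ≤ Real.circleAverage (fun t => Real.log ‖t - e‖) t₀ r := by
    rw [circleAverage_log_norm_sub_const_eq_log_radius_add_posLog hr.ne']
    have h5 : 0 < ‖t₀ - e‖ := norm_pos_iff.2 (sub_ne_zero.2 het)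
    have h6 : Real.log (r⁻¹ * ‖t₀ - e‖) ≤ Real.posLog (r⁻¹ * ‖t₀ - e‖) := le_max_right _ _
    rw [Real.log_mul (by positivity) h5.ne', Real.log_inv] at h6
    linarith
  rw [integral_sub (integrable_const _) hint, mul_sub, ← h3]
  simp only [integral_const, MeasurableSet.univ, measureReal_restrict_apply, univ_inter,
    Real.volume_real_Ioc, sub_zero, max_eq_left hpi.le, smul_eq_mul]
  rw [← mul_assoc, inv_mul_cancel₀ hpi.ne', one_mul]
  linarith

/-- Countable sets are removable for the mean value inequality of upper semicontinuous functions
on a disc, at points outside of the exceptional set. -/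
theorem le_circleMean_of_countable_exceptions {v : ℂ → EReal}
    (husc : UpperSemicontinuousOn v (closedBall 0 1)) (htop : ∀ t ∈ closedBall (0 : ℂ) 1, v t < ⊤)
    {E : Set ℂ} (hE : E.Countable) (h0 : (0 : ℂ) ∉ E)
    (hsub : ∀ t ∈ ball (0 : ℂ) 1, t ∉ E → HasSmallSubmeans v t) :
    v 0 ≤ circleMean v 0 1 := by
  have hsph : sphere (0 : ℂ) 1 ⊆ closedBall 0 1 := sphere_subset_closedBall
  refine le_circleMean_of_forall_polynomial ?_ ?_ ?_
  · simpa using husc.mono hsph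
  · intro t ht
    simpa using htop _ (hsph ht)
  intro p hp
  simp only [smul_eq_mul, mul_one, zero_add] at hp
  by_contra hlt
  obtain ⟨m, hm1, hm2⟩ := EReal.lt_iff_exists_real_btwn.1 (not_le.1 hlt)
  rw [EReal.coe_lt_coe_iff] at hm1
  set c := m - (p.eval 0).re with hc
  have hcpos : 0 < c := by linarith
  set q : ℂ → ℝ := fun t => (p.eval t).re - c * ‖t‖ ^ 2 + c with hq
  have hpcont : Continuous fun t : ℂ => p.eval t := p.continuous
  have hqcont : Continuous q := by fun_prop
  have hq0 : q 0 = m := by simp [hq, hc]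
  obtain ⟨m', hm3, hm4⟩ := EReal.lt_iff_exists_real_btwn.1 hm2
  rw [EReal.coe_lt_coe_iff] at hm3
  let ι := {e : ℂ // e ∈ E ∧ ‖e‖ ≤ 1}
  have : Countable ι := (hE.mono fun e (he : e ∈ E ∧ ‖e‖ ≤ 1) => he.1).to_subtype
  -- Each potential is finite at `0` because `0 ∉ E`, so small positive weights keep the total at
  -- `0` below the room `m' - m`, while the sum is infinite on `E`.
  obtain ⟨δ, hδ, hsum⟩ := ENNReal.exists_pos_tsum_mul_lt_of_countable (ε := ENNReal.ofReal (m' - m))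
    (by simpa using hm3) (fun e : ι => negLogPotential e 0) fun e => by
      have hne : (0 : ℂ) ≠ e := fun h => h0 (by rw [h]; exact e.2.1)
      rw [negLogPotential_of_ne hne]
      exact ENNReal.ofReal_ne_top
  set N : ℂ → ℝ≥0∞ := fun t => ∑' e : ι, negLogPotential e t * δ e with hN
  have hNlsc : LowerSemicontinuous N := lowerSemicontinuous_tsum fun e =>
    (ENNReal.continuous_mul_const (ENNReal.coe_ne_top) |>.comp
      (continuous_negLogPotential e)).lowerSemicontinuous
  have hNE : ∀ t ∈ E, ‖t‖ ≤ 1 → N t = ⊤ := by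
    intro t ht ht1
    refine top_le_iff.1 (le_trans ?_ (ENNReal.le_tsum (⟨t, ht, ht1⟩ : ι)))
    rw [negLogPotential_self, ENNReal.top_mul (by exact_mod_cast (hδ _).ne')]
  have hNmean : ∀ (t₀ : ℂ) (r : ℝ), 0 < r → closedBall t₀ r ⊆ closedBall 0 1 →
      ENNReal.ofReal (2 * Real.pi)⁻¹ * ∫⁻ θ in Ioc 0 (2 * Real.pi), N (circleMap t₀ r θ) ≤ N t₀ := by
    intro t₀ r hr hb
    have hmeas (e : ι) : Measurable fun θ => negLogPotential e (circleMap t₀ r θ) :=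
      ((continuous_negLogPotential e).comp (continuous_circleMap t₀ r)).measurable
    simp only [hN]
    rw [lintegral_tsum fun e => ((hmeas e).mul_const _).aemeasurable, ← ENNReal.tsum_mul_left]
    refine ENNReal.tsum_le_tsum fun e => ?_
    rw [lintegral_mul_const _ (hmeas e), ← mul_assoc]
    gcongr
    exact lintegral_negLogPotential_le hr e.2.2 hb
  -- Subtracting `N` forces the positive maximum of `v - q - N` away from `E`, so the submean
  -- inequality is available there.
  have hF : UpperSemicontinuousOn (fun t => (v t + ((-q t : ℝ) : EReal)) + (-(N t : EReal)))
      (closedBall 0 1) := by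
    refine UpperSemicontinuousOn.add' (husc.add_coe_real hqcont.neg.continuousOn) ?_ ?_
    · intro t _ y hy
      have h1 : -y < (N t : EReal) := EReal.neg_lt_comm.1 hy
      have h2 : LowerSemicontinuous fun t => (N t : EReal) := 
        continuous_coe_ennreal_ereal.comp_lowerSemicontinuous hNlsc EReal.coe_ennreal_strictMono.monotone
      filter_upwards [mem_nhdsWithin_of_mem_nhds (h2 t _ h1)] with s hs
      exact EReal.neg_lt_comm.1 hs
    · intro t ht
      refine EReal.continuousAt_add (Or.inl ?_) (Or.inr ?_)
      · exact (EReal.add_lt_top (htop t ht).ne (by simp)).ne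
      · simp
  obtain ⟨t₁, ht₁, hmax⟩ := hF.exists_isMaxOn ⟨0, by simp⟩ (isCompact_closedBall (0 : ℂ) 1)
  have hpos : 0 < (v t₁ + ((-q t₁ : ℝ) : EReal)) + (-(N t₁ : EReal)) := by
    refine lt_of_lt_of_le ?_ (hmax (show (0 : ℂ) ∈ closedBall (0 : ℂ) 1 by simp))
    simp only [hq0]
    have hN0 : N 0 < ENNReal.ofReal (m' - m) := hsum
    lift N 0 to NNReal using hN0.ne_top with ν hν
    have h1 : (ν : ℝ) < m' - m := by
      rw [← ENNReal.ofReal_coe_nnreal] at hN0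
      exact (ENNReal.ofReal_lt_ofReal_iff (by linarith)).1 hN0
    cases hv : v 0 with
    | bot => rw [hv] at hm4; simp at hm4
    | top => exact absurd (htop 0 (by simp)) (by simp [hv])
    | coe x =>
      rw [hv, EReal.coe_lt_coe_iff] at hm4
      change (0 : EReal) < (x : EReal) + ((-m : ℝ) : EReal) + -((ν : ℝ) : EReal)
      rw [← EReal.coe_neg, ← EReal.coe_add, ← EReal.coe_add, ← EReal.coe_zero,
        EReal.coe_lt_coe_iff]
      linarith
  obtain ⟨ν, hν⟩ : ∃ ν : NNReal, N t₁ = ν := by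
    cases h : N t₁ with
    | top => rw [h] at hpos; simp at hpos
    | coe x => exact ⟨x, rfl⟩
  obtain ⟨a, ha⟩ : ∃ a : ℝ, v t₁ = a := by
    cases h : v t₁ with
    | bot => rw [h] at hpos; simp at hpos
    | top => exact absurd (htop _ ht₁) (by simp [h])
    | coe x => exact ⟨x, rfl⟩
  rw [hν, ha] at hpos
  have hpos' : 0 < a - q t₁ - ν := by
    change (0 : EReal) < (a : EReal) + ((-q t₁ : ℝ) : EReal) + -((ν : ℝ) : EReal) at hpos
    rw [← EReal.coe_neg, ← EReal.coe_add, ← EReal.coe_add, ← EReal.coe_zero,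
        EReal.coe_lt_coe_iff] at hpos
    linarith
  have hν0 : (0 : ℝ) ≤ ν := ν.2
  have hle : ∀ t ∈ closedBall (0 : ℂ) 1, N t ≠ ⊤ →
      v t ≤ ((a - q t₁ - ν + q t + (N t).toReal : ℝ) : EReal) := by
    intro t ht hNt
    have h1 : (v t + ((-q t : ℝ) : EReal)) + (-(N t : EReal)) ≤
      (v t₁ + ((-q t₁ : ℝ) : EReal)) + (-(N t₁ : EReal)) := hmax ht
    lift N t to NNReal using hNt with κ
    rw [hν, ha] at h1
    cases h : v t with
    | bot => exact bot_le
    | top => exact absurd (htop _ ht) (by simp [h])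
    | coe x =>
      rw [h] at h1
      change (x : EReal) + ((-q t : ℝ) : EReal) + -((κ : ℝ) : EReal) ≤
        (a : EReal) + ((-q t₁ : ℝ) : EReal) + -((ν : ℝ) : EReal) at h1
      rw [← EReal.coe_neg, ← EReal.coe_add, ← EReal.coe_add, ← EReal.coe_neg, ← EReal.coe_add,
        ← EReal.coe_add, EReal.coe_le_coe_iff] at h1
      rw [EReal.coe_le_coe_iff]
      simp only [ENNReal.coe_toReal]
      linarith
  have ht1 : ‖t₁‖ < 1 := by
    refine lt_of_le_of_ne (by simpa using ht₁) fun h => ?_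
    have h1 := hp t₁ (by simpa using h)
    rw [ha, EReal.coe_lt_coe_iff] at h1
    simp only [hq, h] at hpos'
    linarith
  have htE : t₁ ∉ E := fun h => by
    have := hNE t₁ h ht1.le
    rw [hν] at this
    exact ENNReal.coe_ne_top this
  obtain ⟨r₀, hr₀, hsm⟩ := hsub t₁ (by simpa using ht1) htE 1
  set r := min r₀ (1 - ‖t₁‖) / 2 with hr
  have hrpos : 0 < r := by
    have : 0 < min r₀ (1 - ‖t₁‖) := lt_min hr₀ (by linarith)
    positivity
  have hr1 : r < r₀ := by
    have := min_le_left r₀ (1 - ‖t₁‖)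
    linarith
  have hr2 : closedBall t₁ r ⊆ closedBall 0 1 := by
    refine closedBall_subset_closedBall' ?_
    have := min_le_right r₀ (1 - ‖t₁‖)
    rw [dist_zero_right]
    linarith
  have hpi : (0 : ℝ) < 2 * Real.pi := by positivity
  set I := ∫⁻ θ in Ioc 0 (2 * Real.pi), N (circleMap t₁ r θ) with hI
  have hNI := hNmean t₁ r hrpos hr2
  rw [← hI] at hNI
  have hIfin : I ≠ ⊤ := by
    intro h
    rw [h, ENNReal.mul_top (by simpa using hpi), hν] at hNI
    exact absurd hNI (by simp)
  have hNm : Measurable fun θ => N (circleMap t₁ r θ) :=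
    hNlsc.measurable.comp (continuous_circleMap t₁ r).measurable
  have hNint : CircleIntegrable (fun τ => (N τ).toReal) t₁ r := by
    rw [circleIntegrable_def, intervalIntegrable_iff, uIoc_of_le hpi.le]
    exact integrable_toReal_of_lintegral_ne_top hNm.aemeasurable hIfin
  have hNavg : Real.circleAverage (fun τ => (N τ).toReal) t₁ r ≤ ν := by
    rw [Real.circleAverage_def, intervalIntegral.integral_of_le hpi.le,
      integral_toReal hNm.aemeasurable (ae_lt_top hNm hIfin), ← hI, smul_eq_mul]
    have h1 := ENNReal.toReal_mono (by rw [hν]; exact ENNReal.coe_ne_top) hNI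
    rw [ENNReal.toReal_mul, ENNReal.toReal_ofReal (by positivity), hν] at h1
    exact h1
  set B : ℂ → ℝ := fun τ => (a - q t₁ - ν) + ((p.eval τ).re + (-c) • ‖τ‖ ^ 2 + c) + (N τ).toReal with hB
  have hi1 : CircleIntegrable (fun τ : ℂ => (p.eval τ).re) t₁ r :=
    Continuous.continuousOn (by fun_prop) |>.circleIntegrable hrpos.le
  have hi2 : CircleIntegrable (fun τ : ℂ => (-c) • ‖τ‖ ^ 2) t₁ r :=
    Continuous.continuousOn (by fun_prop) |>.circleIntegrable hrpos.le
  have hi4 : CircleIntegrable (fun τ : ℂ => (p.eval τ).re + (-c) • ‖τ‖ ^ 2) t₁ r := hi1.add hi2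
  have hi5 : CircleIntegrable (fun τ : ℂ => (p.eval τ).re + (-c) • ‖τ‖ ^ 2 + c) t₁ r :=
    hi4.add (circleIntegrable_const _ _ _)
  have hi6 : CircleIntegrable (fun τ : ℂ => (a - q t₁ - ν) +
      ((p.eval τ).re + (-c) • ‖τ‖ ^ 2 + c)) t₁ r := (circleIntegrable_const _ _ _).add hi5
  have hmean : circleMean v t₁ ((r : ℂ) • 1) ≤ ((Real.circleAverage B t₁ r : ℝ) : EReal) := by
    rw [Real.circleAverage_eq_circleAverage_zero_one]
    have hcm (θ : ℝ) : (r : ℂ) * circleMap 0 1 θ + t₁ = circleMap t₁ r θ := by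
      simp [circleMap, add_comm]
    -- The majorant is meaningless only where `N = ∞`; this is a null set on the circle, since the
    -- mean of `N` is at most `N t₁ < ∞`.
    refine circleMean_le_circleAverage_of_ae ?_ ?_
    · have := hi6.add hNint
      rw [circleIntegrable_def] at this ⊢
      simp only [hcm]
      exact this
    · filter_upwards [ae_lt_top hNm hIfin] with θ hθ
      have h1 := hle (circleMap t₁ r θ)
        (hr2 (sphere_subset_closedBall (circleMap_mem_sphere t₁ hrpos.le θ))) hθ.ne
      have h2 : t₁ + Complex.exp (θ * Complex.I) • (r : ℂ) • (1 : ℂ) = circleMap t₁ r θ := by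
        simp [circleMap, mul_comm]
      rw [h2, hcm]
      refine h1.trans_eq ?_
      simp only [hB, hq, smul_eq_mul, EReal.coe_eq_coe_iff]
      ring
  have hBavg : Real.circleAverage B t₁ r = (a - q t₁ - ν) +
      ((p.eval t₁).re + (-c) * (‖t₁‖ ^ 2 + r ^ 2) + c) +
      Real.circleAverage (fun τ => (N τ).toReal) t₁ r := by
    rw [hB, Real.circleAverage_fun_add hi6 hNint,
      Real.circleAverage_fun_add (circleIntegrable_const _ _ _) hi5,
      Real.circleAverage_fun_add hi4 (circleIntegrable_const _ _ _),
      Real.circleAverage_fun_add hi1 hi2, Real.circleAverage_const, Real.circleAverage_const,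
      Real.circleAverage_fun_smul, polynomial_circleAverage_re, circleAverage_norm_sq _ hrpos]
    simp
  have hfin := (hsm r hrpos hr1).trans hmean
  rw [ha, EReal.coe_le_coe_iff, hBavg] at hfin
  simp only [hq] at hfin
  have : 0 < c * r ^ 2 := by positivity
  linarith

end Removable

/-! ### Psh functions: composition, removable sets, values off null sets -/

section Psh

open Filter Topology Metric

theorem IsPshInCoordinates.hasSmallSubmeans {n : ℕ} {φ : (Fin n → ℂ) → EReal} {D : Set (Fin n → ℂ)}
    (h : IsPshInCoordinates φ D) {z : Fin n → ℂ} (hz : z ∈ D) : HasSmallSubmeans φ z := by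
  intro η
  obtain ⟨r, hr, h1⟩ := h.mean_value z hz
  refine ⟨r / (‖η‖ + 1), by positivity, fun s hs hsr => (h1 _ ?_).2⟩
  rw [lt_div_iff₀ (by positivity)] at hsr
  rw [norm_smul, Complex.norm_real, Real.norm_eq_abs, abs_of_pos hs]
  nlinarith [norm_nonneg η]

theorem HasSmallSubmeans.congr {W : Type*} [NormedAddCommGroup W] [NormedSpace ℂ W] {u v : W → EReal}
    {p : W} (h : HasSmallSubmeans u p) (huv : u =ᶠ[𝓝 p] v) : HasSmallSubmeans v p := by
  obtain ⟨ρ, hρ, h1⟩ := Metric.eventually_nhds_iff.1 huv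
  intro η
  obtain ⟨r₀, hr₀, h2⟩ := h η
  refine ⟨min r₀ (ρ / (‖η‖ + 1)), lt_min hr₀ (by positivity), fun r hr hr2 => ?_⟩
  have h3 : r * (‖η‖ + 1) < ρ := (lt_div_iff₀ (by positivity)).1 (hr2.trans_le (min_le_right _ _))
  rw [← h1 (y := p) (by simpa using hρ), ← circleMean_congr (φ := u) fun t ht => h1 ?_]
  · exact h2 r hr (hr2.trans_le (min_le_left _ _))
  · have : ‖t‖ = 1 := by simpa using ht
    rw [dist_self_add_left, norm_smul, norm_smul, this, Complex.norm_real, Real.norm_eq_abs,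
      abs_of_pos hr]
    nlinarith [norm_nonneg η]

theorem IsPshInCoordinates.mono {n : ℕ} {φ : (Fin n → ℂ) → EReal} {D D' : Set (Fin n → ℂ)}
    (h : IsPshInCoordinates φ D) (hD' : IsOpen D') (hsub : D' ⊆ D) : IsPshInCoordinates φ D' := by
  refine ⟨fun z hz => h.lt_top z (hsub hz), h.usc.mono hsub, fun z hz => ?_⟩
  obtain ⟨r, hr, h1⟩ := h.mean_value z (hsub hz)
  obtain ⟨ρ, hρ, h2⟩ := Metric.isOpen_iff.1 hD' z hz
  refine ⟨min r ρ, lt_min hr hρ, fun ξ hξ => ⟨fun θ => h2 ?_, (h1 ξ (hξ.trans_le (min_le_left _ _))).2⟩⟩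
  rw [mem_ball, dist_self_add_left, norm_smul, Complex.norm_exp_ofReal_mul_I, one_mul]
  exact hξ.trans_le (min_le_right _ _)

theorem IsPshInCoordinates.congr {n : ℕ} {φ ψ : (Fin n → ℂ) → EReal} {D : Set (Fin n → ℂ)}
    (h : IsPshInCoordinates φ D) (hφψ : EqOn φ ψ D) : IsPshInCoordinates ψ D := by
  refine ⟨fun z hz => hφψ hz ▸ h.lt_top z hz, fun z hz y hy => ?_, fun z hz => ?_⟩
  · change ψ z < y at hy
    change ∀ᶠ x in 𝓝[D] z, ψ x < y
    rw [← hφψ hz] at hy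
    filter_upwards [h.usc z hz y hy, self_mem_nhdsWithin] with x hx hxD
    rwa [← hφψ hxD]
  · obtain ⟨r, hr, h1⟩ := h.mean_value z hz
    refine ⟨r, hr, fun ξ hξ => ⟨(h1 ξ hξ).1, ?_⟩⟩
    have h2 (θ : ℝ) := hφψ ((h1 ξ hξ).1 θ)
    have h3 : circleMean ψ z ξ = circleMean φ z ξ := by simp [circleMean, h2]
    rw [← hφψ hz, h3]
    exact (h1 ξ hξ).2

theorem isPshInCoordinates_of_locally {n : ℕ} {φ : (Fin n → ℂ) → EReal} {D : Set (Fin n → ℂ)}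
    (h : ∀ z ∈ D, ∃ D' ⊆ D, IsOpen D' ∧ z ∈ D' ∧ IsPshInCoordinates φ D') :
    IsPshInCoordinates φ D := by
  refine ⟨fun z hz => ?_, fun z hz => ?_, fun z hz => ?_⟩ <;>
    obtain ⟨D', hD', ho, hz', hp⟩ := h z hz
  · exact hp.lt_top z hz'
  · intro y hy
    have h1 := hp.usc z hz' y hy
    rw [ho.nhdsWithin_eq hz'] at h1
    exact mem_nhdsWithin_of_mem_nhds h1
  · obtain ⟨r, hr, h1⟩ := hp.mean_value z hz'
    exact ⟨r, hr, fun ξ hξ => ⟨fun θ => hD' ((h1 ξ hξ).1 θ), (h1 ξ hξ).2⟩⟩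

/-- Composition of a function with small submeans on complex lines with an analytic map. -/
theorem isPshInCoordinates_comp {n : ℕ} {W : Type*} [NormedAddCommGroup W] [NormedSpace ℂ W]
    [FiniteDimensional ℂ W] {u : W → EReal} {D : Set W} (hD : IsOpen D)
    (husc : UpperSemicontinuousOn u D) (htop : ∀ x ∈ D, u x < ⊤)
    (hu : ∀ x ∈ D, HasSmallSubmeans u x) {g : (Fin n → ℂ) → W} {D' : Set (Fin n → ℂ)}
    (hD' : IsOpen D') (hg : AnalyticOnNhd ℂ g D') (hgD : MapsTo g D' D) :
    IsPshInCoordinates (fun z => u (g z)) D' := by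
  refine ⟨fun z hz => htop _ (hgD hz), fun z hz y hy => ?_, fun z hz => ?_⟩
  · exact ((hg.continuousOn z hz).tendsto_nhdsWithin hgD).eventually (husc _ (hgD hz) y hy)
  · obtain ⟨r, hr, h1⟩ := Metric.isOpen_iff.1 hD' z hz
    refine ⟨r, hr, fun ξ hξ => ?_⟩
    have h2 : ∀ t ∈ closedBall (0 : ℂ) 1, z + t • ξ ∈ D' := fun t ht => h1 (by
      rw [mem_ball, dist_self_add_left, norm_smul]
      have : ‖t‖ ≤ 1 := by simpa using ht
      nlinarith [norm_nonneg ξ])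
    refine ⟨fun θ => h2 _ (by simp), ?_⟩
    have h3 := le_circleMean_comp_of_hasSmallSubmeans hD husc htop hu (γ := fun t : ℂ => g (z + t • ξ))
      (fun t ht => (hg _ (h2 t ht)).comp_of_eq (by fun_prop) rfl) (fun t ht => hgD (h2 t ht))
    rw [circleMean_eq_comp_line]
    simpa using h3

/-- A set `T` is removable for plurisubharmonic functions if through each point outside of it there is
a dense set of directions of lines that meet `T` in countable sets. -/
theorem isPshInCoordinates_of_removable {n : ℕ} {φ : (Fin n → ℂ) → EReal} {U T : Set (Fin n → ℂ)}
    (hU : IsOpen U) (hT : ∀ x ∉ T, Dense {ξ : Fin n → ℂ | {t : ℂ | x + t • ξ ∈ T}.Countable})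
    (husc : UpperSemicontinuousOn φ U) (htop : ∀ x ∈ U, φ x < ⊤)
    (hsub : ∀ x ∈ U, x ∉ T → HasSmallSubmeans φ x)
    (hfreq : ∀ x ∈ U, ∀ c : ℝ, c < φ x → ∃ᶠ x' in 𝓝 x, x' ∉ T ∧ c < φ x') :
    IsPshInCoordinates φ U := by
  -- On a line that meets `T` in a countable set, with centre off `T`, the one-variable removability
  -- result applies.
  have hline : ∀ x ξ : Fin n → ℂ, x ∉ T → {t : ℂ | x + t • ξ ∈ T}.Countable →
      (∀ t ∈ closedBall (0 : ℂ) 1, x + t • ξ ∈ U) → φ x ≤ circleMean φ x ξ := by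
    intro x ξ hx hξ hd
    have h1 := le_circleMean_of_countable_exceptions (v := fun t => φ (x + t • ξ)) ?_
      (fun t ht => htop _ (hd t ht)) hξ (by simpa using hx) ?_
    · rw [circleMean_eq_comp_line]
      simpa using h1
    · intro t ht y hy
      have hc : ContinuousOn (fun t : ℂ => x + t • ξ) (closedBall 0 1) := by fun_prop
      exact ((hc t ht).tendsto_nhdsWithin hd).eventually (husc _ (hd t ht) y hy)
    · intro t ht htT η
      obtain ⟨r₀, hr₀, h2⟩ := hsub _ (hd t (ball_subset_closedBall ht)) htT (η • ξ)
      refine ⟨r₀, hr₀, fun r hr hrr => (h2 r hr hrr).trans_eq ?_⟩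
      rw [smul_smul, circleMean_comp_line_smul, smul_eq_mul]
  refine ⟨htop, husc, fun z hz => ?_⟩
  obtain ⟨ρ, hρ, hball⟩ := Metric.isOpen_iff.1 hU z hz
  refine ⟨ρ, hρ, fun ξ hξ => ?_⟩
  have hdisc : ∀ t ∈ closedBall (0 : ℂ) 1, z + t • ξ ∈ U := fun t ht => hball (by
    rw [mem_ball, dist_self_add_left, norm_smul]
    have : ‖t‖ ≤ 1 := by simpa using ht
    nlinarith [norm_nonneg ξ])
  refine ⟨fun θ => hdisc _ (by simp), ?_⟩
  refine le_circleMean_of_forall_polynomial ?_ (fun t ht => htop _ (hdisc t (sphere_subset_closedBall ht))) ?_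
  · intro t ht y hy
    have hc : ContinuousOn (fun t : ℂ => z + t • ξ) (sphere 0 1) := by fun_prop
    exact ((hc t ht).tendsto_nhdsWithin fun t ht => hdisc t (sphere_subset_closedBall ht)).eventually
      (husc _ (hdisc t (sphere_subset_closedBall ht)) y hy)
  intro p hp
  by_contra hlt
  obtain ⟨m, hm1, hm2⟩ := EReal.lt_iff_exists_real_btwn.1 (not_le.1 hlt)
  have hpc : Continuous fun t : ℂ => (p.eval t).re := Complex.continuous_re.comp p.continuous
  -- By semicontinuity and compactness of the circle, `φ < Re p` is an open condition on centre and
  -- direction. Both can therefore be moved to good ones, keeping `m < φ` at the centre by `hfreq`.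
  have hev : ∀ᶠ w : (Fin n → ℂ) × (Fin n → ℂ) in 𝓝 (z, ξ), ∀ t ∈ sphere (0 : ℂ) 1,
      φ (w.1 + t • w.2) < ((p.eval t).re : EReal) := by
    refine (isCompact_sphere (0 : ℂ) 1).eventually_forall_of_forall_eventually fun t ht => ?_
    obtain ⟨a, ha1, ha2⟩ := EReal.lt_iff_exists_real_btwn.1 (hp t ht)
    have h1 := husc _ (hdisc t (sphere_subset_closedBall ht)) a ha1
    rw [hU.nhdsWithin_eq (hdisc t (sphere_subset_closedBall ht))] at h1
    have hc : Continuous fun w : ((Fin n → ℂ) × (Fin n → ℂ)) × ℂ => w.1.1 + w.2 • w.1.2 := by fun_prop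
    have h2 := (hc.tendsto ((z, ξ), t)).eventually h1
    have h3 : ∀ᶠ w : ((Fin n → ℂ) × (Fin n → ℂ)) × ℂ in 𝓝 ((z, ξ), t), a < (p.eval w.2).re :=
      ((hpc.comp continuous_snd).tendsto ((z, ξ), t)).eventually_const_lt (EReal.coe_lt_coe_iff.1 ha2)
    filter_upwards [h2, h3] with w hw1 hw2
    exact hw1.trans (EReal.coe_lt_coe_iff.2 hw2)
  have hev2 : ∀ᶠ w : (Fin n → ℂ) × (Fin n → ℂ) in 𝓝 (z, ξ), ∀ t ∈ closedBall (0 : ℂ) 1,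
      w.1 + t • w.2 ∈ U := by
    refine (isCompact_closedBall (0 : ℂ) 1).eventually_forall_of_forall_eventually fun t ht => ?_
    have hc : Continuous fun w : ((Fin n → ℂ) × (Fin n → ℂ)) × ℂ => w.1.1 + w.2 • w.1.2 := by fun_prop
    exact (hc.tendsto ((z, ξ), t)).eventually (hU.mem_nhds (hdisc t ht))
  have hev3 := hev.and hev2
  rw [nhds_prod_eq] at hev3
  obtain ⟨P1, hP1, P2, hP2, hP⟩ := Filter.eventually_prod_iff.1 hev3
  obtain ⟨x, ⟨hxT, hmx⟩, hx⟩ := ((hfreq z hz m hm2).and_eventually hP1).exists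
  obtain ⟨ξ', hξ'1, hξ'2⟩ := (hT x hxT).inter_nhds_nonempty hP2
  obtain ⟨h4, h5⟩ := hP hx hξ'2
  have h6 := (hline x ξ' hxT hξ'1 h5).trans
    (circleMean_le_circleAverage hpc.continuousOn fun t ht => (h4 t ht).le)
  rw [polynomial_circleAverage_re] at h6
  exact absurd (hm1.trans (hmx.trans_le h6)) (lt_irrefl _)

/-- Fubini: for every fixed `θ` the set of bad `ξ` is an affine image of `N`, hence null; so for
almost every `ξ` the set of bad `θ` is null, and arbitrarily small such `ξ` exist. -/
theorem exists_circle_ae_notMem {n : ℕ} {N : Set (Fin n → ℂ)} (hN : volume N = 0) (z : Fin n → ℂ)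
    {s : ℝ} (hs : 0 < s) :
    ∃ ξ : Fin n → ℂ, ‖ξ‖ < s ∧
      ∀ᵐ θ : ℝ ∂(volume.restrict (Ioc 0 (2 * Real.pi))), z + Complex.exp (θ * Complex.I) • ξ ∉ N := by
  set N' := toMeasurable volume N with hN'
  have hN'0 : volume N' = 0 := by rw [hN', measure_toMeasurable, hN]
  set μ : Measure ℝ := volume.restrict (Ioc 0 (2 * Real.pi)) with hμ
  have hc : Continuous fun w : ℝ × (Fin n → ℂ) => z + Complex.exp (w.1 * Complex.I) • w.2 := by fun_prop
  set S : Set (ℝ × (Fin n → ℂ)) := (fun w => z + Complex.exp (w.1 * Complex.I) • w.2) ⁻¹' N' with hS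
  have hSm : MeasurableSet S := hc.measurable (measurableSet_toMeasurable _ _)
  have hS0 : (μ.prod volume) S = 0 := by
    rw [Measure.measure_prod_null hSm]
    refine Eventually.of_forall fun θ => ?_
    have h1 : Prod.mk θ ⁻¹' S ⊆ (fun w : Fin n → ℂ => (Complex.exp (θ * Complex.I))⁻¹ • (w - z)) '' N' := by
      intro ξ hξ
      refine ⟨z + Complex.exp (θ * Complex.I) • ξ, hξ, ?_⟩
      simp [smul_smul]
    refine measure_mono_null h1 ?_
    refine addHaar_image_eq_zero_of_differentiableOn_of_addHaar_eq_zero volume ?_ hN'0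
    fun_prop
  have h2 : ∀ᵐ w ∂(volume.prod μ), w.swap ∉ S := by
    have : (volume.prod μ) (Prod.swap ⁻¹' S) = 0 := by
      rw [← Measure.prod_swap, Measure.map_apply measurable_swap (measurable_swap hSm)]
      rw [← preimage_comp, Prod.swap_swap_eq, preimage_id]
      exact hS0
    exact measure_eq_zero_iff_ae_notMem.1 this
  have h3 := Measure.ae_ae_of_ae_prod h2
  have h4 : ∃ᶠ ξ in ae (volume : Measure (Fin n → ℂ)), ‖ξ‖ < s := by
    rw [frequently_ae_iff]
    have : {ξ : Fin n → ℂ | ‖ξ‖ < s} = ball 0 s := by ext; simp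
    rw [this]
    exact (measure_ball_pos volume 0 hs).ne'
  obtain ⟨ξ, hξ1, hξ2⟩ := (h4.and_eventually h3).exists
  refine ⟨ξ, hξ1, ?_⟩
  filter_upwards [hξ2] with θ hθ hmem
  exact hθ (subset_toMeasurable volume N hmem)

/-- The value of a plurisubharmonic function at a point is approached off a null set. -/
theorem IsPshInCoordinates.frequently_lt_of_null {n : ℕ} {φ : (Fin n → ℂ) → EReal}
    {D N : Set (Fin n → ℂ)} (h : IsPshInCoordinates φ D) {z : Fin n → ℂ} (hz : z ∈ D)
    (hN : volume N = 0) {c : EReal} (hc : c < φ z) : ∃ᶠ x in 𝓝 z, x ∉ N ∧ c < φ x := by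
  by_contra hcon
  rw [not_frequently] at hcon
  obtain ⟨ρ, hρ, h1⟩ := Metric.eventually_nhds_iff.1 hcon
  obtain ⟨r, hr, h2⟩ := h.mean_value z hz
  obtain ⟨m, hm1, hm2⟩ := EReal.lt_iff_exists_real_btwn.1 hc
  -- Almost all of this small circle avoids `N`, where `φ ≤ c < m`; the mean is then at most `m < φ
  -- z`.
  obtain ⟨ξ, hξ1, hξ2⟩ := exists_circle_ae_notMem hN z (lt_min hρ hr)
  have h3 := (h2 ξ (hξ1.trans_le (min_le_right _ _))).2
  have h4 : circleMean φ z ξ ≤ ((Real.circleAverage (fun _ => m) 0 1 : ℝ) : EReal) := by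
    refine circleMean_le_circleAverage_of_ae (circleIntegrable_const _ _ _) ?_
    filter_upwards [hξ2] with θ hθ
    have h5 := h1 (y := z + Complex.exp (θ * Complex.I) • ξ) (by
      rw [dist_self_add_left, norm_smul, Complex.norm_exp_ofReal_mul_I, one_mul]
      exact hξ1.trans_le (min_le_left _ _))
    push Not at h5
    exact (h5 hθ).trans hm1.le
  rw [Real.circleAverage_const] at h4
  exact absurd (hm2.trans_le (h3.trans h4)) (lt_irrefl _)

end Psh

/-! ### Local hypersurfaces and thin sets -/

section AnalyticSets

open Filter Topology Metric

variable {V : Type*} [NormedAddCommGroup V] [NormedSpace ℂ V]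

/-- In suitable local analytic coordinates a submersion is its derivative. -/
theorem exists_straightening [FiniteDimensional ℂ V] {W : Type*} [NormedAddCommGroup W]
    [NormedSpace ℂ W] [FiniteDimensional ℂ W] {g : V → W} {p : V} (hg : AnalyticAt ℂ g p)
    (hsurj : Function.Surjective (fderiv ℂ g p)) {U : Set V} (hU : U ∈ 𝓝 p) :
    ∃ Ψ : OpenPartialHomeomorph V V, p ∈ Ψ.source ∧ Ψ p = p ∧ Ψ.source ⊆ U ∧
      AnalyticOnNhd ℂ Ψ Ψ.source ∧ AnalyticOnNhd ℂ Ψ.symm Ψ.target ∧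
      ∀ x ∈ Ψ.source, fderiv ℂ g p (Ψ x) = fderiv ℂ g p p + (g x - g p) := by
  have : CompleteSpace V := FiniteDimensional.complete ℂ V
  have : CompleteSpace W := FiniteDimensional.complete ℂ W
  set A := fderiv ℂ g p with hA
  obtain ⟨R₀, hR₀⟩ := (A : V →ₗ[ℂ] W).exists_rightInverse_of_surjective
    (LinearMap.range_eq_top.2 hsurj)
  set R : W →L[ℂ] V := LinearMap.toContinuousLinearMap R₀ with hR
  have hAR : ∀ y, A (R y) = y := fun y => LinearMap.congr_fun hR₀ y
  -- `ψ` has the identity as derivative at `p`, and since `A ∘ R = id`, the composite `A ∘ ψ` is `g`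
  -- up to a constant.
  set ψ : V → V := fun x => x + R (g x - g p - A (x - p)) with hψ
  have hψa : ∀ x, AnalyticAt ℂ g x → AnalyticAt ℂ ψ x := by
    intro x hx
    have h1 : AnalyticAt ℂ (fun x => g x - g p - A (x - p)) x :=
      (hx.sub analyticAt_const).sub
        ((A.analyticAt _).comp_of_eq (analyticAt_id.sub analyticAt_const) rfl)
    exact analyticAt_id.add ((R.analyticAt _).comp h1)
  have hψp : HasFDerivAt ψ ((ContinuousLinearEquiv.refl ℂ V : V ≃L[ℂ] V) : V →L[ℂ] V) p := by
    have h1 : HasFDerivAt (fun x => g x - g p - A (x - p)) (A - A) p :=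
      (hg.differentiableAt.hasFDerivAt.sub_const _).sub
        (A.hasFDerivAt.comp p ((hasFDerivAt_id p).sub_const p))
    have h2 := (hasFDerivAt_id p).add (R.hasFDerivAt.comp p h1)
    have h3 : ((ContinuousLinearEquiv.refl ℂ V : V ≃L[ℂ] V) : V →L[ℂ] V) =
        ContinuousLinearMap.id ℂ V + R ∘SL (A - A) := by
      ext v
      simp
    rw [h3]
    exact h2
  have hc : ContDiffAt ℂ ω ψ p := (hψa p hg).contDiffAt
  set Ψ₀ := hc.toOpenPartialHomeomorph ψ hψp (by simp) with hΨ₀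
  have hΨ₀c : (Ψ₀ : V → V) = ψ := rfl
  -- Restricting to points where the derivative of `ψ` stays invertible makes the inverse analytic
  -- on the whole target.
  obtain ⟨O, hO, hOo, hpO⟩ : ∃ O ⊆ U ∩ {x | AnalyticAt ℂ g x} ∩
      {x | ∃ e : V ≃L[ℂ] V, (e : V →L[ℂ] V) = fderiv ℂ ψ x}, IsOpen O ∧ p ∈ O := by
    refine mem_nhds_iff.1 (inter_mem (inter_mem hU hg.eventually_analyticAt) ?_)
    have h3 : ContinuousAt (fderiv ℂ ψ) p := (hψa p hg).fderiv.continuousAt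
    have h4 := (ContinuousLinearEquiv.refl ℂ V).nhds
    rw [← hψp.fderiv] at h4
    exact h3 h4
  refine ⟨Ψ₀.restrOpen O hOo, ?_, ?_, ?_, ?_, ?_, ?_⟩
  · exact ⟨hc.mem_toOpenPartialHomeomorph_source hψp (by simp), hpO⟩
  · change ψ p = p
    simp [hψ]
  · exact fun x hx => (hO hx.2).1.1
  · exact fun x hx => hψa x (hO hx.2).1.2
  · intro y hy
    have hy' : (Ψ₀.restrOpen O hOo).symm y ∈ O := ((Ψ₀.restrOpen O hOo).map_target hy).2
    obtain ⟨e, he⟩ := (hO hy').2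
    exact (Ψ₀.restrOpen O hOo).analyticAt_symm hy (hψa _ (hO hy').1.2) he.symm
  · intro x _
    change A (ψ x) = _
    simp only [hψ, map_add, hAR, map_sub]
    abel

/-- An analytic function all of whose derivatives vanish at a point vanishes near the point. -/
theorem AnalyticAt.eventually_eq_zero_of_iteratedFDeriv [FiniteDimensional ℂ V] {f : V → ℂ} {p : V}
    (hf : AnalyticAt ℂ f p) (h : ∀ k, iteratedFDeriv ℂ k f p = 0) : f =ᶠ[𝓝 p] 0 := by
  obtain ⟨s, r, hs⟩ := hf
  have h1 : ∀ y ∈ Metric.eball p r, f y = 0 := by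
    intro y hy
    have h2 := hs.hasSum_iteratedFDeriv (y := y - p) (by simpa [edist_eq_enorm_sub] using hy)
    simp only [h, zero_apply, smul_zero, add_sub_cancel] at h2
    exact h2.unique hasSum_zero
  filter_upwards [Metric.eball_mem_nhds p hs.r_pos] with y hy using h1 y hy

/-- To prove a property of the zero set of an analytic function that is stable under countable
unions it suffices to prove it locally for smooth hypersurfaces. -/
theorem hypersurface_induction [FiniteDimensional ℂ V] {P : Set V → Prop} (h_empty : P ∅)
    (h_mono : ∀ s t, s ⊆ t → P t → P s) (h_iUnion : ∀ f : ℕ → Set V, (∀ i, P (f i)) → P (⋃ i, f i))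
    {S : Set V} {a : V → ℂ} (ha : ∀ p ∈ S, AnalyticAt ℂ a p) (h0 : ∀ p ∈ S, a p = 0)
    (hne : ∀ p ∈ S, ¬ a =ᶠ[𝓝 p] 0)
    (hP : ∀ p ∈ S, ∀ w : V → ℂ, AnalyticAt ℂ w p → w p = 0 → fderiv ℂ w p ≠ 0 →
      ∃ N ∈ 𝓝 p, P (S ∩ N ∩ {x | w x = 0})) : P S := by
  have : ProperSpace V := FiniteDimensional.proper ℂ V
  -- Stratification by the order of vanishing of `a`. Every point of `S` lies in some stratum,
  -- because a function with all derivatives zero at a point vanishes near it.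
  set Sk : ℕ → Set V := fun k => {p ∈ S | (∀ j ≤ k, iteratedFDeriv ℂ j a p = 0) ∧
    iteratedFDeriv ℂ (k + 1) a p ≠ 0} with hSk
  have hcover : S ⊆ ⋃ k, Sk k := by
    classical
    intro p hp
    have h1 : ∃ k, iteratedFDeriv ℂ k a p ≠ 0 := by
      by_contra h
      push Not at h
      exact hne p hp ((ha p hp).eventually_eq_zero_of_iteratedFDeriv h)
    have h2 : Nat.find h1 ≠ 0 := by
      intro h
      have h3 := Nat.find_spec h1
      rw [h] at h3
      apply h3
      ext m
      simp [h0 p hp]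
    obtain ⟨k, hk⟩ := Nat.exists_eq_succ_of_ne_zero h2
    refine mem_iUnion.2 ⟨k, hp, fun j hj => ?_, ?_⟩
    · by_contra h
      have := Nat.find_min' h1 h
      omega
    · have := Nat.find_spec h1
      rwa [hk] at this
  refine h_mono _ _ hcover (h_iUnion _ fun k => ?_)
  have hloc : ∀ p ∈ Sk k, ∃ N ∈ 𝓝 p, P (Sk k ∩ N) := by
    rintro p ⟨hpS, hp0, hp1⟩
    have hak : AnalyticAt ℂ (iteratedFDeriv ℂ k a) p := by
      have h1 : AnalyticOnNhd ℂ a {x | AnalyticAt ℂ a x} := fun x hx => hx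
      exact h1.iteratedFDeriv_of_isOpen (isOpen_analyticAt ℂ a) k p (ha p hpS)
    have hfd : fderiv ℂ (iteratedFDeriv ℂ k a) p ≠ 0 := by
      intro h
      apply hp1
      ext m
      rw [iteratedFDeriv_succ_apply_left, h]
      simp
    obtain ⟨v, hv⟩ : ∃ v, fderiv ℂ (iteratedFDeriv ℂ k a) p v ≠ 0 := by
      by_contra h
      push Not at h
      exact hfd (ContinuousLinearMap.ext h)
    obtain ⟨m, hm⟩ : ∃ m, fderiv ℂ (iteratedFDeriv ℂ k a) p v m ≠ 0 := by
      by_contra h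
      push Not at h
      exact hv (ContinuousMultilinearMap.ext h)
    -- A component of the `k`-th derivative vanishes on the whole stratum and has nonzero
    -- differential at `p`: near `p` the stratum lies in a smooth hypersurface.
    set w : V → ℂ := fun x => iteratedFDeriv ℂ k a x m with hw
    have hwe : w = ContinuousMultilinearMap.apply ℂ (fun _ : Fin k => V) ℂ m ∘ iteratedFDeriv ℂ k a := rfl
    have hwa : AnalyticAt ℂ w p := by
      rw [hwe]
      exact (ContinuousLinearMap.analyticAt _ _).comp hak
    have hwd : fderiv ℂ w p ≠ 0 := by
      intro h
      rw [hwe, fderiv_comp p (ContinuousLinearMap.differentiableAt _) hak.differentiableAt,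
        ContinuousLinearMap.fderiv] at h
      exact hm (by simpa using congrArg (fun L : V →L[ℂ] ℂ => L v) h)
    obtain ⟨N, hN, hPN⟩ := hP p hpS w hwa (by simp [hw, hp0 k le_rfl]) hwd
    refine ⟨N, hN, h_mono _ _ ?_ hPN⟩
    rintro x ⟨⟨hxS, hx0, -⟩, hxN⟩
    exact ⟨⟨hxS, hxN⟩, by simp [hw, hx0 k le_rfl]⟩
  choose! N hN hPN using hloc
  obtain ⟨t, htS, htc, htU⟩ := TopologicalSpace.countable_cover_nhdsWithin
    (fun p hp => mem_nhdsWithin_of_mem_nhds (hN p hp))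
  rcases t.eq_empty_or_nonempty with rfl | hne
  · refine h_mono _ _ htU ?_
    simpa using h_empty
  · obtain ⟨f, hf⟩ := htc.exists_eq_range hne
    refine h_mono _ (⋃ i, Sk k ∩ N (f i)) ?_ (h_iUnion _ fun i => hPN _ (htS (hf ▸ mem_range_self i)))
    intro x hx
    obtain ⟨q, hq, hxq⟩ := mem_iUnion₂.1 (htU hx)
    rw [hf] at hq
    obtain ⟨i, rfl⟩ := hq
    exact mem_iUnion.2 ⟨i, hx, hxq⟩

/-- A subset of the zero set of an analytic function on an open set that vanishes identically near
no point of that open set. -/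
def IsThinPiece (Z : Set V) : Prop :=
  ∃ (O : Set V) (w : V → ℂ), IsOpen O ∧ AnalyticOnNhd ℂ w O ∧ (∀ x ∈ O, ¬ w =ᶠ[𝓝 x] 0) ∧
    Z ⊆ {x | x ∈ O ∧ w x = 0}

/-- A set covered by countably many local analytic hypersurfaces. -/
def IsThin (T : Set V) : Prop :=
  ∃ 𝒵 : Set (Set V), 𝒵.Countable ∧ (∀ Z ∈ 𝒵, IsThinPiece Z) ∧ T ⊆ ⋃₀ 𝒵

theorem IsThinPiece.isThin {Z : Set V} (h : IsThinPiece Z) : IsThin Z :=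
  ⟨{Z}, countable_singleton Z, by simpa using h, by simp⟩

theorem isThin_empty : IsThin (∅ : Set V) := ⟨∅, countable_empty, by simp, by simp⟩

theorem IsThin.mono {S T : Set V} (h : IsThin T) (hST : S ⊆ T) : IsThin S := by
  obtain ⟨𝒵, h1, h2, h3⟩ := h
  exact ⟨𝒵, h1, h2, hST.trans h3⟩

theorem isThin_iUnion {ι : Sort*} [Countable ι] {T : ι → Set V} (h : ∀ i, IsThin (T i)) :
    IsThin (⋃ i, T i) := by
  choose 𝒵 h1 h2 h3 using h
  refine ⟨⋃ i, 𝒵 i, countable_iUnion h1, fun Z hZ => ?_, iUnion_subset fun i => ?_⟩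
  · obtain ⟨i, hi⟩ := mem_iUnion.1 hZ
    exact h2 i Z hi
  · exact (h3 i).trans (sUnion_subset_sUnion (subset_iUnion 𝒵 i))

theorem IsThin.union {S T : Set V} (hS : IsThin S) (hT : IsThin T) : IsThin (S ∪ T) := by
  rw [union_eq_iUnion]
  exact isThin_iUnion fun b => by cases b <;> assumption

theorem isThin_image_of_locally {α : Type*} [TopologicalSpace α] [SecondCountableTopology α]
    {S : Set α} (g : α → V) (h : ∀ x ∈ S, ∃ N ∈ 𝓝 x, IsThin (g '' (S ∩ N))) : IsThin (g '' S) := by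
  choose! N hN hT using h
  obtain ⟨t, htS, htc, htU⟩ := TopologicalSpace.countable_cover_nhdsWithin
    (fun p hp => mem_nhdsWithin_of_mem_nhds (hN p hp))
  have : Countable t := htc.to_subtype
  refine (isThin_iUnion fun x : t => hT x (htS x.2)).mono ?_
  rintro _ ⟨x, hx, rfl⟩
  obtain ⟨q, hq, hxq⟩ := mem_iUnion₂.1 (htU hx)
  exact mem_iUnion.2 ⟨⟨q, hq⟩, x, ⟨hx, hxq⟩, rfl⟩

theorem isThin_of_locally [FiniteDimensional ℂ V] {S : Set V}
    (h : ∀ x ∈ S, ∃ N ∈ 𝓝 x, IsThin (S ∩ N)) : IsThin S := by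
  have : ProperSpace V := FiniteDimensional.proper ℂ V
  simpa using isThin_image_of_locally (V := V) (S := S) id (by simpa using h)

/-- `hypersurface_induction` reduces to smooth hypersurfaces. Straightening turns these into pieces
of proper affine subspaces, and the differentiable inverse chart preserves null sets. -/
theorem IsThinPiece.measure_zero [FiniteDimensional ℂ V] [MeasurableSpace V] [BorelSpace V]
    (μ : Measure V) [μ.IsAddHaarMeasure] {Z : Set V} (h : IsThinPiece Z) : μ Z = 0 := by
  obtain ⟨O, a, hO, ha, hne, hZ⟩ := h
  refine measure_mono_null hZ ?_
  have : FiniteDimensional ℝ V := FiniteDimensional.complexToReal V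
  refine hypersurface_induction (P := fun S => μ S = 0) measure_empty
    (fun s t => measure_mono_null) (fun f hf => measure_iUnion_null hf)
    (fun p hp => ha p hp.1) (fun p hp => hp.2) (fun p hp => hne p hp.1) ?_
  intro p _ w hw hwp hdw
  have hsurj : Function.Surjective (fderiv ℂ w p) :=
    (fderiv ℂ w p : V →ₗ[ℂ] ℂ).surjective (by
      intro h; exact hdw (ContinuousLinearMap.coe_injective h))
  obtain ⟨Ψ, hpΨ, -, -, -, hsymm, hlin⟩ := exists_straightening hw hsurj univ_mem
  refine ⟨Ψ.source, Ψ.open_source.mem_nhds hpΨ, ?_⟩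
  set L : Set V := {y | fderiv ℂ w p y = fderiv ℂ w p p} with hL
  have hL0 : μ L = 0 := by
    set s : AffineSubspace ℝ V := AffineSubspace.mk' p
      ((LinearMap.ker (fderiv ℂ w p : V →ₗ[ℂ] ℂ)).restrictScalars ℝ) with hs
    have h1 : L = s := by
      ext y
      simp [hL, hs, AffineSubspace.mem_mk', sub_eq_zero]
    rw [h1]
    refine Measure.addHaar_affineSubspace μ s fun htop => ?_
    obtain ⟨v, hv⟩ := hsurj 1
    have h2 : p + v ∈ s := by rw [htop]; trivial
    rw [hs, AffineSubspace.mem_mk'] at h2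
    simp [hv] at h2
  refine measure_mono_null ?_ (addHaar_image_eq_zero_of_differentiableOn_of_addHaar_eq_zero μ
    (f := Ψ.symm) (s := L ∩ Ψ.target) ?_ (measure_mono_null inter_subset_left hL0))
  · rintro x ⟨⟨-, hxΨ⟩, hx0⟩
    refine ⟨Ψ x, ⟨?_, Ψ.map_source hxΨ⟩, Ψ.left_inv hxΨ⟩
    have hx0' : w x = 0 := hx0
    simp [hL, hlin x hxΨ, hx0', hwp]
  · exact ((hsymm.differentiableOn.restrictScalars ℝ).mono inter_subset_right)

theorem IsThin.measure_zero [FiniteDimensional ℂ V] [MeasurableSpace V] [BorelSpace V]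
    (μ : Measure V) [μ.IsAddHaarMeasure] {T : Set V} (h : IsThin T) : μ T = 0 := by
  obtain ⟨𝒵, h1, h2, h3⟩ := h
  exact measure_mono_null h3 ((measure_sUnion_null_iff h1).2 fun Z hZ => (h2 Z hZ).measure_zero μ)

/-- Through each point, most lines meet the thin set in countable sets. -/
theorem IsThin.dense_countable_lines [FiniteDimensional ℂ V] {T : Set V} (h : IsThin T)
    (x : V) : Dense {ξ : V | {t : ℂ | x + t • ξ ∈ T}.Countable} := by
  borelize V
  have : FiniteDimensional ℝ V := FiniteDimensional.complexToReal V
  have : ProperSpace V := FiniteDimensional.proper ℂ V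
  set μ : Measure V := Measure.addHaar with hμ
  obtain ⟨𝒵, h1, h2, h3⟩ := h
  choose! O w hO hw hne hZ using h2
  obtain ⟨Q, hQc, hQd⟩ := TopologicalSpace.exists_countable_dense ℂ
  -- Pieces are null, so for almost every direction the line avoids all of them at a countable dense
  -- set of parameters. The parameter `0` is left out, since it gives `x` for every direction.
  have hae : ∀ᵐ ξ ∂μ, ∀ Z ∈ 𝒵, ∀ t ∈ Q \ {0}, x + t • ξ ∉ {y | y ∈ O Z ∧ w Z y = 0} := by
    rw [ae_ball_iff h1]
    intro Z hZ'
    rw [ae_ball_iff (hQc.mono sdiff_subset)]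
    intro t ht
    have hthin : IsThinPiece {y | y ∈ O Z ∧ w Z y = 0} :=
      ⟨O Z, w Z, hO Z hZ', hw Z hZ', hne Z hZ', subset_rfl⟩
    refine (measure_eq_zero_iff_ae_notMem (s := {ξ | x + t • ξ ∈ {y | y ∈ O Z ∧ w Z y = 0}})).1 ?_
    refine measure_mono_null ?_ (addHaar_image_eq_zero_of_differentiableOn_of_addHaar_eq_zero μ
      (f := fun w : V => t⁻¹ • (w - x)) (s := {y | y ∈ O Z ∧ w Z y = 0}) ?_ (hthin.measure_zero μ))
    · intro ξ hξ
      have ht0 : t ≠ 0 := ht.2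
      exact ⟨x + t • ξ, hξ, by simp [smul_smul, inv_mul_cancel₀ ht0]⟩
    · have : Differentiable ℂ fun w : V => t⁻¹ • (w - x) := by fun_prop
      exact (this.restrictScalars ℝ).differentiableOn
  refine (Measure.dense_of_ae hae).mono fun ξ hξ => ?_
  have hsub : {t : ℂ | x + t • ξ ∈ T} ⊆ ⋃ Z ∈ 𝒵, {t : ℂ | x + t • ξ ∈ O Z ∧ w Z (x + t • ξ) = 0} := by
    intro t ht
    obtain ⟨Z, hZ', hm⟩ := h3 ht
    exact mem_iUnion₂.2 ⟨Z, hZ', hZ Z hZ' hm⟩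
  refine Countable.mono hsub (h1.biUnion fun Z hZ' => ?_)
  set E := {t : ℂ | x + t • ξ ∈ O Z ∧ w Z (x + t • ξ) = 0} with hE
  have hcont : Continuous fun t : ℂ => x + t • ξ := by fun_prop
  -- If the defining function vanished on the line near `t`, it would vanish at one of the dense
  -- parameters excluded by the choice of `ξ`. So its zeros on the line are isolated.
  have hiso : ∀ t ∈ E, ∃ N ∈ 𝓝 t, E ∩ N ⊆ {t} := by
    rintro t ⟨htO, ht0⟩
    have hfa : AnalyticAt ℂ (fun t : ℂ => w Z (x + t • ξ)) t :=
      (hw Z hZ' _ htO).comp_of_eq (by fun_prop) rfl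
    rcases hfa.eventually_eq_zero_or_eventually_ne_zero with h4 | h4
    · exfalso
      have h5 : ∀ᶠ s in 𝓝 t, x + s • ξ ∈ O Z := hcont.continuousAt.eventually ((hO Z hZ').mem_nhds htO)
      have hd : Dense (Q \ {0}) := hQd.sdiff_singleton 0
      obtain ⟨s, hs, hsQ⟩ := mem_closure_iff_nhds.1 (hd t) _ (h4.and h5)
      exact hξ Z hZ' s hsQ ⟨hs.2, hs.1⟩
    · refine ⟨_, eventually_nhdsWithin_iff.1 h4, ?_⟩
      rintro s ⟨hsE, hs⟩
      by_contra hst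
      exact hs hst hsE.2
  choose! N hN hEN using hiso
  obtain ⟨t, htE, htc, htU⟩ := TopologicalSpace.countable_cover_nhdsWithin
    (fun p hp => mem_nhdsWithin_of_mem_nhds (t := E) (hN p hp))
  refine htc.mono fun s hs => ?_
  obtain ⟨q, hq, hsq⟩ := mem_iUnion₂.1 (htU hs)
  rw [hEN q (htE hq) ⟨hs, hsq⟩]
  exact hq

end AnalyticSets

/-! ### Minors of the derivative and the analytic Sard theorem -/

section Sard

open Filter Topology Metric

universe u

variable {V : Type u} [NormedAddCommGroup V] [NormedSpace ℂ V]

/-- The minor of the derivative of `g` with rows the vectors `v i` and columns the coordinates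
`τ j`. -/
noncomputable def derivMinor {n r : ℕ} (g : V → Fin n → ℂ) (v : Fin r → V) (τ : Fin r → Fin n) (x : V) : ℂ :=
  (Matrix.of fun i j => fderiv ℂ g x (v i) (τ j)).det

theorem analyticAt_derivMinor [FiniteDimensional ℂ V] {n r : ℕ} {g : V → Fin n → ℂ} {x : V}
    (hg : AnalyticAt ℂ g x) (v : Fin r → V) (τ : Fin r → Fin n) :
    AnalyticAt ℂ (derivMinor g v τ) x := by
  have : CompleteSpace V := FiniteDimensional.complete ℂ V
  have h1 (i j : Fin r) : AnalyticAt ℂ (fun x => fderiv ℂ g x (v i) (τ j)) x := by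
    have h2 : AnalyticAt ℂ (fun x => fderiv ℂ g x (v i)) x :=
      ((ContinuousLinearMap.apply ℂ (Fin n → ℂ) (v i)).analyticAt _).comp_of_eq hg.fderiv rfl
    exact ((ContinuousLinearMap.proj (R := ℂ) (φ := fun _ : Fin n => ℂ) (τ j)).analyticAt _).comp_of_eq h2 rfl
  unfold derivMinor
  simp only [Matrix.det_apply, Matrix.of_apply]
  refine Finset.analyticAt_fun_sum _ fun σ _ => ?_
  have h3 : AnalyticAt ℂ (fun x => ∏ i, fderiv ℂ g x (v (σ i)) (τ i)) x :=
    Finset.analyticAt_fun_prod _ fun i _ => h1 _ _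
  have h4 : (fun x => Equiv.Perm.sign σ • ∏ i, fderiv ℂ g x (v (σ i)) (τ i)) =
      fun x => (((Equiv.Perm.sign σ : ℤˣ) : ℤ) : ℂ) * ∏ i, fderiv ℂ g x (v (σ i)) (τ i) := by
    ext x
    rw [Units.smul_def, zsmul_eq_mul]
  rw [h4]
  exact analyticAt_const.mul h3

/-- If a minor does not vanish, the corresponding coordinates of the derivative are surjective. -/
theorem exists_of_derivMinor_ne_zero {n r : ℕ} {g : V → Fin n → ℂ} {v : Fin r → V}
    {τ : Fin r → Fin n} {x : V} (h : derivMinor g v τ x ≠ 0) (y : Fin r → ℂ) :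
    ∃ u : V, ∀ j, fderiv ℂ g x u (τ j) = y j := by
  set M : Matrix (Fin r) (Fin r) ℂ := Matrix.of fun i j => fderiv ℂ g x (v i) (τ j) with hM
  have hu : IsUnit M.det := isUnit_iff_ne_zero.2 h
  set c := Matrix.vecMul y M⁻¹ with hc
  refine ⟨∑ i, c i • v i, fun j => ?_⟩
  have h1 : Matrix.vecMul c M = y := by
    rw [hc, Matrix.vecMul_vecMul, Matrix.nonsing_inv_mul _ hu, Matrix.vecMul_one]
  rw [← h1]
  simp [map_sum, Matrix.vecMul, dotProduct, hM]

/-- If all bordered minors vanish, directions in which the chosen coordinates of the derivative vanish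
also kill the remaining coordinate. -/
theorem fderiv_apply_eq_zero_of_derivMinor {n r : ℕ} {g : V → Fin n → ℂ} {ι : Type*} [Fintype ι]
    (b : Module.Basis ι ℂ V) {σ : Fin r → ι} {τ : Fin r → Fin n} {x : V} {j₀ : Fin n}
    (h : derivMinor g (fun i => b (σ i)) τ x ≠ 0)
    (h' : ∀ k, derivMinor g (fun i => b ((Fin.cons k σ : Fin (r + 1) → ι) i))
      (Fin.cons j₀ τ : Fin (r + 1) → Fin n) x = 0)
    {u : V} (hu : ∀ j, fderiv ℂ g x u (τ j) = 0) : fderiv ℂ g x u j₀ = 0 := by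
  set A := fderiv ℂ g x with hA
  set N : Fin (r + 1) → Matrix (Fin r) (Fin r) ℂ := fun j => Matrix.of fun i i' =>
    A (b (σ i)) ((Fin.cons j₀ τ : Fin (r + 1) → Fin n) (j.succAbove i')) with hN
  -- The expansion of the bordered minor along its first row, as a linear functional of the vector
  -- in that row. It vanishes on the basis, hence on `u`, where only the term of column `j₀`
  -- survives.
  set L : V →ₗ[ℂ] ℂ := ∑ j : Fin (r + 1), ((-1) ^ (j : ℕ) * (N j).det) •
    ((LinearMap.proj ((Fin.cons j₀ τ : Fin (r + 1) → Fin n) j)).comp (A : V →ₗ[ℂ] (Fin n → ℂ))) with hL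
  have hLb : L = 0 := by
    refine b.ext fun k => ?_
    have h1 := h' k
    rw [derivMinor, Matrix.det_succ_row_zero] at h1
    rw [LinearMap.zero_apply, ← h1, hL, LinearMap.sum_apply]
    refine Finset.sum_congr rfl fun j _ => ?_
    have h2 : (Matrix.of fun (i j : Fin (r + 1)) => A (b ((Fin.cons k σ : Fin (r + 1) → ι) i))
        ((Fin.cons j₀ τ : Fin (r + 1) → Fin n) j)).submatrix Fin.succ j.succAbove = N j := by
      ext i i'
      simp [hN]
    rw [h2]
    simp
    ring
  have h3 : L u = (N 0).det * A u j₀ := by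
    rw [hL, LinearMap.sum_apply, Fin.sum_univ_succ]
    simp [hu]
  have h4 : (N 0).det ≠ 0 := by
    have : N 0 = Matrix.of fun i j => A (b (σ i)) (τ j) := by
      ext i i'
      simp [hN]
    rw [this]
    exact h
  rw [hLb, LinearMap.zero_apply] at h3
  exact (mul_eq_zero.1 h3.symm).resolve_left h4

/-- Where the derivative has locally constant rank less than the dimension of the target, the image
is locally thin. -/
theorem exists_nhds_isThin_image_of_constant_rank [FiniteDimensional ℂ V] {n r : ℕ}
    {g : V → Fin n → ℂ} {p : V} (hg : AnalyticAt ℂ g p) {ι : Type*} [Fintype ι]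
    (b : Module.Basis ι ℂ V) {σ : Fin r → ι} {τ : Fin r → Fin n} {j₀ : Fin n} (hj₀ : ∀ j, τ j ≠ j₀)
    (h : derivMinor g (fun i => b (σ i)) τ p ≠ 0)
    (h' : ∀ k, derivMinor g (fun i => b ((Fin.cons k σ : Fin (r + 1) → ι) i))
      (Fin.cons j₀ τ : Fin (r + 1) → Fin n) =ᶠ[𝓝 p] 0) :
    ∃ N ∈ 𝓝 p, IsThin (g '' N) := by
  have : CompleteSpace V := FiniteDimensional.complete ℂ V
  -- `κ` keeps the coordinates that form a submersion at `p`; straightening makes `κ ∘ g` affine.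
  set κ : (Fin n → ℂ) →L[ℂ] (Fin r → ℂ) :=
    ContinuousLinearMap.pi fun j => ContinuousLinearMap.proj (τ j) with hK
  have hKa : ∀ y j, κ y j = y (τ j) := fun y j => rfl
  have ha : ∀ x, AnalyticAt ℂ g x → AnalyticAt ℂ (fun x => κ (g x)) x := fun x hx =>
    (κ.analyticAt _).comp_of_eq hx rfl
  have hda : ∀ x, AnalyticAt ℂ g x → fderiv ℂ (fun x => κ (g x)) x = κ.comp (fderiv ℂ g x) :=
    fun x hx => (κ.hasFDerivAt.comp x hx.differentiableAt.hasFDerivAt).fderiv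
  set A := fderiv ℂ (fun x => κ (g x)) p with hA
  have hAsurj : Function.Surjective A := by
    intro y
    obtain ⟨u, hu⟩ := exists_of_derivMinor_ne_zero h y
    refine ⟨u, ?_⟩
    rw [hA, hda p hg]
    ext j
    exact hu j
  have hnear : ∀ᶠ x in 𝓝 p, AnalyticAt ℂ g x ∧ derivMinor g (fun i => b (σ i)) τ x ≠ 0 ∧
      ∀ k, derivMinor g (fun i => b ((Fin.cons k σ : Fin (r + 1) → ι) i))
        (Fin.cons j₀ τ : Fin (r + 1) → Fin n) x = 0 := by
    refine hg.eventually_analyticAt.and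
      (((analyticAt_derivMinor hg _ _).continuousAt.eventually_ne h).and ?_)
    rw [eventually_all]
    exact h'
  obtain ⟨Ψ, hpΨ, hΨp, hΨU, hΨa, hΨs, hlin⟩ := exists_straightening (ha p hg) hAsurj hnear
  rw [← hA] at hlin
  obtain ⟨R₀, hR₀⟩ := (A : V →ₗ[ℂ] Fin r → ℂ).exists_rightInverse_of_surjective
    (LinearMap.range_eq_top.2 hAsurj)
  set R : (Fin r → ℂ) →L[ℂ] V := LinearMap.toContinuousLinearMap R₀ with hR
  have hAR : ∀ y, A (R y) = y := fun y => LinearMap.congr_fun hR₀ y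
  set H : V → ℂ := fun y => g (Ψ.symm y) j₀ with hH
  have hpt : p ∈ Ψ.target := by rw [← hΨp]; exact Ψ.map_source hpΨ
  have hgs : ∀ y ∈ Ψ.target, AnalyticAt ℂ (fun y => g (Ψ.symm y)) y := fun y hy =>
    (hΨU (Ψ.map_target hy)).1.comp_of_eq (hΨs y hy) rfl
  set pr : (Fin n → ℂ) →L[ℂ] ℂ := ContinuousLinearMap.proj j₀ with hpr
  have hHa : ∀ y ∈ Ψ.target, AnalyticAt ℂ H y := fun y hy =>
    (pr.analyticAt _).comp_of_eq (hgs y hy) rfl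
  -- The vanishing of the bordered minors says that the coordinate `j₀` has no derivative along `ker
  -- A`. On a ball it is then a function of `A y` alone, so the image lies on a graph.
  have hHd : ∀ y ∈ Ψ.target, ∀ u, A u = 0 → fderiv ℂ H y u = 0 := by
    intro y hy u hu
    set x := Ψ.symm y with hx
    have hxs : x ∈ Ψ.source := Ψ.map_target hy
    obtain ⟨hx1, hx2, hx3⟩ := hΨU hxs
    have hds : HasFDerivAt Ψ.symm (fderiv ℂ Ψ.symm y) y := (hΨs y hy).differentiableAt.hasFDerivAt
    set v := fderiv ℂ Ψ.symm y u with hv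
    have hd1 : HasFDerivAt (fun y => g (Ψ.symm y)) ((fderiv ℂ g x).comp (fderiv ℂ Ψ.symm y)) y :=
      HasFDerivAt.comp y hx1.differentiableAt.hasFDerivAt hds
    have hd2 : HasFDerivAt (fun y => κ (g (Ψ.symm y)))
        (κ.comp ((fderiv ℂ g x).comp (fderiv ℂ Ψ.symm y))) y := κ.hasFDerivAt.comp y hd1
    have hd3 : HasFDerivAt (fun y => κ (g (Ψ.symm y))) A y := by
      have h1 : HasFDerivAt (fun y => A y - A p + κ (g p)) A y :=
        (A.hasFDerivAt.sub_const _).add_const _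
      refine h1.congr_of_eventuallyEq ?_
      filter_upwards [Ψ.open_target.mem_nhds hy] with y' hy'
      have h2 := hlin _ (Ψ.map_target hy')
      rw [Ψ.right_inv hy'] at h2
      rw [h2]
      abel
    have h3 := hd2.unique hd3
    have h4 : κ (fderiv ℂ g x v) = 0 := by
      have := congrArg (fun L : V →L[ℂ] (Fin r → ℂ) => L u) h3
      simpa [hu] using this
    have h5 : fderiv ℂ g x v j₀ = 0 :=
      fderiv_apply_eq_zero_of_derivMinor b hx2 hx3 fun j => congrFun h4 j
    have hd4 : HasFDerivAt H (pr.comp ((fderiv ℂ g x).comp (fderiv ℂ Ψ.symm y))) y :=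
      pr.hasFDerivAt.comp y hd1
    rw [hd4.fderiv]
    exact h5
  obtain ⟨ε, hε, hball⟩ := Metric.isOpen_iff.1 Ψ.open_target p hpt
  have hconst : ∀ y ∈ ball p ε, ∀ y' ∈ ball p ε, A y = A y' → H y = H y' := by
    intro y hy y' hy' hyy
    set u := y' - y with hu
    have hAu : A u = 0 := by rw [hu, map_sub, hyy, sub_self]
    have hcv : ∀ t ∈ Icc (0 : ℝ) 1, y + (t : ℂ) • u ∈ ball p ε := by
      intro t ht
      have h1 := (convex_ball p ε).add_smul_sub_mem hy hy' ht
      rwa [← hu, ← Complex.coe_smul] at h1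
    have hder : ∀ t ∈ Icc (0 : ℝ) 1, HasDerivWithinAt (fun t : ℝ => H (y + (t : ℂ) • u)) 0 (Icc 0 1) t := by
      intro t ht
      have h1 : HasFDerivAt H (fderiv ℂ H (y + (t : ℂ) • u)) (y + (t : ℂ) • u) :=
        (hHa _ (hball (hcv t ht))).differentiableAt.hasFDerivAt
      have h2 : HasDerivAt (fun s : ℂ => y + s • u) u (t : ℂ) := by
        simpa using ((hasDerivAt_id (t : ℂ)).smul_const u).const_add y
      have h3 := h1.comp_hasDerivAt (t : ℂ) h2
      rw [hHd _ (hball (hcv t ht)) u hAu] at h3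
      exact h3.comp_ofReal.hasDerivWithinAt
    have h6 := constant_of_derivWithin_zero (f := fun t : ℝ => H (y + (t : ℂ) • u)) (a := 0) (b := 1)
      (fun t ht => (hder t ht).differentiableWithinAt) (fun t ht =>
        (hder t (Ico_subset_Icc_self ht)).derivWithin (uniqueDiffOn_Icc_zero_one t (Ico_subset_Icc_self ht)))
      1 (by simp)
    simpa [hu] using h6.symm
  set Q : (Fin n → ℂ) → V := fun X => p + R (κ X - κ (g p)) with hQ
  have hQc : Continuous Q := by fun_prop
  have hQp : Q (g p) = p := by simp [hQ]
  set O : Set (Fin n → ℂ) := Q ⁻¹' ball p ε with hO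
  have hOo : IsOpen O := isOpen_ball.preimage hQc
  -- The equation of the graph. As `τ` misses `j₀`, `Q X` does not involve the coordinate `j₀`; so
  -- `w` has slope one in that direction and is nowhere locally zero.
  set w : (Fin n → ℂ) → ℂ := fun X => X j₀ - H (Q X) with hw
  have hQa : ∀ X, AnalyticAt ℂ Q X := fun X =>
    analyticAt_const.add ((R.analyticAt _).comp_of_eq ((κ.analyticAt _).sub analyticAt_const) rfl)
  have hpiece : IsThinPiece {X | X ∈ O ∧ w X = 0} := by
    refine ⟨O, w, hOo, fun X hX => ?_, fun X hX hloc => ?_, subset_rfl⟩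
    · exact (pr.analyticAt X).sub ((hHa _ (hball hX)).comp_of_eq (hQa X) rfl)
    · have h1 : Tendsto (fun s : ℂ => X + s • (Pi.single j₀ (1 : ℂ) : Fin n → ℂ)) (𝓝 0) (𝓝 X) := by
        have : Continuous fun s : ℂ => X + s • (Pi.single j₀ (1 : ℂ) : Fin n → ℂ) := by fun_prop
        simpa using this.tendsto 0
      have h2 : ∀ s : ℂ, w (X + s • (Pi.single j₀ (1 : ℂ) : Fin n → ℂ)) = w X + s := by
        intro s
        have h3 : κ (X + s • (Pi.single j₀ (1 : ℂ) : Fin n → ℂ)) = κ X := by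
          ext j
          simp [hKa, hj₀ j]
        simp only [hw, hQ, h3]
        simp
        ring
      have h4 : w X = 0 := hloc.self_of_nhds
      have h5 := h1.eventually hloc
      simp only [h2, h4, zero_add, Pi.zero_apply] at h5
      have h6 : ∀ᶠ s : ℂ in 𝓝[≠] 0, False := by
        filter_upwards [nhdsWithin_le_nhds h5, self_mem_nhdsWithin] with s hs hs'
        exact hs' hs
      rw [eventually_false_iff_eq_bot] at h6
      exact NeBot.ne (inferInstance : (𝓝[≠] (0 : ℂ)).NeBot) h6
  have hgc : ContinuousAt g p := hg.continuousAt
  have hN : ∀ᶠ x in 𝓝 p, x ∈ Ψ.source ∧ Ψ x ∈ ball p ε ∧ g x ∈ O := by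
    refine (Filter.Eventually.and (Ψ.open_source.mem_nhds hpΨ) (Filter.Eventually.and ?_ ?_))
    · refine (Ψ.continuousAt hpΨ).eventually (isOpen_ball.mem_nhds ?_)
      rw [hΨp]
      exact mem_ball_self hε
    · refine hgc.eventually (hOo.mem_nhds ?_)
      change Q (g p) ∈ ball p ε
      rw [hQp]
      exact mem_ball_self hε
  refine ⟨_, hN, hpiece.isThin.mono ?_⟩
  rintro _ ⟨x, ⟨hx1, hx2, hx3⟩, rfl⟩
  refine ⟨hx3, ?_⟩
  have h1 : H (Ψ x) = g x j₀ := by simp only [hH, Ψ.left_inv hx1]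
  have h2 : H (Ψ x) = H (Q (g x)) := by
    refine hconst _ hx2 _ hx3 ?_
    rw [hlin x hx1, hQ, map_add, hAR]
  simp only [hw, ← h2, h1, sub_self]

/-- Analytic version of Sard's theorem: the image of an analytic set of critical points is thin. -/
theorem isThin_image_of_not_surjective_aux (n d : ℕ) : ∀ (V : Type u) [NormedAddCommGroup V]
    [NormedSpace ℂ V] [FiniteDimensional ℂ V], Module.finrank ℂ V = d → ∀ (U : Set V)
    (g : V → Fin n → ℂ) (m : ℕ) (a : Fin m → V → ℂ), IsOpen U → AnalyticOnNhd ℂ g U →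
    (∀ i, AnalyticOnNhd ℂ (a i) U) →
    (∀ p ∈ U, (∀ i, a i p = 0) → ¬ Function.Surjective (fderiv ℂ g p)) →
    IsThin (g '' {p | p ∈ U ∧ ∀ i, a i p = 0}) := by
  induction d using Nat.strong_induction_on with
  | _ d ih =>
  intro V _ _ _ hd U g m a hU hg ha hcrit
  have : CompleteSpace V := FiniteDimensional.complete ℂ V
  have : ProperSpace V := FiniteDimensional.proper ℂ V
  set S := {p | p ∈ U ∧ ∀ i, a i p = 0} with hS
  -- Points where `b` vanishes, but not identically nearby, are reduced to smooth hypersurfaces,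
  -- each parametrised by an open subset of the smaller space `ker dw`. Restricting `g` cannot make
  -- its derivative surjective, so the induction on dimension applies.
  have hslice : ∀ b : V → ℂ, AnalyticOnNhd ℂ b U →
      IsThin (g '' {p | p ∈ S ∧ b p = 0 ∧ ¬ b =ᶠ[𝓝 p] 0}) := by
    intro b hb
    set S' := {p | p ∈ S ∧ b p = 0 ∧ ¬ b =ᶠ[𝓝 p] 0} with hS'
    refine hypersurface_induction (P := fun s => IsThin (g '' s)) (a := b) (by simpa using isThin_empty)
      (fun s t hst ht => ht.mono (image_mono hst))
      (fun f hf => by rw [image_iUnion]; exact isThin_iUnion hf)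
      (fun p hp => hb p hp.1.1) (fun p hp => hp.2.1) (fun p hp => hp.2.2) ?_
    intro p hp w hw hwp hdw
    have hsurj : Function.Surjective (fderiv ℂ w p) :=
      (fderiv ℂ w p : V →ₗ[ℂ] ℂ).surjective (by
        intro h; exact hdw (ContinuousLinearMap.coe_injective h))
    obtain ⟨Ψ, hpΨ, -, hΨU, -, hsymm, hlin⟩ := exists_straightening hw hsurj (hU.mem_nhds hp.1.1)
    refine ⟨Ψ.source, Ψ.open_source.mem_nhds hpΨ, ?_⟩
    set K := LinearMap.ker (fderiv ℂ w p : V →ₗ[ℂ] ℂ) with hK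
    have hKd : Module.finrank ℂ K < d := by
      rw [← hd]
      refine Submodule.finrank_lt fun htop => ?_
      rw [hK, LinearMap.ker_eq_top] at htop
      exact hdw (ContinuousLinearMap.coe_injective htop)
    set κ : K → V := fun k => Ψ.symm (p + k) with hκ
    set U' : Set K := {k | p + (k : V) ∈ Ψ.target} with hU'
    have hc : Continuous fun k : K => p + (k : V) := by fun_prop
    have hκa : AnalyticOnNhd ℂ κ U' := fun k hk =>
      (hsymm _ hk).comp_of_eq (analyticAt_const.add (K.subtypeL.analyticAt k)) rfl
    have hκU : ∀ k ∈ U', κ k ∈ U := fun k hk => hΨU (Ψ.map_target hk)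
    refine (ih _ hKd K rfl U' (fun k => g (κ k)) m (fun i k => a i (κ k))
      (Ψ.open_target.preimage hc) (fun k hk => (hg _ (hκU k hk)).comp_of_eq (hκa k hk) rfl)
      (fun i k hk => (ha i _ (hκU k hk)).comp_of_eq (hκa k hk) rfl) ?_).mono ?_
    · intro k hk hk0 hsur
      refine hcrit _ (hκU k hk) hk0 fun y => ?_
      obtain ⟨v, hv⟩ := hsur y
      have h1 : fderiv ℂ (fun k => g (κ k)) k = (fderiv ℂ g (κ k)).comp (fderiv ℂ κ k) :=
        fderiv_comp k (hg _ (hκU k hk)).differentiableAt (hκa k hk).differentiableAt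
      rw [h1] at hv
      exact ⟨_, hv⟩
    · rintro _ ⟨x, ⟨⟨hxS', hxΨ⟩, hx0⟩, rfl⟩
      have hx0' : w x = 0 := hx0
      have hk : Ψ x - p ∈ K := by
        simp [hK, hlin x hxΨ, hx0', hwp]
      have h2 : κ ⟨Ψ x - p, hk⟩ = x := by simp [hκ, Ψ.left_inv hxΨ]
      refine ⟨⟨Ψ x - p, hk⟩, ⟨?_, fun i => ?_⟩, ?_⟩
      · simpa [hU'] using Ψ.map_source hxΨ
      · simp only [h2]
        exact hxS'.1.2 i
      · simp only [h2]
  set b := Module.finBasis ℂ V with hb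
  have hmin (r : ℕ) (σ : Fin r → Fin (Module.finrank ℂ V)) (τ : Fin r → Fin n) :
      AnalyticOnNhd ℂ (derivMinor g (fun i => b (σ i)) τ) U :=
    fun x hx => analyticAt_derivMinor (hg x hx) _ _
  have hthin1 : IsThin (g '' ⋃ i : Fin m, {p | p ∈ S ∧ a i p = 0 ∧ ¬ a i =ᶠ[𝓝 p] 0}) := by
    rw [image_iUnion]
    exact isThin_iUnion fun i => hslice _ (ha i)
  have hthin2 : IsThin (g '' ⋃ z : (r : ℕ) × (Fin r → Fin (Module.finrank ℂ V)) × (Fin r → Fin n),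
      {p | p ∈ S ∧ derivMinor g (fun i => b (z.2.1 i)) z.2.2 p = 0 ∧
        ¬ derivMinor g (fun i => b (z.2.1 i)) z.2.2 =ᶠ[𝓝 p] 0}) := by
    rw [image_iUnion]
    exact isThin_iUnion fun z => hslice _ (hmin _ _ _)
  set S₁ := ⋃ i : Fin m, {p | p ∈ S ∧ a i p = 0 ∧ ¬ a i =ᶠ[𝓝 p] 0} with hS₁
  set S₂ := ⋃ z : (r : ℕ) × (Fin r → Fin (Module.finrank ℂ V)) × (Fin r → Fin n),
      {p | p ∈ S ∧ derivMinor g (fun i => b (z.2.1 i)) z.2.2 p = 0 ∧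
        ¬ derivMinor g (fun i => b (z.2.1 i)) z.2.2 =ᶠ[𝓝 p] 0} with hS₂
  -- At the remaining points the equations `a i` vanish identically nearby, and each minor is either
  -- nonzero at `p` or identically zero nearby. Thus the rank is locally constant, and a nonzero
  -- minor of maximal size feeds the constant rank lemma.
  have hthin3 : IsThin (g '' (S \ (S₁ ∪ S₂))) := by
    refine isThin_image_of_locally g ?_
    rintro p ⟨hpS, hpn⟩
    have hp1 : ∀ i, a i =ᶠ[𝓝 p] 0 := by
      intro i
      by_contra h
      exact hpn (Or.inl (mem_iUnion.2 ⟨i, hpS, hpS.2 i, h⟩))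
    have hp2 : ∀ (r : ℕ) (σ : Fin r → Fin (Module.finrank ℂ V)) (τ : Fin r → Fin n),
        ¬ derivMinor g (fun i => b (σ i)) τ =ᶠ[𝓝 p] 0 → derivMinor g (fun i => b (σ i)) τ p ≠ 0 :=
      fun r σ τ h h0 => hpn (Or.inr (mem_iUnion.2 ⟨⟨r, σ, τ⟩, hpS, h0, h⟩))
    set Q : ℕ → Prop := fun r => ∃ (σ : Fin r → Fin (Module.finrank ℂ V)) (τ : Fin r → Fin n),
      ¬ derivMinor g (fun i => b (σ i)) τ =ᶠ[𝓝 p] 0 with hQ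
    have hQ0 : Q 0 := by
      refine ⟨Fin.elim0, Fin.elim0, fun h => ?_⟩
      have := h.self_of_nhds
      simp [derivMinor] at this
    have hinj : ∀ r (σ : Fin r → Fin (Module.finrank ℂ V)) (τ : Fin r → Fin n) (x : V),
        derivMinor g (fun i => b (σ i)) τ x ≠ 0 → Function.Injective τ := by
      intro r σ τ x hne i j hij
      by_contra hij'
      exact hne (Matrix.det_zero_of_column_eq hij' fun k => by simp [hij])
    have hQn : ∀ r, Q r → r ≤ n := by
      rintro r ⟨σ, τ, h⟩
      simpa using Fintype.card_le_of_injective τ (hinj r σ τ p (hp2 r σ τ h))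
    classical
    obtain ⟨r, hr, hmax⟩ : ∃ r, Q r ∧ ¬ Q (r + 1) := by
      by_contra hcon
      push Not at hcon
      have : ∀ r, Q r := fun r => Nat.rec hQ0 (fun k hk => hcon k hk) r
      have := hQn (n + 1) (this _)
      omega
    obtain ⟨σ, τ, hστ⟩ := hr
    have hne := hp2 r σ τ hστ
    -- Criticality at `p` enters here: a nonzero minor using every coordinate would make the
    -- derivative surjective.
    obtain ⟨j₀, hj₀⟩ : ∃ j₀, ∀ j, τ j ≠ j₀ := by
      by_contra hcon
      push Not at hcon
      refine hcrit p hpS.1 hpS.2 fun y => ?_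
      obtain ⟨u, hu⟩ := exists_of_derivMinor_ne_zero hne fun j => y (τ j)
      refine ⟨u, funext fun k => ?_⟩
      obtain ⟨j, rfl⟩ := hcon k
      exact hu j
    have hbord : ∀ k, derivMinor g (fun i => b ((Fin.cons k σ : Fin (r + 1) → _) i))
        (Fin.cons j₀ τ : Fin (r + 1) → Fin n) =ᶠ[𝓝 p] 0 := by
      intro k
      by_contra h
      exact hmax ⟨_, _, h⟩
    obtain ⟨N, hN, hT⟩ := exists_nhds_isThin_image_of_constant_rank (hg p hpS.1) b hj₀ hne hbord
    exact ⟨N, hN, hT.mono (image_mono inter_subset_right)⟩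
  refine ((hthin1.union hthin2).union hthin3).mono ?_
  rw [← image_union, ← image_union]
  refine image_mono fun x hx => ?_
  by_cases h : x ∈ S₁ ∪ S₂
  · exact Or.inl h
  · exact Or.inr ⟨hx, h⟩

end Sard

/-! ### Holomorphic maps in charts and analytic subsets of manifolds -/

section AnalyticGeometry

open Filter Topology Metric

variable {n m : ℕ}
  {X : Type*} [TopologicalSpace X] [ChartedSpace (Fin n → ℂ) X]
  {Y : Type*} [TopologicalSpace Y] [ChartedSpace (Fin m → ℂ) Y]

theorem ContMDiffOn.analyticOnNhd_comp_chart_symm [IsManifold 𝓘(ℂ, Fin n → ℂ) ω X]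
    {G : Type*} [NormedAddCommGroup G] [NormedSpace ℂ G] {g : X → G} {U : Set X}
    (hg : ContMDiffOn 𝓘(ℂ, Fin n → ℂ) 𝓘(ℂ, G) ω g U) (hU : IsOpen U)
    {e : OpenPartialHomeomorph X (Fin n → ℂ)} (he : e ∈ atlas (Fin n → ℂ) X) :
    AnalyticOnNhd ℂ (fun z => g (e.symm z)) (e.target ∩ e.symm ⁻¹' U) := by
  have h1 : ContMDiffOn 𝓘(ℂ, Fin n → ℂ) 𝓘(ℂ, Fin n → ℂ) ω e.symm e.target :=
    contMDiffOn_symm_of_mem_maximalAtlas (IsManifold.subset_maximalAtlas he)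
  have h2 : ContMDiffOn 𝓘(ℂ, Fin n → ℂ) 𝓘(ℂ, G) ω (g ∘ e.symm) (e.target ∩ e.symm ⁻¹' U) :=
    hg.comp (h1.mono inter_subset_left) fun z hz => hz.2
  have h3 := (contMDiffOn_iff_contDiffOn.1 h2).analyticOn
  exact (e.isOpen_inter_preimage_symm hU).analyticOn_iff_analyticOnNhd.1 h3

theorem ContMDiff.analyticOnNhd_charts [IsManifold 𝓘(ℂ, Fin n → ℂ) ω X]
    [IsManifold 𝓘(ℂ, Fin m → ℂ) ω Y] {f : Y → X}
    (hf : ContMDiff 𝓘(ℂ, Fin m → ℂ) 𝓘(ℂ, Fin n → ℂ) ω f)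
    {e : OpenPartialHomeomorph Y (Fin m → ℂ)} (he : e ∈ atlas (Fin m → ℂ) Y)
    {e' : OpenPartialHomeomorph X (Fin n → ℂ)} (he' : e' ∈ atlas (Fin n → ℂ) X) :
    AnalyticOnNhd ℂ (fun z => e' (f (e.symm z))) (e.target ∩ e.symm ⁻¹' (f ⁻¹' e'.source)) := by
  have h1 : ContMDiffOn 𝓘(ℂ, Fin n → ℂ) 𝓘(ℂ, Fin n → ℂ) ω e' e'.source :=
    contMDiffOn_of_mem_maximalAtlas (IsManifold.subset_maximalAtlas he')
  have h2 : ContMDiffOn 𝓘(ℂ, Fin m → ℂ) 𝓘(ℂ, Fin n → ℂ) ω (e' ∘ f) (f ⁻¹' e'.source) :=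
    h1.comp hf.contMDiffOn fun y hy => hy
  exact h2.analyticOnNhd_comp_chart_symm (e'.open_source.preimage hf.continuous) he

theorem AnalyticOnNhd.contMDiffOn_comp_chart [IsManifold 𝓘(ℂ, Fin n → ℂ) ω X]
    {G : Type*} [NormedAddCommGroup G] [NormedSpace ℂ G] {g : (Fin n → ℂ) → G}
    {D : Set (Fin n → ℂ)} (hg : AnalyticOnNhd ℂ g D) (hD : IsOpen D)
    {e : OpenPartialHomeomorph X (Fin n → ℂ)} (he : e ∈ atlas (Fin n → ℂ) X) :
    ContMDiffOn 𝓘(ℂ, Fin n → ℂ) 𝓘(ℂ, G) ω (fun x => g (e x)) (e.source ∩ e ⁻¹' D) := by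
  have h1 : ContMDiffOn 𝓘(ℂ, Fin n → ℂ) 𝓘(ℂ, Fin n → ℂ) ω e e.source :=
    contMDiffOn_of_mem_maximalAtlas (IsManifold.subset_maximalAtlas he)
  have h2 : ContMDiffOn 𝓘(ℂ, Fin n → ℂ) 𝓘(ℂ, G) ω g D :=
    contMDiffOn_iff_contDiffOn.2 (hg.contDiffOn hD.uniqueDiffOn)
  exact h2.comp (h1.mono inter_subset_left) fun x hx => hx.2

/-- The set `T` is thin in all coordinate charts. -/
def IsThinInCharts (T : Set X) : Prop :=
  ∀ e ∈ atlas (Fin n → ℂ) X, IsThin (e.target ∩ e.symm ⁻¹' T)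

/-- The set `N` is a Lebesgue null set in all coordinate charts. -/
def IsNullInCharts (N : Set X) : Prop :=
  ∀ e ∈ atlas (Fin n → ℂ) X, volume (e.target ∩ e.symm ⁻¹' N) = 0

theorem IsThinInCharts.isNullInCharts {T : Set X} (hT : IsThinInCharts (n := n) T) :
    IsNullInCharts (n := n) T :=
  fun e he => (hT e he).measure_zero volume

theorem IsThinInCharts.union {S T : Set X} (hS : IsThinInCharts (n := n) S)
    (hT : IsThinInCharts (n := n) T) : IsThinInCharts (n := n) (S ∪ T) := by
  intro e he
  rw [preimage_union, inter_union_distrib_left]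
  exact (hS e he).union (hT e he)

theorem IsClosedAnalyticSubset.isClosed [IsManifold 𝓘(ℂ, Fin n → ℂ) ω X] {A : Set X}
    (hA : IsClosedAnalyticSubset (n := n) A) : IsClosed A := by
  rw [← isOpen_compl_iff, isOpen_iff_mem_nhds]
  intro x hx
  obtain ⟨U, hU, hxU, k, g, hg, hAU⟩ := hA x
  obtain ⟨i, hi⟩ : ∃ i, g i x ≠ 0 := by
    by_contra! h
    exact hx ((hAU.symm ▸ ⟨hxU, h⟩ : x ∈ A ∩ U).1)
  have h1 : ContinuousAt (g i) x := (hg i).continuousOn.continuousAt (hU.mem_nhds hxU)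
  filter_upwards [hU.mem_nhds hxU, h1.eventually_ne hi] with y hyU hy hyA
  exact hy ((hAU ▸ ⟨hyA, hyU⟩ : y ∈ {p | p ∈ U ∧ ∀ i, g i p = 0}).2 i)

/-- A closed analytic subset of a connected manifold with interior points is the whole manifold. -/
theorem IsClosedAnalyticSubset.interior_eq_empty [ConnectedSpace X]
    [IsManifold 𝓘(ℂ, Fin n → ℂ) ω X] {A : Set X}
    (hA : IsClosedAnalyticSubset (n := n) A) (hne : A ≠ univ) : interior A = ∅ := by
  -- By the identity theorem on a chart ball around a limit point of the interior, the defining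
  -- functions vanish on the whole ball. So the interior is clopen.
  have hcl : IsClosed (interior A) := by
    refine isClosed_of_closure_subset fun x hx => ?_
    obtain ⟨U, hU, hxU, k, g, hg, hAU⟩ := hA x
    set e := chartAt (Fin n → ℂ) x with he
    have hxe : x ∈ e.source := mem_chart_source _ x
    have hO : IsOpen (e.target ∩ e.symm ⁻¹' U) := e.isOpen_inter_preimage_symm hU
    obtain ⟨ε, hε, hball⟩ := Metric.isOpen_iff.1 hO (e x)
      ⟨e.map_source hxe, by simpa [e.left_inv hxe] using hxU⟩
    have hN : e.source ∩ e ⁻¹' ball (e x) ε ∈ 𝓝 x :=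
      (e.isOpen_inter_preimage isOpen_ball).mem_nhds ⟨hxe, mem_ball_self hε⟩
    obtain ⟨y, hyN, hyA⟩ := mem_closure_iff_nhds.1 hx _ hN
    have hzero : ∀ i, EqOn (fun z => g i (e.symm z)) 0 (ball (e x) ε) := by
      intro i
      refine (((hg i).analyticOnNhd_comp_chart_symm hU (chart_mem_atlas _ x)).mono
        hball).eqOn_zero_of_preconnected_of_eventuallyEq_zero (convex_ball _ _).isPreconnected
        hyN.2 ?_
      have h1 : ∀ᶠ z in 𝓝 (e y), e.symm z ∈ interior A ∩ U := by
        refine (e.continuousAt_symm (e.map_source hyN.1)).eventually ?_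
        rw [e.left_inv hyN.1]
        refine (isOpen_interior.inter hU).mem_nhds ⟨hyA, ?_⟩
        have := (hball hyN.2).2
        rwa [mem_preimage, e.left_inv hyN.1] at this
      filter_upwards [h1] with z hz
      exact (hAU ▸ ⟨interior_subset hz.1, hz.2⟩ : e.symm z ∈ {p | p ∈ U ∧ ∀ i, g i p = 0}).2 i
    refine mem_interior_iff_mem_nhds.2 (mem_of_superset hN fun w hw => ?_)
    have h2 : w ∈ {p | p ∈ U ∧ ∀ i, g i p = 0} := by
      refine ⟨by simpa [e.left_inv hw.1] using (hball hw.2).2, fun i => ?_⟩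
      simpa [e.left_inv hw.1] using hzero i hw.2
    rw [← hAU] at h2
    exact h2.1
  rcases isClopen_iff.1 ⟨hcl, isOpen_interior⟩ with h | h
  · exact h
  · exact absurd (eq_univ_of_univ_subset (h ▸ interior_subset)) hne

/-- As the interior is empty, near each point of `A` some defining function is not identically zero.
On a ball the identity theorem then keeps it from vanishing near any point, as a thin piece
requires. -/
theorem IsClosedAnalyticSubset.isThinInCharts [ConnectedSpace X]
    [IsManifold 𝓘(ℂ, Fin n → ℂ) ω X] {A : Set X}
    (hA : IsClosedAnalyticSubset (n := n) A) (hne : A ≠ univ) : IsThinInCharts (n := n) A := by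
  intro e he
  refine isThin_of_locally fun z hz => ?_
  obtain ⟨U, hU, hxU, k, g, hg, hAU⟩ := hA (e.symm z)
  have hO : IsOpen (e.target ∩ e.symm ⁻¹' U) := e.isOpen_inter_preimage_symm hU
  obtain ⟨ε, hε, hball⟩ := Metric.isOpen_iff.1 hO z ⟨hz.1, hxU⟩
  have han i := (hg i).analyticOnNhd_comp_chart_symm hU he
  obtain ⟨i, hi⟩ : ∃ i, ¬ (fun w => g i (e.symm w)) =ᶠ[𝓝 z] 0 := by
    by_contra! h
    have h1 : ∀ᶠ w in 𝓝 z, ∀ i, g i (e.symm w) = 0 := eventually_all.2 h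
    have h2 : ∀ᶠ x in 𝓝 (e.symm z), x ∈ A := by
      have hs : e.symm z ∈ e.source := e.map_target hz.1
      have h3 := e.continuousAt hs
      rw [ContinuousAt, e.right_inv hz.1] at h3
      filter_upwards [h3.eventually h1, hU.mem_nhds hxU, e.open_source.mem_nhds hs] with x hx hxU hxs
      have h4 : x ∈ {p | p ∈ U ∧ ∀ i, g i p = 0} := ⟨hxU, fun i => by simpa [e.left_inv hxs] using hx i⟩
      rw [← hAU] at h4
      exact h4.1
    have h5 : e.symm z ∈ interior A := mem_interior_iff_mem_nhds.2 h2
    rw [hA.interior_eq_empty hne] at h5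
    exact h5
  refine ⟨_, ball_mem_nhds z hε, IsThinPiece.isThin ⟨ball z ε, _, isOpen_ball,
    (han i).mono hball, fun x hx h => hi ?_, ?_⟩⟩
  · have := ((han i).mono hball).eqOn_zero_of_preconnected_of_eventuallyEq_zero
      (convex_ball _ _).isPreconnected hx h
    exact this.eventuallyEq_of_mem (ball_mem_nhds z hε)
  · rintro w ⟨⟨hw1, hw2⟩, hw3⟩
    exact ⟨hw3, (hAU ▸ ⟨hw2, (hball hw3).2⟩ : e.symm w ∈ {p | p ∈ U ∧ ∀ i, g i p = 0}).2 i⟩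

/-- The critical points of a map between manifolds. -/
def criticalPoints (n m : ℕ) {X : Type*} [TopologicalSpace X] [ChartedSpace (Fin n → ℂ) X]
    {Y : Type*} [TopologicalSpace Y] [ChartedSpace (Fin m → ℂ) Y] (f : Y → X) : Set Y :=
  {y | ¬ Function.Surjective (mfderiv 𝓘(ℂ, Fin m → ℂ) 𝓘(ℂ, Fin n → ℂ) f y)}

theorem mem_criticalPoints_iff [IsManifold 𝓘(ℂ, Fin n → ℂ) ω X]
    [IsManifold 𝓘(ℂ, Fin m → ℂ) ω Y] {f : Y → X}
    (hf : ContMDiff 𝓘(ℂ, Fin m → ℂ) 𝓘(ℂ, Fin n → ℂ) ω f)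
    {e : OpenPartialHomeomorph Y (Fin m → ℂ)} (he : e ∈ atlas (Fin m → ℂ) Y)
    {e' : OpenPartialHomeomorph X (Fin n → ℂ)} (he' : e' ∈ atlas (Fin n → ℂ) X)
    {z : Fin m → ℂ} (hz : z ∈ e.target) (hz' : f (e.symm z) ∈ e'.source) :
    e.symm z ∈ criticalPoints n m f ↔
      ¬ Function.Surjective (fderiv ℂ (fun z => e' (f (e.symm z))) z) := by
  have : IsManifold 𝓘(ℂ, Fin n → ℂ) 1 X := IsManifold.of_le (n := ω) (by simp)
  have : IsManifold 𝓘(ℂ, Fin m → ℂ) 1 Y := IsManifold.of_le (n := ω) (by simp)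
  have hed : e.MDifferentiable 𝓘(ℂ, Fin m → ℂ) 𝓘(ℂ, Fin m → ℂ) := mdifferentiable_of_mem_atlas he
  have hed' : e'.MDifferentiable 𝓘(ℂ, Fin n → ℂ) 𝓘(ℂ, Fin n → ℂ) :=
    mdifferentiable_of_mem_atlas he'
  have h1 := (hed.mdifferentiableAt_symm hz).hasMFDerivAt
  have h2 := ((hf.mdifferentiable (by simp)) (e.symm z)).hasMFDerivAt
  have h3 := (hed'.mdifferentiableAt hz').hasMFDerivAt
  have hb1 : Function.Bijective (mfderiv 𝓘(ℂ, Fin m → ℂ) 𝓘(ℂ, Fin m → ℂ) e.symm z) :=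
    hed.symm.mfderiv_bijective (by simpa using hz)
  have hb2 := hed'.mfderiv_bijective hz'
  have key : ∀ (A : (Fin n → ℂ) →L[ℂ] (Fin n → ℂ)) (B : (Fin m → ℂ) →L[ℂ] (Fin n → ℂ))
      (C : (Fin m → ℂ) →L[ℂ] (Fin m → ℂ)), Function.Bijective A → Function.Bijective C →
      HasFDerivAt (fun z => e' (f (e.symm z))) (A.comp (B.comp C)) z →
      (¬ Function.Surjective B ↔
        ¬ Function.Surjective (fderiv ℂ (fun z => e' (f (e.symm z))) z)) := by
    intro A B C hA hC h
    rw [h.fderiv, ContinuousLinearMap.coe_comp, ContinuousLinearMap.coe_comp,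
      Function.Surjective.of_comp_iff' hA, hC.2.of_comp_iff]
  exact key _ _ _ hb2 hb1 (hasMFDerivAt_iff_hasFDerivAt.1 (h3.comp z (h2.comp z h1)))

end AnalyticGeometry

/-! ### Critical points, local sections and preimages of null sets -/

section CriticalPoints

open Filter Topology Metric

/-- The determinant of the images of `n` vectors is multilinear in them. If it vanished on all
tuples of basis vectors, it would vanish on preimages of the standard basis, where it equals `1`. -/
theorem surjective_fderiv_iff_exists_derivMinor {n m : ℕ} {g : (Fin m → ℂ) → Fin n → ℂ}
    {z : Fin m → ℂ} : Function.Surjective (fderiv ℂ g z) ↔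
      ∃ σ : Fin n → Fin m, derivMinor g (fun i => Pi.single (σ i) 1) id z ≠ 0 := by
  refine ⟨fun h => ?_, fun ⟨σ, hσ⟩ y => ?_⟩
  · by_contra! h0
    choose v hv using fun i : Fin n => h (Pi.single i 1)
    have h1 : Matrix.detRowAlternating.toMultilinearMap.compLinearMap
        (fun _ : Fin n => ((fderiv ℂ g z : (Fin m → ℂ) →L[ℂ] (Fin n → ℂ)) :
          (Fin m → ℂ) →ₗ[ℂ] (Fin n → ℂ))) = 0 := by
      refine Module.Basis.ext_multilinear (fun _ => Pi.basisFun ℂ (Fin m)) fun σ => ?_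
      have h5 : derivMinor g (fun i => Pi.single (σ i) 1) id z = 0 := h0 σ
      simp only [MultilinearMap.compLinearMap_apply, Pi.basisFun_apply, zero_apply]
      exact h5
    have h2 := congrArg (fun M => M v) h1
    have h3 : (fun i => fderiv ℂ g z (v i)) = (1 : Matrix (Fin n) (Fin n) ℂ) := by
      ext i j
      rw [hv, Matrix.one_apply, Pi.single_apply]
      simp [eq_comm]
    have h4 : Matrix.det (fun i => fderiv ℂ g z (v i)) = 0 := h2
    rw [h3, Matrix.det_one] at h4
    exact one_ne_zero h4
  · obtain ⟨u, hu⟩ := exists_of_derivMinor_ne_zero hσ y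
    exact ⟨u, funext hu⟩

/-- A submersion has local analytic sections. -/
theorem exists_analytic_local_section {V W : Type*} [NormedAddCommGroup V] [NormedSpace ℂ V]
    [FiniteDimensional ℂ V] [NormedAddCommGroup W] [NormedSpace ℂ W] [FiniteDimensional ℂ W]
    {g : V → W} {p : V} (hg : AnalyticAt ℂ g p) (hsurj : Function.Surjective (fderiv ℂ g p))
    {U : Set V} (hU : U ∈ 𝓝 p) :
    ∃ (s : W → V) (D : Set W), IsOpen D ∧ g p ∈ D ∧ AnalyticOnNhd ℂ s D ∧ MapsTo s D U ∧
      ∀ x ∈ D, g (s x) = x := by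
  obtain ⟨Ψ, hp, hΨp, hsub, hΨ, hΨs, hlin⟩ := exists_straightening hg hsurj hU
  obtain ⟨R, hR⟩ := ((fderiv ℂ g p : V →L[ℂ] W) : V →ₗ[ℂ] W).exists_rightInverse_of_surjective
    (LinearMap.range_eq_top.2 hsurj)
  have hAR : ∀ w, fderiv ℂ g p (R w) = w := fun w => congrArg (fun L => L w) hR
  set τ : W → V := fun x => p + LinearMap.toContinuousLinearMap R (x - g p) with hτ
  have hτc : Continuous τ := by fun_prop
  have hτg : τ (g p) = p := by simp [hτ]
  refine ⟨fun x => Ψ.symm (τ x), τ ⁻¹' Ψ.target, Ψ.open_target.preimage hτc, ?_, fun x hx => ?_,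
    fun x hx => hsub (Ψ.map_target hx), fun x hx => ?_⟩
  · rw [mem_preimage, hτg]
    simpa [hΨp] using Ψ.map_source hp
  · refine (hΨs _ hx).comp_of_eq (analyticAt_const.add ?_) rfl
    exact ((LinearMap.toContinuousLinearMap R).analyticAt _).comp_of_eq
      (analyticAt_id.sub analyticAt_const) rfl
  · have h1 := hlin _ (Ψ.map_target hx)
    rw [Ψ.right_inv hx] at h1
    simp only [hτ, map_add, LinearMap.coe_toContinuousLinearMap', hAR] at h1
    exact (sub_left_injective (add_left_cancel h1)).symm

/-- Preimages of null sets under a submersion are null sets, locally. -/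
theorem exists_nhds_preimage_null {V W : Type*} [NormedAddCommGroup V] [NormedSpace ℂ V]
    [FiniteDimensional ℂ V] [MeasurableSpace V] [BorelSpace V] (μ : Measure V) [μ.IsAddHaarMeasure]
    [NormedAddCommGroup W] [NormedSpace ℂ W] [FiniteDimensional ℂ W]
    [MeasurableSpace W] [BorelSpace W] (ν : Measure W) [ν.IsAddHaarMeasure]
    {g : V → W} {p : V} (hg : AnalyticAt ℂ g p) (hsurj : Function.Surjective (fderiv ℂ g p))
    {N : Set W} (hN : ν N = 0) : ∃ U ∈ 𝓝 p, μ (U ∩ g ⁻¹' N) = 0 := by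
  have : FiniteDimensional ℝ V := FiniteDimensional.complexToReal V
  have : FiniteDimensional ℝ W := FiniteDimensional.complexToReal W
  obtain ⟨Ψ, hp, hΨp, hsub, hΨ, hΨs, hlin⟩ := exists_straightening hg hsurj univ_mem
  set A := fderiv ℂ g p with hA
  set M : Set V := A ⁻¹' ((fun w => w - (A p - g p)) ⁻¹' N) with hM
  -- In straightened coordinates `g` is a translate of the surjective linear map `A`, under which
  -- null sets pull back to null sets.
  have hM0 : μ M = 0 := by
    have h1 : ν ((fun w => w - (A p - g p)) ⁻¹' N) = 0 := by
      simp only [sub_eq_add_neg]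
      rw [measure_preimage_add_right, hN]
    have h2 := (ae_comp_linearMap_mem_iff ((A.restrictScalars ℝ : V →L[ℝ] W) : V →ₗ[ℝ] W) μ ν
      (s := (toMeasurable ν ((fun w => w - (A p - g p)) ⁻¹' N))ᶜ)
      hsurj (measurableSet_toMeasurable _ _).compl).2 (by
        rw [ae_iff]; simpa using h1)
    rw [ae_iff] at h2
    refine measure_mono_null (fun x hx => ?_) h2
    exact not_not.2 (subset_toMeasurable ν _ hx)
  refine ⟨Ψ.source, Ψ.open_source.mem_nhds hp, measure_mono_null (t := Ψ.symm '' (Ψ.target ∩ M)) ?_ ?_⟩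
  · rintro x ⟨hx, hxN⟩
    refine ⟨Ψ x, ⟨Ψ.map_source hx, ?_⟩, Ψ.left_inv hx⟩
    simp only [hM, mem_preimage, hlin x hx]
    have : A p + (g x - g p) - (A p - g p) = g x := by abel
    rwa [this]
  · refine addHaar_image_eq_zero_of_differentiableOn_of_addHaar_eq_zero μ (fun x hx => ?_)
      (measure_mono_null inter_subset_right hM0)
    exact ((hΨs x hx.1).differentiableAt.restrictScalars ℝ).differentiableWithinAt

variable {n m : ℕ}
  {X : Type*} [TopologicalSpace X] [ChartedSpace (Fin n → ℂ) X] [IsManifold 𝓘(ℂ, Fin n → ℂ) ω X]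
  {Y : Type*} [TopologicalSpace Y] [ChartedSpace (Fin m → ℂ) Y] [IsManifold 𝓘(ℂ, Fin m → ℂ) ω Y]
  {f : Y → X}

theorem isClosedAnalyticSubset_criticalPoints
    (hf : ContMDiff 𝓘(ℂ, Fin m → ℂ) 𝓘(ℂ, Fin n → ℂ) ω f) :
    IsClosedAnalyticSubset (n := m) (criticalPoints n m f) := by
  intro y
  set e := chartAt (Fin m → ℂ) y
  set e' := chartAt (Fin n → ℂ) (f y)
  have he := chart_mem_atlas (Fin m → ℂ) y
  have he' := chart_mem_atlas (Fin n → ℂ) (f y)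
  have hO : IsOpen (e.target ∩ e.symm ⁻¹' (f ⁻¹' e'.source)) :=
    e.isOpen_inter_preimage_symm (e'.open_source.preimage hf.continuous)
  have han := hf.analyticOnNhd_charts he he'
  set ε := (Fintype.equivFin (Fin n → Fin m)).symm
  set g : (Fin m → ℂ) → Fin n → ℂ := fun z => e' (f (e.symm z)) with hg
  have hU : ∀ q, q ∈ e.source ∩ e ⁻¹' (e.target ∩ e.symm ⁻¹' (f ⁻¹' e'.source)) ↔
      q ∈ e.source ∧ f q ∈ e'.source := by
    intro q
    constructor
    · rintro ⟨h1, _, h2⟩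
      exact ⟨h1, by simpa [e.left_inv h1] using h2⟩
    · rintro ⟨h1, h2⟩
      exact ⟨h1, e.map_source h1, by simpa [e.left_inv h1] using h2⟩
  refine ⟨_, e.isOpen_inter_preimage hO,
    (hU y).2 ⟨mem_chart_source _ _, mem_chart_source _ _⟩, _,
    fun i q => derivMinor g (fun j => Pi.single (ε i j) 1) id (e q), fun i => ?_, ?_⟩
  · exact AnalyticOnNhd.contMDiffOn_comp_chart (fun z hz => analyticAt_derivMinor (han z hz) _ _) hO he
  · ext q
    rw [mem_inter_iff, mem_ofPred_eq, and_comm]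
    refine and_congr_right fun hq => ?_
    obtain ⟨hq1, hq2⟩ := (hU q).1 hq
    have h1 := mem_criticalPoints_iff hf he he' (e.map_source hq1) (by rwa [e.left_inv hq1])
    rw [e.left_inv hq1, surjective_fderiv_iff_exists_derivMinor] at h1
    rw [h1]
    push Not
    exact ε.forall_congr_right.symm

/-- In charts the `n × n` minors are analytic equations for the critical set, so the analytic Sard
theorem applies. -/
theorem isThin_image_criticalPoints [SecondCountableTopology Y]
    (hf : ContMDiff 𝓘(ℂ, Fin m → ℂ) 𝓘(ℂ, Fin n → ℂ) ω f)
    {e' : OpenPartialHomeomorph X (Fin n → ℂ)} (he' : e' ∈ atlas (Fin n → ℂ) X) :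
    IsThin ((fun y => e' (f y)) '' (criticalPoints n m f ∩ f ⁻¹' e'.source)) := by
  refine isThin_image_of_locally _ fun y hy => ?_
  set e := chartAt (Fin m → ℂ) y
  have he := chart_mem_atlas (Fin m → ℂ) y
  have hO : IsOpen (e.target ∩ e.symm ⁻¹' (f ⁻¹' e'.source)) :=
    e.isOpen_inter_preimage_symm (e'.open_source.preimage hf.continuous)
  have han := hf.analyticOnNhd_charts he he'
  set ε := (Fintype.equivFin (Fin n → Fin m)).symm
  set g : (Fin m → ℂ) → Fin n → ℂ := fun z => e' (f (e.symm z)) with hg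
  refine ⟨e.source, e.open_source.mem_nhds (mem_chart_source _ _),
    (isThin_image_of_not_surjective_aux n _ (Fin m → ℂ) rfl _ g _
      (fun i => derivMinor g (fun j => Pi.single (ε i j) 1) id) hO han
      (fun i z hz => analyticAt_derivMinor (han z hz) _ _) fun z hz h => ?_).mono ?_⟩
  · rw [surjective_fderiv_iff_exists_derivMinor]
    push Not
    exact ε.forall_congr_right.1 h
  · rintro _ ⟨q, ⟨⟨hq1, hq2⟩, hq3⟩, rfl⟩
    refine ⟨e q, ⟨⟨e.map_source hq3, by simpa [e.left_inv hq3] using hq2⟩, ?_⟩,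
      by simp [hg, e.left_inv hq3]⟩
    have h1 := mem_criticalPoints_iff hf he he' (e.map_source hq3) (by rwa [e.left_inv hq3])
    rw [e.left_inv hq3, surjective_fderiv_iff_exists_derivMinor] at h1
    have h2 := h1.1 hq1
    push Not at h2
    exact ε.forall_congr_right.2 h2

theorem isThinInCharts_compl_image_regularPoints [SecondCountableTopology Y]
    (hf : ContMDiff 𝓘(ℂ, Fin m → ℂ) 𝓘(ℂ, Fin n → ℂ) ω f) (hsurj : Function.Surjective f) :
    IsThinInCharts (n := n) (f '' (criticalPoints n m f)ᶜ)ᶜ := by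
  intro e' he'
  refine (isThin_image_criticalPoints hf he').mono ?_
  rintro z ⟨hz1, hz2⟩
  obtain ⟨y, hy⟩ := hsurj (e'.symm z)
  refine ⟨y, ⟨?_, ?_⟩, by simp only [hy, e'.right_inv hz1]⟩
  · by_contra h
    exact hz2 ⟨y, h, hy⟩
  · rw [mem_preimage, hy]
    exact e'.map_target hz1

/-- Otherwise all of `X` would be the image of critical points, hence null in charts, whereas chart
targets are open. -/
theorem criticalPoints_ne_univ [SecondCountableTopology Y] [Nonempty X]
    (hf : ContMDiff 𝓘(ℂ, Fin m → ℂ) 𝓘(ℂ, Fin n → ℂ) ω f) (hsurj : Function.Surjective f) :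
    criticalPoints n m f ≠ univ := by
  intro h
  obtain ⟨x⟩ := ‹Nonempty X›
  have h1 := isThinInCharts_compl_image_regularPoints hf hsurj _ (chart_mem_atlas (Fin n → ℂ) x)
  rw [h] at h1
  have h2 := h1.measure_zero volume
  simp only [compl_univ, image_empty, compl_empty, preimage_univ, inter_univ] at h2
  have h3 := (chartAt (Fin n → ℂ) x).open_target.measure_pos volume ⟨_, mem_chart_target _ x⟩
  exact h3.ne' h2

/-- The critical points form a proper analytic subset of the connected manifold `Y`, hence a null
set; at the other points `f` is a submersion, and `exists_nhds_preimage_null` applies locally. -/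
theorem volume_preimage_in_charts_eq_zero [SecondCountableTopology Y] [ConnectedSpace Y] [Nonempty X]
    (hf : ContMDiff 𝓘(ℂ, Fin m → ℂ) 𝓘(ℂ, Fin n → ℂ) ω f) (hsurj : Function.Surjective f)
    {e : OpenPartialHomeomorph Y (Fin m → ℂ)} (he : e ∈ atlas (Fin m → ℂ) Y)
    {e' : OpenPartialHomeomorph X (Fin n → ℂ)} (he' : e' ∈ atlas (Fin n → ℂ) X)
    {N : Set (Fin n → ℂ)} (hN : volume N = 0) :
    volume (e.target ∩ e.symm ⁻¹' (f ⁻¹' (e'.source ∩ e' ⁻¹' N))) = 0 := by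
  have hcrit := ((isClosedAnalyticSubset_criticalPoints hf).isThinInCharts
    (criticalPoints_ne_univ hf hsurj)).isNullInCharts e he
  have hreg : volume (e.target ∩ e.symm ⁻¹' (f ⁻¹' (e'.source ∩ e' ⁻¹' N) \ criticalPoints n m f)) =
      0 := by
    refine measure_null_of_locally_null _ fun z hz => ?_
    have hzO : z ∈ e.target ∩ e.symm ⁻¹' (f ⁻¹' e'.source) := ⟨hz.1, hz.2.1.1⟩
    have h1 := mem_criticalPoints_iff hf he he' hz.1 hzO.2
    obtain ⟨U, hU, hU0⟩ := exists_nhds_preimage_null volume volume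
      (hf.analyticOnNhd_charts he he' z hzO) (by simpa using h1.not.1 hz.2.2) hN
    refine ⟨_, inter_mem_nhdsWithin _ hU, measure_mono_null ?_ hU0⟩
    rintro w ⟨⟨hw1, hw2⟩, hw3⟩
    exact ⟨hw3, hw2.1.2⟩
  refine measure_mono_null ?_ (measure_union_null hcrit hreg)
  rintro z ⟨hz1, hz2⟩
  by_cases h : e.symm z ∈ criticalPoints n m f
  · exact Or.inl ⟨hz1, h⟩
  · exact Or.inr ⟨hz1, hz2, h⟩

/-- Preimages of null sets under a surjective holomorphic map are null sets. -/
theorem IsNullInCharts.preimage [SecondCountableTopology Y] [ConnectedSpace Y] [Nonempty X]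
    (hf : ContMDiff 𝓘(ℂ, Fin m → ℂ) 𝓘(ℂ, Fin n → ℂ) ω f) (hsurj : Function.Surjective f)
    {N : Set X} (hN : IsNullInCharts (n := n) N) : IsNullInCharts (n := m) (f ⁻¹' N) := by
  intro e he
  refine measure_null_of_locally_null _ fun z hz => ?_
  set e' := chartAt (Fin n → ℂ) (f (e.symm z))
  have he' : e' ∈ atlas (Fin n → ℂ) X := chart_mem_atlas _ _
  have hO : IsOpen (e.target ∩ e.symm ⁻¹' (f ⁻¹' e'.source)) :=
    e.isOpen_inter_preimage_symm (e'.open_source.preimage hf.continuous)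
  refine ⟨_, inter_mem_nhdsWithin _ (hO.mem_nhds ⟨hz.1, mem_chart_source _ _⟩),
    measure_mono_null ?_ (volume_preimage_in_charts_eq_zero hf hsurj he he' (hN e' he'))⟩
  rintro w ⟨⟨hw1, hw2⟩, hw3, hw4⟩
  exact ⟨hw1, hw4, e'.map_source hw4, by rwa [mem_preimage, e'.left_inv hw4]⟩

end CriticalPoints

/-! ### Psh functions on manifolds: pull-back and descent along proper maps -/

section Descent

open Filter Topology Metric

variable {n m : ℕ}
  {X : Type*} [TopologicalSpace X] [ChartedSpace (Fin n → ℂ) X]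
  {Y : Type*} [TopologicalSpace Y] [ChartedSpace (Fin m → ℂ) Y]

theorem IsPshOn.lt_top {u : X → EReal} {U : Set X} (hu : IsPshOn (n := n) u U) {x : X}
    (hx : x ∈ U) : u x < ⊤ := by
  have h1 := (hu _ (chart_mem_atlas (Fin n → ℂ) x)).lt_top (chartAt (Fin n → ℂ) x x)
    ⟨mem_chart_target _ x, by simpa using hx⟩
  simpa using h1

theorem IsPshOn.eventually_lt {u : X → EReal} {U : Set X} (hu : IsPshOn (n := n) u U)
    (hU : IsOpen U) {x : X} (hx : x ∈ U) {c : EReal} (hc : u x < c) : ∀ᶠ y in 𝓝 x, u y < c := by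
  set e := chartAt (Fin n → ℂ) x
  have he : e ∈ atlas (Fin n → ℂ) X := chart_mem_atlas (Fin n → ℂ) x
  have hxs : x ∈ e.source := mem_chart_source _ x
  have hx' : e x ∈ e.target ∩ e.symm ⁻¹' U := ⟨e.map_source hxs, by simpa [e.left_inv hxs] using hx⟩
  have h1 := (hu e he).usc (e x) hx' c (by simpa [e.left_inv hxs] using hc)
  rw [(e.isOpen_inter_preimage_symm hU).nhdsWithin_eq hx'] at h1
  filter_upwards [(e.continuousAt hxs).eventually h1, e.open_source.mem_nhds hxs] with y hy hys
  simpa [e.left_inv hys] using hy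

theorem IsPshOn.frequently_lt_of_null {u : X → EReal} {U N : Set X} (hu : IsPshOn (n := n) u U)
    (hN : IsNullInCharts (n := n) N) {x : X} (hx : x ∈ U) {c : EReal} (hc : c < u x) :
    ∃ᶠ y in 𝓝 x, y ∉ N ∧ c < u y := by
  set e := chartAt (Fin n → ℂ) x
  have he : e ∈ atlas (Fin n → ℂ) X := chart_mem_atlas (Fin n → ℂ) x
  have hxs : x ∈ e.source := mem_chart_source _ x
  have hx' : e x ∈ e.target ∩ e.symm ⁻¹' U := ⟨e.map_source hxs, by simpa [e.left_inv hxs] using hx⟩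
  have h1 := (hu _ he).frequently_lt_of_null hx' (hN e he) (c := c) (by simpa [e.left_inv hxs] using hc)
  have h2 := h1.and_eventually (e.open_target.mem_nhds (e.map_source hxs))
  have h3 : Tendsto e.symm (𝓝 (e x)) (𝓝 x) := by
    simpa [ContinuousAt, e.left_inv hxs] using e.continuousAt_symm (e.map_source hxs)
  exact h3.frequently (h2.mono fun z hz => ⟨fun h => hz.1.1 ⟨hz.2, h⟩, hz.1.2⟩)

variable [IsManifold 𝓘(ℂ, Fin n → ℂ) ω X] [IsManifold 𝓘(ℂ, Fin m → ℂ) ω Y]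

theorem IsPshOn.comp {u : X → EReal} {U : Set X} (hu : IsPshOn (n := n) u U) (hU : IsOpen U)
    {f : Y → X} (hf : ContMDiff 𝓘(ℂ, Fin m → ℂ) 𝓘(ℂ, Fin n → ℂ) ω f) :
    IsPshOn (n := m) (fun y => u (f y)) (f ⁻¹' U) := by
  intro e he
  refine isPshInCoordinates_of_locally fun z hz => ?_
  set e' := chartAt (Fin n → ℂ) (f (e.symm z))
  have he' : e' ∈ atlas (Fin n → ℂ) X := chart_mem_atlas (Fin n → ℂ) (f (e.symm z))
  have hO : IsOpen (e.target ∩ e.symm ⁻¹' (f ⁻¹' (e'.source ∩ U))) :=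
    e.isOpen_inter_preimage_symm ((e'.open_source.inter hU).preimage hf.continuous)
  refine ⟨_, fun w hw => ⟨hw.1, hw.2.2⟩, hO, ⟨hz.1, mem_chart_source _ _, hz.2⟩, ?_⟩
  have h1 := hu e' he'
  refine (isPshInCoordinates_comp (e'.isOpen_inter_preimage_symm hU) h1.usc h1.lt_top
    (fun x hx => h1.hasSmallSubmeans hx) hO
    ((hf.analyticOnNhd_charts he he').mono fun w hw => ⟨hw.1, hw.2.1⟩) fun w hw =>
      ⟨e'.map_source hw.2.1, by simpa [e'.left_inv hw.2.1] using hw.2.2⟩).congr fun w hw => ?_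
  simp only [e'.left_inv hw.2.1]

/-- A plurisubharmonic function upstairs that is constant on the fibres over the complement of a
closed analytic subset comes from a plurisubharmonic function downstairs. -/
theorem IsPshOn.exists_descent [SecondCountableTopology Y] [ConnectedSpace Y] [ConnectedSpace X]
    {f : Y → X} (hf : ContMDiff 𝓘(ℂ, Fin m → ℂ) 𝓘(ℂ, Fin n → ℂ) ω f) (hproper : IsProperMap f)
    (hsurj : Function.Surjective f) {A : Set X} (hA : IsClosedAnalyticSubset (n := n) A)
    (hAne : A ≠ univ) {U : Set X} (hU : IsOpen U) {u : Y → EReal}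
    (hu : IsPshOn (n := m) u (f ⁻¹' U))
    (hconst : ∀ y y', f y = f y' → f y ∈ U → f y ∉ A → u y = u y') :
    ∃ φ : X → EReal, IsPshOn (n := n) φ U ∧ ∀ y ∈ f ⁻¹' U, u y = φ (f y) := by
  -- Over `U` this supremum is attained because fibres are compact, and it is upper semicontinuous
  -- because a proper map is closed.
  set φ : X → EReal := fun x => ⨆ y ∈ f ⁻¹' {x}, u y with hφ
  have hUY : IsOpen (f ⁻¹' U) := hU.preimage hf.continuous
  have hle : ∀ y, u y ≤ φ (f y) := fun y => le_iSup₂ (f := fun y' (_ : y' ∈ f ⁻¹' {f y}) => u y') y rfl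
  have hmax : ∀ x ∈ U, ∃ y, f y = x ∧ φ x = u y := by
    intro x hx
    have husc : UpperSemicontinuousOn u (f ⁻¹' {x}) := fun y hy c hc =>
      mem_nhdsWithin_of_mem_nhds (hu.eventually_lt hUY (by
        rw [mem_preimage, show f y = x from hy]; exact hx) hc)
    obtain ⟨y, hy, hm⟩ := husc.exists_isMaxOn (hsurj x) (hproper.isCompact_preimage isCompact_singleton)
    exact ⟨y, hy, le_antisymm (iSup₂_le fun y' hy' => hm hy') (by
      have := hle y; rwa [show f y = x from hy] at this)⟩
  have hlt : ∀ x ∈ U, φ x < ⊤ := by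
    intro x hx
    obtain ⟨y, rfl, hy⟩ := hmax x hx
    rw [hy]
    exact hu.lt_top hx
  have husc : ∀ x ∈ U, ∀ c, φ x < c → ∀ᶠ x' in 𝓝 x, φ x' < c := by
    intro x hx c hc
    obtain ⟨c', hc', hc''⟩ := exists_between hc
    filter_upwards [hproper.isClosedMap.eventually_nhds_fiber x (p := fun y => u y < c')
      fun y hy => hu.eventually_lt hUY (by
        rw [mem_preimage, show f y = x from hy]; exact hx) (by
        have := hle y
        rw [show f y = x from hy] at this
        exact this.trans_lt hc')] with x' hx'
    exact (iSup₂_le fun y hy => (hx' y hy).le).trans_lt hc''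
  have hval : ∀ y, f y ∈ U → f y ∉ A → φ (f y) = u y := by
    intro y hyU hyA
    obtain ⟨y', hy', h⟩ := hmax _ hyU
    rw [h]
    exact (hconst y y' hy'.symm hyU hyA).symm
  -- Outside `T`, `u` is constant on the fibre and the fibre contains a regular point.
  set T := A ∪ (f '' (criticalPoints n m f)ᶜ)ᶜ with hT
  have hTthin : IsThinInCharts (n := n) T :=
    (hA.isThinInCharts hAne).union (isThinInCharts_compl_image_regularPoints hf hsurj)
  have hTnull := hTthin.isNullInCharts.preimage (Y := Y) hf hsurj
  have hpsh : IsPshOn (n := n) φ U := by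
    intro e he
    have hO := e.isOpen_inter_preimage_symm hU
    refine isPshInCoordinates_of_removable hO (fun z _ => (hTthin e he).dense_countable_lines z)
      (fun z hz c hc => mem_nhdsWithin_of_mem_nhds ?_) (fun z hz => hlt _ hz.2) (fun z hz hzT => ?_)
      fun z hz c hc => ?_
    · exact (e.continuousAt_symm hz.1).eventually (husc _ hz.2 c hc)
    · have hzT' : e.symm z ∉ T := fun h => hzT ⟨hz.1, h⟩
      rw [hT, mem_union, not_or, mem_compl_iff, not_not] at hzT'
      -- A regular point over `z` gives an analytic local section of `f`; near `z`, `φ` is `u`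
      -- composed with it.
      obtain ⟨hzA, y, hyr, hy⟩ := hzT'
      set d := chartAt (Fin m → ℂ) y
      have hd : d ∈ atlas (Fin m → ℂ) Y := chart_mem_atlas (Fin m → ℂ) y
      have hyd : y ∈ d.source := mem_chart_source _ y
      have hOd : IsOpen (d.target ∩ d.symm ⁻¹' (f ⁻¹' e.source)) :=
        d.isOpen_inter_preimage_symm (e.open_source.preimage hf.continuous)
      have hdy : d y ∈ d.target ∩ d.symm ⁻¹' (f ⁻¹' e.source) :=
        ⟨d.map_source hyd, by simpa [d.left_inv hyd, hy] using e.map_target hz.1⟩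
      have h1 := mem_criticalPoints_iff hf hd he hdy.1 hdy.2
      have hUA : IsOpen (U \ A) := hU.sdiff hA.isClosed
      have hOd' : IsOpen (d.target ∩ d.symm ⁻¹' (f ⁻¹' (e.source ∩ (U \ A)))) :=
        d.isOpen_inter_preimage_symm ((e.open_source.inter hUA).preimage hf.continuous)
      have hdy' : d y ∈ d.target ∩ d.symm ⁻¹' (f ⁻¹' (e.source ∩ (U \ A))) :=
        ⟨hdy.1, hdy.2, by
          simp only [d.left_inv hyd, hy]; exact ⟨hz.2, hzA⟩⟩
      obtain ⟨s, D, hD, hgD, hs, hsO, hgs⟩ := exists_analytic_local_section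
        (hf.analyticOnNhd_charts hd he _ hdy) (by
          rw [d.left_inv hyd] at h1
          simpa using h1.not.1 hyr) (hOd'.mem_nhds hdy')
      have hgz : e (f (d.symm (d y))) = z := by rw [d.left_inv hyd, hy, e.right_inv hz.1]
      rw [hgz] at hgD
      have h2 := hu d hd
      have h3 := isPshInCoordinates_comp (d.isOpen_inter_preimage_symm hUY) h2.usc h2.lt_top
        (fun x hx => h2.hasSmallSubmeans hx) hD hs (fun x hx => ⟨(hsO hx).1, (hsO hx).2.2.1⟩)
      refine (h3.hasSmallSubmeans hgD).congr ?_
      filter_upwards [hD.mem_nhds hgD] with x hx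
      have h4 := hsO hx
      have h5 : f (d.symm (s x)) = e.symm x := by
        rw [← e.left_inv h4.2.1]
        exact congrArg e.symm (hgs x hx)
      rw [← h5, hval _ h4.2.2.1 h4.2.2.2]
    -- At a maximum point `y` of the fibre, `u y` is approached off the null set `f ⁻¹' T`. Since `u
    -- ≤ φ ∘ f`, the images under `f` of these points show that `φ` is approached off `T`.
    · obtain ⟨y, hy, hφy⟩ := hmax _ hz.2
      have hyU : y ∈ f ⁻¹' U := by rw [mem_preimage, hy]; exact hz.2
      rw [hφy] at hc
      have h1 := hu.frequently_lt_of_null hTnull hyU hc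
      have hes : e.symm z ∈ e.source := e.map_target hz.1
      have h2 : Tendsto (fun y => e (f y)) (𝓝 y) (𝓝 z) := by
        have h3 := e.continuousAt hes
        rw [ContinuousAt, e.right_inv hz.1, ← hy] at h3
        exact h3.comp hf.continuous.continuousAt
      have h4 : ∀ᶠ y' in 𝓝 y, f y' ∈ e.source :=
        hf.continuous.continuousAt.eventually (e.open_source.mem_nhds (hy ▸ hes))
      refine h2.frequently ((h1.and_eventually h4).mono fun y' hy' => ⟨fun h => hy'.1.1 ?_, ?_⟩)
      · simpa [e.left_inv hy'.2] using h.2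
      · rw [e.left_inv hy'.2]
        exact hy'.1.2.trans_le (hle y')
  -- Over the exceptional set: if `u y < c < φ (f y)`, then `u < c` near `y`, while the psh function
  -- `φ ∘ f` exceeds `c` at nearby points off the null set, where it equals `u`.
  refine ⟨φ, hpsh, fun y hy => le_antisymm (hle y) (not_lt.1 fun hlt' => ?_)⟩
  obtain ⟨c, hc1, hc2⟩ := exists_between hlt'
  have h1 := (hpsh.comp hU hf).frequently_lt_of_null hTnull hy hc2
  have h2 : ∀ᶠ y' in 𝓝 y, f y' ∈ U := hUY.mem_nhds hy
  obtain ⟨y', ⟨⟨hy1, hy2⟩, hy3⟩, hy4⟩ :=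
    ((h1.and_eventually (hu.eventually_lt hUY hy hc1)).and_eventually h2).exists
  rw [hval y' hy4 fun h => hy1 (Or.inl h)] at hy2
  exact hy2.not_gt hy3

end Descent

/-! ### Forms that are suprema of squared functionals -/

section SupForms

open Filter Topology Metric

/-- The function `q` is a supremum of squared absolute values of linear functionals. -/
def IsSupForm {V : Type*} [AddCommGroup V] [Module ℂ V] (q : V → ℝ≥0∞) : Prop :=
  ∀ w c, c < q w → ∃ l : V →ₗ[ℂ] ℂ, (∀ v, ‖l v‖ₑ ^ 2 ≤ q v) ∧ c < ‖l w‖ₑ ^ 2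

theorem IsSupForm.comp {V W : Type*} [AddCommGroup V] [Module ℂ V] [AddCommGroup W] [Module ℂ W]
    {q : V → ℝ≥0∞} (hq : IsSupForm q) (T : W →ₗ[ℂ] V) : IsSupForm fun w => q (T w) := by
  intro w c hc
  obtain ⟨l, hl, hlc⟩ := hq _ _ hc
  exact ⟨l.comp T, fun v => hl _, hlc⟩

/-- The functionals are the evaluations `ζ ↦ √s ζ v` with `s < 1 / q v`. A finite scale `s` strictly
below `(q v)⁻¹` also covers the case `q v = 0`. -/
theorem isSupForm_dualForm {V : Type*} [AddCommGroup V] [Module ℂ V] [TopologicalSpace V]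
    (q : V → ℝ≥0∞) : IsSupForm (dualForm q) := by
  intro ξ c hc
  obtain ⟨v, hv⟩ := lt_iSup_iff.1 hc
  have h0 : ‖ξ v‖ₑ ^ 2 ≠ 0 := by
    intro h
    rw [h, ENNReal.zero_div] at hv
    exact not_lt_zero hv
  have htop : ‖ξ v‖ₑ ^ 2 ≠ ⊤ := by simp
  have h1 : c / ‖ξ v‖ₑ ^ 2 < (q v)⁻¹ := by
    rw [ENNReal.div_lt_iff (Or.inl h0) (Or.inl htop), mul_comm]
    exact hv
  obtain ⟨s, hs1, hs2⟩ := ENNReal.lt_iff_exists_nnreal_btwn.1 h1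
  have hsq : ∀ a : ℂ, ‖((Real.sqrt s : ℝ) : ℂ) * a‖ₑ ^ 2 = s * ‖a‖ₑ ^ 2 := by
    intro a
    rw [enorm_mul, mul_pow]
    congr 1
    rw [enorm_eq_nnnorm, ← ENNReal.coe_pow, ENNReal.coe_inj, ← NNReal.coe_inj]
    simp [Real.sq_sqrt]
  refine ⟨{ toFun := fun ζ => ((Real.sqrt s : ℝ) : ℂ) * ζ v
            map_add' := fun a b => by simp [mul_add]
            map_smul' := fun a b => by simp; ring }, fun ζ => ?_, ?_⟩
  · refine le_trans ?_ (le_iSup _ v)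
    simp only [LinearMap.coe_mk, AddHom.coe_mk, hsq]
    rw [mul_comm]
    exact mul_le_mul_right hs2.le _
  · simp only [LinearMap.coe_mk, AddHom.coe_mk, hsq]
    exact (ENNReal.div_lt_iff (Or.inl h0) (Or.inl htop)).1 hs1

/-- At `w ∈ W` the functional is `B w / √(B w w)`, bounded on `W` by Cauchy–Schwarz and extended
arbitrarily, which is harmless since `q = ∞` off `W`. At `w ∉ W` it is a large multiple of a
functional that kills `W` but not `w`. -/
theorem IsUnboundedHermitianForm.isSupForm {V : Type*} [AddCommGroup V] [Module ℂ V]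
    {q : V → ℝ≥0∞} (hq : IsUnboundedHermitianForm q) : IsSupForm q := by
  obtain ⟨W, B, hsymm, hpos, hW, hoff⟩ := hq
  intro w c hc
  by_cases hw : w ∈ W
  · set w' : W := ⟨w, hw⟩
    have hqw : q w = ENNReal.ofReal (B w' w').re := hW w'
    have hb : 0 < (B w' w').re := by
      rw [← ENNReal.ofReal_pos, ← hqw]
      exact pos_of_gt hc
    have him : ∀ v, B v v = ((B v v).re : ℂ) := fun v => by
      have := hsymm v v
      exact (Complex.conj_eq_iff_re.1 this.symm).symm
    let core : PreInnerProductSpace.Core ℂ W :=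
      { inner := fun x y => B x y
        conj_inner_symm := fun x y => (hsymm x y).symm
        re_inner_nonneg := fun x => hpos x
        add_left := fun x y z => by simp
        smul_left := fun x y r => by simp }
    have hCS : ∀ v : W, ‖B w' v‖ ^ 2 ≤ (B w' w').re * (B v v).re := by
      intro v
      have h1 := InnerProductSpace.Core.inner_mul_inner_self_le (𝕜 := ℂ) (F := W) (c := core) w' v
      have h2 : ‖B v w'‖ = ‖B w' v‖ := by rw [hsymm v w']; simp
      change ‖B w' v‖ * ‖B v w'‖ ≤ (B w' w').re * (B v v).re at h1
      rwa [h2, ← sq] at h1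
    obtain ⟨l, hl⟩ := LinearMap.exists_extend
      ((((Real.sqrt (B w' w').re)⁻¹ : ℝ) : ℂ) • (B w' : W →ₗ[ℂ] ℂ))
    have hl' : ∀ v : W, ‖l v‖ ^ 2 = ‖B w' v‖ ^ 2 / (B w' w').re := by
      intro v
      have h1 : l v = (((Real.sqrt (B w' w').re)⁻¹ : ℝ) : ℂ) * B w' v :=
        congrArg (fun T : W →ₗ[ℂ] ℂ => T v) hl
      rw [h1, norm_mul, mul_pow, Complex.norm_real, Real.norm_eq_abs, sq_abs, inv_pow,
        Real.sq_sqrt hb.le]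
      ring
    have henorm : ∀ a : ℂ, ‖a‖ₑ ^ 2 = ENNReal.ofReal (‖a‖ ^ 2) := fun a => by
      rw [ENNReal.ofReal_pow (norm_nonneg a), ofReal_norm]
    refine ⟨l, fun v => ?_, ?_⟩
    · by_cases hv : v ∈ W
      · have h1 := hW ⟨v, hv⟩
        have h2 := hl' ⟨v, hv⟩
        simp only at h1 h2
        rw [h1, henorm, h2]
        refine ENNReal.ofReal_le_ofReal ((div_le_iff₀ hb).2 ?_)
        rw [mul_comm]
        exact hCS _
      · rw [hoff v hv]
        exact le_top
    · have h2 := hl' w'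
      have h3 : ‖B w' w'‖ = (B w' w').re := by
        conv_lhs => rw [him w']
        rw [Complex.norm_real, Real.norm_of_nonneg hb.le]
      rw [h3, pow_two (B w' w').re, mul_div_assoc, div_self hb.ne', mul_one] at h2
      change ‖l w‖ ^ 2 = _ at h2
      rwa [henorm, h2, ← hqw]
  · obtain ⟨l, hl0, hlW⟩ := Submodule.exists_le_ker_of_notMem hw
    have hct : c ≠ ⊤ := (hc.trans_le le_top).ne
    obtain ⟨k, hk⟩ : ∃ k : ℕ, c < ‖(k : ℂ) * l w‖ₑ ^ 2 := by
      obtain ⟨k, hk⟩ := exists_nat_gt ((c.toReal + 1) / ‖l w‖)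
      have hlw : 0 < ‖l w‖ := norm_pos_iff.2 hl0
      rw [div_lt_iff₀ hlw] at hk
      refine ⟨k, ?_⟩
      have h1 : ‖(k : ℂ) * l w‖ₑ ^ 2 = ENNReal.ofReal ((k * ‖l w‖) ^ 2) := by
        rw [ENNReal.ofReal_pow (by positivity), ← ofReal_norm]
        simp
      rw [h1, ENNReal.lt_ofReal_iff_toReal_lt hct]
      nlinarith [ENNReal.toReal_nonneg (a := c)]
    refine ⟨(k : ℂ) • l, fun v => ?_, by simpa using hk⟩
    by_cases hv : v ∈ W
    · have : l v = 0 := hlW hv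
      simp [this]
    · rw [hoff v hv]
      exact le_top

/-- `√q` is a supremum of the seminorms `|l|`, hence subadditive even where it is infinite. -/
theorem IsSupForm.rpow_add_le {V : Type*} [AddCommGroup V] [Module ℂ V] {q : V → ℝ≥0∞}
    (hq : IsSupForm q) (v w : V) :
    q (v + w) ^ (1 / 2 : ℝ) ≤ q v ^ (1 / 2 : ℝ) + q w ^ (1 / 2 : ℝ) := by
  have hsq : ∀ a : ℝ≥0∞, (a ^ 2) ^ (1 / 2 : ℝ) = a := fun a => by
    rw [← ENNReal.rpow_natCast, ← ENNReal.rpow_mul]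
    norm_num
  refine le_of_forall_lt fun c hc => ?_
  have h1 : c ^ 2 < q (v + w) := by
    rw [← ENNReal.rpow_lt_rpow_iff (z := 1 / 2) (by norm_num), hsq]
    exact hc
  obtain ⟨l, hl, hlc⟩ := hq _ _ h1
  have h2 : c < ‖l (v + w)‖ₑ := (ENNReal.pow_lt_pow_left_iff two_ne_zero).1 hlc
  have h3 : ∀ u, ‖l u‖ₑ ≤ q u ^ (1 / 2 : ℝ) := fun u => by
    have := ENNReal.rpow_le_rpow (hl u) (z := 1 / 2) (by norm_num)
    rwa [hsq] at this
  calc c < ‖l (v + w)‖ₑ := h2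
    _ ≤ ‖l v‖ₑ + ‖l w‖ₑ := by rw [map_add]; exact enorm_add_le _ _
    _ ≤ _ := add_le_add (h3 v) (h3 w)

theorem IsSupForm.smul_le {V : Type*} [AddCommGroup V] [Module ℂ V] {q : V → ℝ≥0∞}
    (hq : IsSupForm q) (a : ℂ) (w : V) : 
    q (a • w) ^ (1 / 2 : ℝ) ≤ ‖a‖ₑ * q w ^ (1 / 2 : ℝ) := by
  have hsq : ∀ a : ℝ≥0∞, (a ^ 2) ^ (1 / 2 : ℝ) = a := fun a => by
    rw [← ENNReal.rpow_natCast, ← ENNReal.rpow_mul]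
    norm_num
  refine le_of_forall_lt fun c hc => ?_
  have h1 : c ^ 2 < q (a • w) := by
    rw [← ENNReal.rpow_lt_rpow_iff (z := 1 / 2) (by norm_num), hsq]
    exact hc
  obtain ⟨l, hl, hlc⟩ := hq _ _ h1
  have h2 : c < ‖l (a • w)‖ₑ := (ENNReal.pow_lt_pow_left_iff two_ne_zero).1 hlc
  have h3 : ∀ u, ‖l u‖ₑ ≤ q u ^ (1 / 2 : ℝ) := fun u => by
    have := ENNReal.rpow_le_rpow (hl u) (z := 1 / 2) (by norm_num)
    rwa [hsq] at this
  calc c < ‖l (a • w)‖ₑ := h2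
    _ = ‖a‖ₑ * ‖l w‖ₑ := by rw [map_smul, smul_eq_mul, enorm_mul]
    _ ≤ _ := mul_le_mul_right (h3 w) _

/-- For a functional `l` with `|l|² ≤ q`, the maximum principle applies to the entire function `l (w
+ t η)² exp (-p t)`, of modulus at most `1` on the unit circle. This is the submean inequality along
lines inside a fibre. -/
theorem IsSupForm.log_le_of_polynomial {V : Type*} [AddCommGroup V] [Module ℂ V] {q : V → ℝ≥0∞}
    (hq : IsSupForm q) (w η : V) (p : Polynomial ℂ)
    (hp : ∀ t ∈ sphere (0 : ℂ) 1, ENNReal.log (q (w + t • η)) < ((p.eval t).re : EReal)) :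
    ENNReal.log (q w) ≤ ((p.eval 0).re : EReal) := by
  have key : ∀ (a : ℝ≥0∞) (r : ℝ), ENNReal.log a ≤ (r : EReal) ↔ a ≤ ENNReal.ofReal (Real.exp r) := by
    intro a r
    rw [← EReal.exp_coe, ← ENNReal.log_le_log_iff, EReal.log_exp]
  rw [key]
  by_contra! hlt
  obtain ⟨l, hl, hlc⟩ := hq _ _ hlt
  have henorm : ∀ a : ℂ, ‖a‖ₑ ^ 2 = ENNReal.ofReal (‖a‖ ^ 2) := fun a => by
    rw [ENNReal.ofReal_pow (norm_nonneg a), ofReal_norm]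
  set G : ℂ → ℂ := fun t => (l w + t * l η) ^ 2 * Complex.exp (-(p.eval t)) with hG
  have hGd : Differentiable ℂ G := by
    have h1 : Differentiable ℂ fun t => p.eval t := p.differentiable
    exact (((differentiable_const _).add (differentiable_id.mul_const _)).pow 2).mul h1.neg.cexp
  have hGn : ∀ t, ‖G t‖ = ‖l (w + t • η)‖ ^ 2 * Real.exp (-(p.eval t).re) := by
    intro t
    simp [hG, Complex.norm_exp]
  have hbd : ‖G 0‖ ≤ 1 := by
    refine Complex.norm_le_of_forall_mem_frontier_norm_le (U := ball 0 1) isBounded_ball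
      hGd.diffContOnCl (fun t ht => ?_) (subset_closure (mem_ball_self one_pos))
    rw [frontier_ball _ one_ne_zero] at ht
    have h1 := (hl (w + t • η)).trans ((key _ _).1 (hp t ht).le)
    rw [henorm, ENNReal.ofReal_le_ofReal_iff (Real.exp_pos _).le] at h1
    rw [hGn, Real.exp_neg, ← div_eq_mul_inv]
    exact (div_le_one (Real.exp_pos _)).2 h1
  rw [hGn, Real.exp_neg, ← div_eq_mul_inv, div_le_one (Real.exp_pos _), zero_smul, add_zero] at hbd
  rw [henorm] at hlc
  exact (ENNReal.ofReal_le_ofReal hbd).not_gt hlc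

end SupForms

/-! ### The log-norm as a function on base times fibre -/

section FormFamilies

open Filter Topology Metric

variable {n : ℕ} {F : Type*} [NormedAddCommGroup F] [NormedSpace ℂ F] [FiniteDimensional ℂ F]
  {Q : (Fin n → ℂ) → F → ℝ≥0∞} {D : Set (Fin n → ℂ)}

omit [FiniteDimensional ℂ F] in
theorem lt_top_of_psh_sections
    (hpsh : ∀ a : (Fin n → ℂ) → F, AnalyticOnNhd ℂ a univ →
      IsPshInCoordinates (fun z => ENNReal.log (Q z (a z))) D) {p : (Fin n → ℂ) × F} (hp : p.1 ∈ D) :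
    ENNReal.log (Q p.1 p.2) < ⊤ :=
  (hpsh (fun _ => p.2) analyticOnNhd_const).lt_top p.1 hp

/-- Constant sections give semicontinuity in `z` for each fixed vector. The triangle inequality for
`√Q`, with local bounds on the norms of basis vectors, makes it joint in `z` and the vector. -/
theorem upperSemicontinuousOn_of_psh_sections (hD : IsOpen D) (hQ : ∀ z ∈ D, IsSupForm (Q z))
    (hpsh : ∀ a : (Fin n → ℂ) → F, AnalyticOnNhd ℂ a univ →
      IsPshInCoordinates (fun z => ENNReal.log (Q z (a z))) D) :
    UpperSemicontinuousOn (fun p : (Fin n → ℂ) × F => ENNReal.log (Q p.1 p.2)) (D ×ˢ univ) := by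
  have hconst : ∀ w, ∀ z ∈ D, ∀ c, Q z w ^ (1 / 2 : ℝ) < c → ∀ᶠ z' in 𝓝 z, Q z' w ^ (1 / 2 : ℝ) < c := by
    intro w z hz c hc
    have hsq : ∀ a b : ℝ≥0∞, a ^ (1 / 2 : ℝ) < b ↔ ENNReal.log a < ENNReal.log (b ^ (2 : ℝ)) := by
      intro a b
      rw [ENNReal.log_lt_log_iff, one_div, ENNReal.rpow_inv_lt_iff (by norm_num)]
    have h1 := (hpsh (fun _ => w) analyticOnNhd_const).usc z hz _ ((hsq _ _).1 hc)
    rw [hD.nhdsWithin_eq hz] at h1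
    filter_upwards [h1] with z' hz'
    exact (hsq _ _).2 hz'
  rintro ⟨z₀, w₀⟩ ⟨hz₀, -⟩ c hc
  refine mem_nhdsWithin_of_mem_nhds ?_
  change ENNReal.log (Q z₀ w₀) < c at hc
  obtain ⟨c', rfl⟩ : ∃ c' : ℝ≥0∞, ENNReal.log c' = c := ⟨_, EReal.log_exp c⟩
  rw [ENNReal.log_lt_log_iff] at hc
  have hc' : Q z₀ w₀ ^ (1 / 2 : ℝ) < c' ^ (1 / 2 : ℝ) := ENNReal.rpow_lt_rpow hc (by norm_num)
  obtain ⟨d, hd1, hd2⟩ := exists_between hc'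
  set b := Module.finBasis ℂ F
  have hM : ∀ i, ∃ M : ℝ≥0∞, M < ⊤ ∧ ∀ᶠ z in 𝓝 z₀, Q z (b i) ^ (1 / 2 : ℝ) < M := by
    intro i
    have h1 : Q z₀ (b i) ^ (1 / 2 : ℝ) < ⊤ := by
      have := lt_top_of_psh_sections hpsh (p := (z₀, b i)) hz₀
      rw [← ENNReal.log_top, ENNReal.log_lt_log_iff] at this
      exact ENNReal.rpow_lt_top_of_nonneg (by norm_num) this.ne
    obtain ⟨M, hM1, hM2⟩ := exists_between h1
    exact ⟨M, hM2, hconst _ _ hz₀ _ hM1⟩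
  choose M hMtop hMev using hM
  have hcont : Tendsto (fun w : F => d + ∑ i, ‖b.equivFun (w - w₀) i‖ₑ * M i) (𝓝 w₀) (𝓝 d) := by
    have h1 : ∀ i, Tendsto (fun w : F => ‖b.equivFun (w - w₀) i‖ₑ * M i) (𝓝 w₀) (𝓝 0) := by
      intro i
      have h2 : Continuous fun w : F => b.equivFun (w - w₀) i := by
        have : Continuous b.equivFun :=
          (b.equivFun : F →ₗ[ℂ] (Fin (Module.finrank ℂ F) → ℂ)).continuous_of_finiteDimensional
        exact (continuous_apply i).comp (this.comp (continuous_id.sub continuous_const))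
      have h3 : Tendsto (fun w : F => ‖b.equivFun (w - w₀) i‖ₑ) (𝓝 w₀) (𝓝 0) := by
        simpa using h2.enorm.tendsto w₀
      simpa using ENNReal.Tendsto.mul_const h3 (Or.inr (hMtop i).ne)
    simpa using tendsto_const_nhds.add (tendsto_finsetSum Finset.univ fun i _ => h1 i)
  have hev1 : ∀ᶠ z in 𝓝 z₀, z ∈ D ∧ Q z w₀ ^ (1 / 2 : ℝ) < d ∧ ∀ i, Q z (b i) ^ (1 / 2 : ℝ) < M i :=
    (show ∀ᶠ z in 𝓝 z₀, z ∈ D from hD.mem_nhds hz₀).and ((hconst _ _ hz₀ _ hd1).and (eventually_all.2 hMev))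
  have hev2 := hcont.eventually_lt_const hd2
  change ∀ᶠ p in 𝓝 (z₀, w₀), ENNReal.log (Q p.1 p.2) < ENNReal.log c'
  rw [nhds_prod_eq]
  filter_upwards [hev1.prod_mk hev2] with p hp
  obtain ⟨⟨hzD, h1, h2⟩, h3⟩ := hp
  rw [ENNReal.log_lt_log_iff, ← ENNReal.rpow_lt_rpow_iff (z := 1 / 2) (by norm_num)]
  refine lt_of_le_of_lt ?_ h3
  have hsum : ∀ s : Finset (Fin (Module.finrank ℂ F)), ∀ x : Fin (Module.finrank ℂ F) → ℂ,
      Q p.1 (w₀ + ∑ i ∈ s, x i • b i) ^ (1 / 2 : ℝ) ≤ d + ∑ i ∈ s, ‖x i‖ₑ * M i := by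
    intro s x
    induction s using Finset.cons_induction with
    | empty => simpa using h1.le
    | cons i s his ih =>
      rw [Finset.sum_cons, Finset.sum_cons, add_left_comm, add_left_comm d]
      refine ((hQ _ hzD).rpow_add_le _ _).trans (add_le_add ?_ ih)
      exact ((hQ _ hzD).smul_le _ _).trans (mul_le_mul_right (h2 i).le _)
  have h4 := hsum Finset.univ (b.equivFun (p.2 - w₀))
  rwa [b.sum_equivFun, add_sub_cancel] at h4

/-- A line with direction `(ξ, η)`, `ξ ≠ 0`, lies in the graph of the affine section `p.2 + ℓ (z -
p.1) η` with `ℓ ξ = 1`, so the hypothesis applies; vertical lines use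
`IsSupForm.log_le_of_polynomial`. The section varies with the direction, and so does the radius:
hence the weak form of the conclusion. -/
theorem hasSmallSubmeans_of_psh_sections (hD : IsOpen D) (hQ : ∀ z ∈ D, IsSupForm (Q z))
    (hpsh : ∀ a : (Fin n → ℂ) → F, AnalyticOnNhd ℂ a univ →
      IsPshInCoordinates (fun z => ENNReal.log (Q z (a z))) D) {p : (Fin n → ℂ) × F} (hp : p.1 ∈ D) :
    HasSmallSubmeans (fun p : (Fin n → ℂ) × F => ENNReal.log (Q p.1 p.2)) p := by
  rintro ⟨ξ, η⟩
  by_cases hξ : ξ = 0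
  · subst hξ
    refine ⟨1, one_pos, fun r _ _ => le_circleMean_of_forall_polynomial ?_ (fun t _ => ?_)
      fun P hP => ?_⟩
    · have h1 := upperSemicontinuousOn_of_psh_sections hD hQ hpsh
      have hc : Continuous fun t : ℂ => p + t • (r : ℂ) • ((0 : Fin n → ℂ), η) := by fun_prop
      intro t ht c hc'
      exact (hc.continuousWithinAt.tendsto_nhdsWithin fun t _ => by simpa using hp).eventually
        (h1 _ (by simpa using hp) c hc')
    · exact lt_top_of_psh_sections hpsh (by simpa using hp)
    · refine (hQ _ hp).log_le_of_polynomial p.2 ((r : ℂ) • η) P fun t ht => ?_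
      simpa using hP t ht
  · obtain ⟨ℓ, hℓ⟩ : ∃ ℓ : (Fin n → ℂ) →L[ℂ] ℂ, ℓ ξ = 1 := by
      obtain ⟨i, hi⟩ := Function.ne_iff.1 hξ
      exact ⟨(ξ i)⁻¹ • ContinuousLinearMap.proj i, by simpa using inv_mul_cancel₀ hi⟩
    have ha : AnalyticOnNhd ℂ (fun z => p.2 + ℓ (z - p.1) • η) univ := by
      intro z _
      refine analyticAt_const.add (AnalyticAt.smul ?_ analyticAt_const)
      exact (ℓ.analyticAt _).comp_of_eq (analyticAt_id.sub analyticAt_const) rfl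
    obtain ⟨r₀, hr₀, h1⟩ := (hpsh _ ha).hasSmallSubmeans hp ξ
    refine ⟨r₀, hr₀, fun r hr hrr => ?_⟩
    have h2 := h1 r hr hrr
    simp only [sub_self, map_zero, zero_smul, add_zero] at h2
    refine h2.trans_eq ?_
    rw [circleMean_eq_comp_line (φ := fun p : (Fin n → ℂ) × F => ENNReal.log (Q p.1 p.2)),
      circleMean_eq_comp_line (φ := fun z => ENNReal.log (Q z (p.2 + ℓ (z - p.1) • η)))]
    congr 1
    ext t
    simp [hℓ, mul_smul]

end FormFamilies

/-! ### Trivializations of the dual of a pulled-back bundle -/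

section BundleTrivializations

theorem continuousLinearMapAt_trivializationAt_trivial {Z : Type*} [TopologicalSpace Z]
    (z₀ z : Z) (c : ℂ) :
    (trivializationAt ℂ (Bundle.Trivial Z ℂ) z₀).continuousLinearMapAt ℂ z c = c :=
  congrArg (fun L : ℂ →L[ℂ] ℂ => L c) (Trivial.continuousLinearMapAt_trivialization ℂ Z ℂ z)

variable {n m : ℕ}
  {X : Type*} [TopologicalSpace X] [ChartedSpace (Fin n → ℂ) X]
  {Y : Type*} [TopologicalSpace Y] [ChartedSpace (Fin m → ℂ) Y]
  {F : Type*} [NormedAddCommGroup F] [NormedSpace ℂ F]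
  {E : X → Type*} [∀ x, AddCommGroup (E x)] [∀ x, Module ℂ (E x)]
  [∀ x, TopologicalSpace (E x)] [TopologicalSpace (TotalSpace F E)]
  [FiberBundle F E] [VectorBundle ℂ F E]
  (f : C^ω⟮𝓘(ℂ, Fin m → ℂ), Y; 𝓘(ℂ, Fin n → ℂ), X⟯)

/-- The dual of `f^*E` and the pull-back of the dual of `E` have the same fibres but separately
constructed trivializations. Their coordinates agree, which lets the dual case use the same argument
as `E` itself. -/
theorem trivializationAt_hom_pullback_apply (y₀ y : Y)
    (hy : f y ∈ (trivializationAt F E (f y₀)).baseSet) (v : E (f y) →L[ℂ] ℂ) :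
    (trivializationAt (F →L[ℂ] ℂ) (fun y => (f *ᵖ E) y →L[ℂ] Bundle.Trivial Y ℂ y) y₀ ⟨y, v⟩).2 =
      (trivializationAt (F →L[ℂ] ℂ) (fun x => E x →L[ℂ] Bundle.Trivial X ℂ x) (f y₀) ⟨f y, v⟩).2 := by
  have key : ∀ w : F, ((trivializationAt F E (f y₀)).pullback f).symm y w =
      (trivializationAt F E (f y₀)).symm (f y) w := by
    intro w
    have h1 := ((trivializationAt F E (f y₀)).pullback f).apply_mk_symm (b := y) hy w
    have h1' := congrArg Prod.snd h1
    have h2 : trivializationAt F E (f y₀)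
        ⟨f y, ((trivializationAt F E (f y₀)).pullback f).symm y w⟩ = (f y, w) :=
      Prod.ext ((trivializationAt F E (f y₀)).coe_fst' hy) h1'
    have h3 := (trivializationAt F E (f y₀)).apply_mk_symm hy w
    have h4 := (trivializationAt F E (f y₀)).injOn ((Trivialization.mem_source _).2 hy) ((Trivialization.mem_source _).2 hy) (h2.trans h3.symm)
    injection h4
  rw [hom_trivializationAt_apply, hom_trivializationAt_apply]
  ext w
  refine (continuousLinearMapAt_trivializationAt_trivial y₀ y _).trans
    (Eq.trans ?_ (continuousLinearMapAt_trivializationAt_trivial (f y₀) (f y) _).symm)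
  exact congrArg v ((((trivializationAt F E (f y₀)).pullback f).symmL_apply (R := ℂ) (b := y) hy w).trans
    ((key w).trans ((trivializationAt F E (f y₀)).symmL_apply (R := ℂ) hy w).symm))

end BundleTrivializations

/-! ### Curvature of the pull-back -/

section CurvatureOfPullback

open Filter Topology Metric

variable {n m : ℕ}
  {X : Type*} [TopologicalSpace X] [ChartedSpace (Fin n → ℂ) X] [IsManifold 𝓘(ℂ, Fin n → ℂ) ω X]
  {Y : Type*} [TopologicalSpace Y] [ChartedSpace (Fin m → ℂ) Y] [IsManifold 𝓘(ℂ, Fin m → ℂ) ω Y]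
  {F : Type*} [NormedAddCommGroup F] [NormedSpace ℂ F]
  {E : X → Type*} [∀ x, AddCommGroup (E x)] [∀ x, Module ℂ (E x)]
  [∀ x, TopologicalSpace (E x)] [TopologicalSpace (TotalSpace F E)]
  [FiberBundle F E] [VectorBundle ℂ F E] [ContMDiffVectorBundle ω F E 𝓘(ℂ, Fin n → ℂ)]

theorem isHolomorphicSectionOn_symmL (x₀ : X) {e : OpenPartialHomeomorph X (Fin n → ℂ)}
    (he : e ∈ atlas (Fin n → ℂ) X) {a : (Fin n → ℂ) → F} (ha : AnalyticOnNhd ℂ a univ) :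
    IsHolomorphicSectionOn (n := n) F
      (fun x => (trivializationAt F E x₀).symmL ℂ x (a (e x)))
      (e.source ∩ (trivializationAt F E x₀).baseSet) := by
  have h1 := ((trivializationAt F E x₀).contMDiffOn_section_iff (IB := 𝓘(ℂ, Fin n → ℂ)) (n := ω)
    (s := fun x => (trivializationAt F E x₀).symmL ℂ x (a (e x)))
    (a := e.source ∩ (trivializationAt F E x₀).baseSet)
    (e.open_source.inter (trivializationAt F E x₀).open_baseSet) inter_subset_right)
  refine h1.2 ?_
  have h2 := (ha.contMDiffOn_comp_chart (X := X) isOpen_univ he).mono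
    (show e.source ∩ (trivializationAt F E x₀).baseSet ⊆ e.source ∩ e ⁻¹' univ from
      fun x hx => ⟨hx.1, mem_univ _⟩)
  refine h2.congr fun x hx => ?_
  rw [(trivializationAt F E x₀).symmL_apply hx.2, (trivializationAt F E x₀).apply_mk_symm hx.2]

omit [IsManifold 𝓘(ℂ, Fin n → ℂ) ω X] [ChartedSpace (Fin n → ℂ) X]
  [ContMDiffVectorBundle ω F E 𝓘(ℂ, Fin n → ℂ)] in
-- For use with `x' = e.symm (e x)`, which equals `x` but not by definition; the separate `x'`
-- absorbs the transport between fibres.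
theorem symmL_trivializationAt_snd {x₀ x x' : X} (hx : x ∈ (trivializationAt F E x₀).baseSet)
    (hxx : x' = x) (q : ∀ x, E x → ℝ≥0∞) (v : E x) :
    q x' ((trivializationAt F E x₀).symmL ℂ x' (trivializationAt F E x₀ ⟨x, v⟩).2) = q x v := by
  subst hxx
  have h1 := (trivializationAt F E x₀).symmL_continuousLinearMapAt (R := ℂ) hx v
  have h2 : (trivializationAt F E x₀).continuousLinearMapAt ℂ x' v =
      (trivializationAt F E x₀ ⟨x', v⟩).2 :=
    congrFun ((trivializationAt F E x₀).coe_linearMapAt_of_mem (R := ℂ) hx) v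
  rw [← h2, h1]

/-- A semi-negatively curved family of forms stays so after pull-back. -/
theorem isPshOn_log_comp [FiniteDimensional ℂ F] {q : ∀ x, E x → ℝ≥0∞} (hq : ∀ x, IsSupForm (q x))
    (hneg : IsSemiNegativelyCurvedOn (n := n) F q univ) {f : Y → X}
    (hf : ContMDiff 𝓘(ℂ, Fin m → ℂ) 𝓘(ℂ, Fin n → ℂ) ω f) {U : Set Y} (hU : IsOpen U)
    {v : ∀ y, E (f y)} (hv : ∀ y₀ ∈ U, ContMDiffAt 𝓘(ℂ, Fin m → ℂ) 𝓘(ℂ, F) ω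
      (fun y => (trivializationAt F E (f y₀) ⟨f y, v y⟩).2) y₀) :
    IsPshOn (n := m) (fun y => ENNReal.log (q (f y) (v y))) U := by
  intro d hd
  refine isPshInCoordinates_of_locally fun z hz => ?_
  set x₀ := f (d.symm z) with hx₀
  set e := chartAt (Fin n → ℂ) x₀
  have he : e ∈ atlas (Fin n → ℂ) X := chart_mem_atlas _ _
  set L := trivializationAt F E x₀ with hL
  obtain ⟨O, hO, hbO⟩ := (contMDiffAt_iff_contMDiffOn_nhds (by simp)).1 (hv _ hz.2)
  rw [← hx₀] at hbO
  have hbO' := hbO.mono interior_subset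
  have hW : IsOpen ((interior O ∩ U) ∩ f ⁻¹' (e.source ∩ L.baseSet)) :=
    (isOpen_interior.inter hU).inter ((e.open_source.inter L.open_baseSet).preimage hf.continuous)
  refine ⟨d.target ∩ d.symm ⁻¹' ((interior O ∩ U) ∩ f ⁻¹' (e.source ∩ L.baseSet)),
    fun w hw => ⟨hw.1, hw.2.1.2⟩, d.isOpen_inter_preimage_symm hW,
    ⟨hz.1, ⟨mem_interior_iff_mem_nhds.2 hO, hz.2⟩, mem_chart_source _ _,
      FiberBundle.mem_baseSet_trivializationAt' x₀⟩, ?_⟩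
  have hD : IsOpen (e.target ∩ e.symm ⁻¹' L.baseSet) := e.isOpen_inter_preimage_symm L.open_baseSet
  set Q : (Fin n → ℂ) → F → ℝ≥0∞ := fun z w => q (e.symm z) (L.symmL ℂ (e.symm z) w) with hQ
  have hQs : ∀ z ∈ e.target ∩ e.symm ⁻¹' L.baseSet, IsSupForm (Q z) := fun z _ =>
    (hq _).comp (L.symmL ℂ (e.symm z) : F →ₗ[ℂ] E (e.symm z))
  have hpsh : ∀ a : (Fin n → ℂ) → F, AnalyticOnNhd ℂ a univ →
      IsPshInCoordinates (fun z => ENNReal.log (Q z (a z))) (e.target ∩ e.symm ⁻¹' L.baseSet) := by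
    intro a ha
    have h1 := hneg _ (e.open_source.inter L.open_baseSet) (subset_univ _) _
      (isHolomorphicSectionOn_symmL x₀ he ha) e he
    refine (h1.mono hD fun z hz => ⟨hz.1, e.map_target hz.1, hz.2⟩).congr fun z hz => ?_
    simp only [hQ, e.right_inv hz.1, hL]
  have hg1 := hf.analyticOnNhd_charts hd he
  have hg2 := hbO'.analyticOnNhd_comp_chart_symm isOpen_interior hd
  -- In coordinates the section is an analytic map into base times fibre, and its log-norm is the
  -- joint function composed with that map.
  have key := isPshInCoordinates_comp (hD.prod isOpen_univ)
    (upperSemicontinuousOn_of_psh_sections hD hQs hpsh)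
    (fun p hp => lt_top_of_psh_sections hpsh hp.1)
    (fun p hp => hasSmallSubmeans_of_psh_sections hD hQs hpsh hp.1)
    (d.isOpen_inter_preimage_symm hW)
    (g := fun w => (e (f (d.symm w)), (L ⟨f (d.symm w), v (d.symm w)⟩).2))
    (fun w hw => (hg1 w ⟨hw.1, hw.2.2.1⟩).prod (hg2 w ⟨hw.1, hw.2.1.1⟩))
    (fun w hw => ⟨⟨e.map_source hw.2.2.1, by
      simpa [e.left_inv hw.2.2.1] using hw.2.2.2⟩, mem_univ _⟩)
  refine key.congr fun w hw => ?_
  exact congrArg ENNReal.log (symmL_trivializationAt_snd hw.2.2.2 (e.left_inv hw.2.2.1) q _)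

end CurvatureOfPullback

/-! ### Measurability of pulled-back metrics -/

section PullbackMetric

open Filter Topology Metric

/-- A finite Hermitian form is determined by its values on sums of two vectors of a real basis. -/
theorem IsUnboundedHermitianForm.apply_sum_eq {V : Type*} [AddCommGroup V] [Module ℂ V]
    {q : V → ℝ≥0∞} (hq : IsUnboundedHermitianForm q) (hfin : ∀ v, q v ≠ ⊤)
    {ι : Type*} [Fintype ι] (c : ι → V) (r : ι → ℝ) :
    q (∑ k, (r k : ℂ) • c k) = ENNReal.ofReal (∑ k, ∑ l, r k * r l *
      (((q (c k + c l)).toReal - (q (c k)).toReal - (q (c l)).toReal) / 2)) := by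
  obtain ⟨W, B, hsymm, hpos, hW, hoff⟩ := hq
  have hmem : ∀ v, v ∈ W := fun v => by
    by_contra h
    exact hfin v (hoff v h)
  set b : ι → W := fun k => ⟨c k, hmem _⟩ with hb
  have hval : ∀ v : W, (q (v : V)).toReal = (B v v).re := fun v => by
    rw [hW, ENNReal.toReal_ofReal (hpos v)]
  -- Real polarization suffices: with real coefficients only the real parts of `B` enter.
  have hpol : ∀ k l, ((q (c k + c l)).toReal - (q (c k)).toReal - (q (c l)).toReal) / 2 =
      (B (b k) (b l)).re := by
    intro k l
    have h1 := hval (b k + b l)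
    have h2 := hval (b k)
    have h3 := hval (b l)
    have h4 : (B (b l) (b k)).re = (B (b k) (b l)).re := by rw [hsymm (b l) (b k)]; simp
    simp only [Submodule.coe_add, map_add, LinearMap.add_apply, Complex.add_re, hb] at h1 h2 h3 h4
    rw [h1, h2, h3, h4]
    ring
  have hsum : (∑ k, (r k : ℂ) • c k) = ((∑ k, (r k : ℂ) • b k : W) : V) := by
    simp [hb]
  rw [hsum, hW]
  congr 1
  simp only [hpol]
  simp only [map_sum, LinearMap.sum_apply, map_smul, LinearMap.map_smulₛₗ, LinearMap.smul_apply,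
    Complex.re_sum, smul_eq_mul, Complex.conj_ofReal, Complex.re_ofReal_mul]
  refine Finset.sum_congr rfl fun k _ => ?_
  rw [Finset.mul_sum]
  refine Finset.sum_congr rfl fun l _ => ?_
  rw [hsymm (b l) (b k), Complex.conj_re]
  ring

theorem aemeasurable_restrict_of_locally {α β : Type*} [TopologicalSpace α]
    [SecondCountableTopology α] [MeasurableSpace α] [MeasurableSpace β] {μ : Measure α}
    {g : α → β} {S : Set α} (h : ∀ x ∈ S, ∃ N ∈ 𝓝 x, AEMeasurable g (μ.restrict N)) :
    AEMeasurable g (μ.restrict S) := by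
  choose! N hN hg using h
  obtain ⟨t, htS, htc, htU⟩ := TopologicalSpace.countable_cover_nhdsWithin
    (fun x hx => mem_nhdsWithin_of_mem_nhds (hN x hx))
  have : Countable t := htc.to_subtype
  have h1 : AEMeasurable g (μ.restrict (⋃ x : t, N x)) :=
    aemeasurable_iUnion_iff.2 fun x => hg x (htS x.2)
  refine h1.mono_set (htU.trans ?_)
  simp

variable {n m : ℕ}
  {X : Type*} [TopologicalSpace X] [ChartedSpace (Fin n → ℂ) X] [IsManifold 𝓘(ℂ, Fin n → ℂ) ω X]
  {Y : Type*} [TopologicalSpace Y] [ChartedSpace (Fin m → ℂ) Y] [IsManifold 𝓘(ℂ, Fin m → ℂ) ω Y]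
  {F : Type*} [NormedAddCommGroup F] [NormedSpace ℂ F]
  {E : X → Type*} [∀ x, AddCommGroup (E x)] [∀ x, Module ℂ (E x)]
  [∀ x, TopologicalSpace (E x)] [TopologicalSpace (TotalSpace F E)]
  [FiberBundle F E] [VectorBundle ℂ F E]

/-- Composition of a measurable function in a chart downstairs with a surjective holomorphic map. -/
theorem AEMeasurable.comp_charts [SecondCountableTopology Y] [ConnectedSpace Y] [Nonempty X]
    {f : Y → X} (hf : ContMDiff 𝓘(ℂ, Fin m → ℂ) 𝓘(ℂ, Fin n → ℂ) ω f)
    (hsurj : Function.Surjective f)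
    {e : OpenPartialHomeomorph Y (Fin m → ℂ)} (he : e ∈ atlas (Fin m → ℂ) Y)
    {e' : OpenPartialHomeomorph X (Fin n → ℂ)} (he' : e' ∈ atlas (Fin n → ℂ) X)
    {β : Type*} [MeasurableSpace β] {H : (Fin n → ℂ) → β} {S : Set (Fin n → ℂ)}
    (hH : AEMeasurable H (volume.restrict S))
    {D : Set (Fin m → ℂ)} (hD : MeasurableSet D)
    (hDe : D ⊆ e.target ∩ e.symm ⁻¹' (f ⁻¹' (e'.source ∩ e' ⁻¹' S))) :
    AEMeasurable (fun z => H (e' (f (e.symm z)))) (volume.restrict D) := by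
  have hg : AEMeasurable (fun z => e' (f (e.symm z))) (volume.restrict D) :=
    ((hf.analyticOnNhd_charts he he').continuousOn.mono
      fun z hz => ⟨(hDe hz).1, (hDe hz).2.1⟩).aemeasurable hD
  refine AEMeasurable.comp_aemeasurable (f := fun z => e' (f (e.symm z))) (hH.mono_ac ?_) hg
  refine Measure.AbsolutelyContinuous.mk fun s hs h0 => ?_
  rw [Measure.map_apply_of_aemeasurable hg hs, Measure.restrict_apply₀' hD.nullMeasurableSet]
  rw [Measure.restrict_apply hs] at h0
  refine measure_mono_null ?_ (volume_preimage_in_charts_eq_zero hf hsurj he he' h0)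
  rintro z ⟨hz1, hz2⟩
  have h1 := hDe hz2
  exact ⟨h1.1, h1.2.1, hz1, h1.2.2⟩

omit [IsManifold 𝓘(ℂ, Fin n → ℂ) ω X] [VectorBundle ℂ F E] in
theorem IsSingularHermitianMetricOn.isNullInCharts {h : ∀ x, E x → ℝ≥0∞} {Ω : Set X}
    (hh : IsSingularHermitianMetricOn (n := n) F h Ω) :
    IsNullInCharts (n := n) {x | x ∈ Ω ∧ ¬ ∀ v : E x, v ≠ 0 → 0 < h x v ∧ h x v < ⊤} := by
  intro e he
  have h1 := hh.det e he
  rw [ae_iff] at h1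
  refine measure_mono_null ?_ (nonpos_iff_eq_zero.1 ((Measure.le_restrict_apply _ _).trans h1.le))
  rintro z ⟨hz1, hz2, hz3⟩
  exact ⟨hz3, hz1, hz2⟩

/-- As `v` need not come from a section on `X`, it is expanded in a real basis of the model fibre.
Off a null set the form is finite, and its value at `v` is quadratic in the continuous coordinates,
with coefficients made from norms of sections that are constant in the trivialization; those are
measurable after pull-back. -/
theorem IsSingularHermitianMetricOn.aemeasurable_comp [SecondCountableTopology Y] [ConnectedSpace Y]
    [Nonempty X] [FiniteDimensional ℂ F] [ContMDiffVectorBundle ω F E 𝓘(ℂ, Fin n → ℂ)]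
    {h : ∀ x, E x → ℝ≥0∞} (hh : IsSingularHermitianMetricOn (n := n) F h univ)
    {f : Y → X} (hf : ContMDiff 𝓘(ℂ, Fin m → ℂ) 𝓘(ℂ, Fin n → ℂ) ω f)
    (hsurj : Function.Surjective f) {U : Set Y}
    {v : ∀ y, E (f y)} (hv : ∀ y₀ ∈ U, ContMDiffAt 𝓘(ℂ, Fin m → ℂ) 𝓘(ℂ, F) ω
      (fun y => (trivializationAt F E (f y₀) ⟨f y, v y⟩).2) y₀)
    {d : OpenPartialHomeomorph Y (Fin m → ℂ)} (hd : d ∈ atlas (Fin m → ℂ) Y) :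
    AEMeasurable (fun z => h (f (d.symm z)) (v (d.symm z)))
      (volume.restrict (d.target ∩ d.symm ⁻¹' U)) := by
  refine aemeasurable_restrict_of_locally fun z hz => ?_
  set x₀ := f (d.symm z) with hx₀
  set e := chartAt (Fin n → ℂ) x₀
  have he : e ∈ atlas (Fin n → ℂ) X := chart_mem_atlas _ _
  set L := trivializationAt F E x₀ with hL
  obtain ⟨O, hO, hbO⟩ := (contMDiffAt_iff_contMDiffOn_nhds (by simp)).1 (hv _ hz.2)
  rw [← hx₀] at hbO
  have hbO' := hbO.mono interior_subset
  have hW : IsOpen (interior O ∩ f ⁻¹' (e.source ∩ L.baseSet)) :=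
    isOpen_interior.inter ((e.open_source.inter L.open_baseSet).preimage hf.continuous)
  set D := d.target ∩ d.symm ⁻¹' (interior O ∩ f ⁻¹' (e.source ∩ L.baseSet)) with hDdef
  have hD : IsOpen D := d.isOpen_inter_preimage_symm hW
  refine ⟨D, hD.mem_nhds ⟨hz.1, mem_interior_iff_mem_nhds.2 hO, mem_chart_source _ _,
      FiberBundle.mem_baseSet_trivializationAt' x₀⟩, ?_⟩
  set c := Module.finBasis ℝ F
  set G : F → (Fin m → ℂ) → ℝ≥0∞ := fun w z => h (e.symm (e (f (d.symm z))))
    (L.symmL ℂ (e.symm (e (f (d.symm z)))) w) with hG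
  have hGm : ∀ w, AEMeasurable (G w) (volume.restrict D) := by
    intro w
    have h1 := hh.measurable _ (e.open_source.inter L.open_baseSet) (subset_univ _) _
      (isHolomorphicSectionOn_symmL x₀ he (a := fun _ => w) analyticOnNhd_const) e he
    refine h1.comp_charts hf hsurj hd he hD.measurableSet fun z hz =>
      ⟨hz.1, hz.2.2.1, e.map_source hz.2.2.1, ?_⟩
    simp only [mem_preimage, e.left_inv hz.2.2.1]
    exact hz.2.2
  set b : (Fin m → ℂ) → F := fun z => (L ⟨f (d.symm z), v (d.symm z)⟩).2 with hb
  have hbc : ContinuousOn b D := (hbO'.analyticOnNhd_comp_chart_symm isOpen_interior hd).continuousOn.mono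
    fun z hz => ⟨hz.1, hz.2.1⟩
  have hbm : ∀ k, AEMeasurable (fun z => c.equivFun (b z) k) (volume.restrict D) := by
    intro k
    have h1 : Continuous c.equivFun :=
      (c.equivFun : F →ₗ[ℝ] (Fin (Module.finrank ℝ F) → ℝ)).continuous_of_finiteDimensional
    exact (((continuous_apply k).comp h1).comp_continuousOn hbc).aemeasurable hD.measurableSet
  have hm : AEMeasurable (fun z => ENNReal.ofReal (∑ k, ∑ l, c.equivFun (b z) k * c.equivFun (b z) l *
      (((G (c k + c l) z).toReal - (G (c k) z).toReal - (G (c l) z).toReal) / 2)))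
      (volume.restrict D) := by
    refine AEMeasurable.ennreal_ofReal ?_
    refine Finset.aemeasurable_fun_sum _ fun k _ => Finset.aemeasurable_fun_sum _ fun l _ => ?_
    exact ((hbm k).mul (hbm l)).mul ((((hGm _).ennreal_toReal.sub (hGm _).ennreal_toReal).sub
      (hGm _).ennreal_toReal).div_const 2)
  refine hm.congr ?_
  have hnull := (hh.isNullInCharts.preimage hf hsurj) d hd
  rw [Filter.EventuallyEq, ae_restrict_iff' hD.measurableSet]
  filter_upwards [measure_eq_zero_iff_ae_notMem.1 hnull] with w hw hwD
  have hfin : ∀ u : E (f (d.symm w)), h (f (d.symm w)) u ≠ ⊤ := by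
    intro u
    have h1 : ∀ v : E (f (d.symm w)), v ≠ 0 → 0 < h _ v ∧ h _ v < ⊤ := by
      by_contra hcon
      exact hw ⟨hwD.1, mem_univ _, hcon⟩
    by_cases hu : u = 0
    · obtain ⟨W, B, -, -, hW, -⟩ := hh.form (f (d.symm w)) (mem_univ _)
      have := hW 0
      rw [hu]
      simp only [Submodule.coe_zero] at this
      simp [this]
    · exact (h1 u hu).2.ne
  have key : ∀ x, x = f (d.symm w) → ENNReal.ofReal (∑ k, ∑ l,
      c.equivFun (b w) k * c.equivFun (b w) l * (((h x (L.symmL ℂ x (c k + c l))).toReal -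
        (h x (L.symmL ℂ x (c k))).toReal - (h x (L.symmL ℂ x (c l))).toReal) / 2)) =
      h (f (d.symm w)) (v (d.symm w)) := by
    rintro x rfl
    have h1 := (hh.form (f (d.symm w)) (mem_univ _)).apply_sum_eq hfin
      (fun k => L.symmL ℂ (f (d.symm w)) (c k)) (fun k => c.equivFun (b w) k)
    simp only [← map_add, ← map_smul, ← map_sum] at h1
    rw [← h1, ← symmL_trivializationAt_snd (hx := hwD.2.2.2) rfl h (v (d.symm w))]
    congr 2
    exact c.sum_equivFun (b w)
  exact key _ (e.left_inv hwD.2.2.1)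

end PullbackMetric

/-! ### Sections of pulled-back bundles, and descent of metrics -/

section Sections

open Filter Topology

variable {n m : ℕ}
  {X : Type*} [TopologicalSpace X] [ChartedSpace (Fin n → ℂ) X]
  {Y : Type*} [TopologicalSpace Y] [ChartedSpace (Fin m → ℂ) Y]
  {F : Type*} [NormedAddCommGroup F] [NormedSpace ℂ F]
  {E : X → Type*} [∀ x, AddCommGroup (E x)] [∀ x, Module ℂ (E x)]
  [∀ x, TopologicalSpace (E x)] [TopologicalSpace (TotalSpace F E)]
  [FiberBundle F E] [VectorBundle ℂ F E]
  (f : C^ω⟮𝓘(ℂ, Fin m → ℂ), Y; 𝓘(ℂ, Fin n → ℂ), X⟯)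

omit [∀ x, Module ℂ (E x)] [VectorBundle ℂ F E] in
theorem contMDiffAt_pullback_section_iff (v : ∀ y, (f *ᵖ E) y) (y₀ : Y) :
    ContMDiffAt 𝓘(ℂ, Fin m → ℂ) (𝓘(ℂ, Fin m → ℂ).prod 𝓘(ℂ, F)) ω
      (fun y => TotalSpace.mk' F (E := f *ᵖ E) y (v y)) y₀ ↔
    ContMDiffAt 𝓘(ℂ, Fin m → ℂ) 𝓘(ℂ, F) ω
      (fun y => (trivializationAt F E (f y₀) (TotalSpace.mk' F (E := E) (f y) (v y))).2) y₀ :=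
  contMDiffAt_section y₀

theorem contMDiffAt_hom_pullback_section_iff (v : ∀ y, (f *ᵖ E) y →L[ℂ] Bundle.Trivial Y ℂ y)
    (y₀ : Y) :
    ContMDiffAt 𝓘(ℂ, Fin m → ℂ) (𝓘(ℂ, Fin m → ℂ).prod 𝓘(ℂ, F →L[ℂ] ℂ)) ω
      (fun y => TotalSpace.mk' (F →L[ℂ] ℂ)
        (E := fun y => (f *ᵖ E) y →L[ℂ] Bundle.Trivial Y ℂ y) y (v y)) y₀ ↔
    ContMDiffAt 𝓘(ℂ, Fin m → ℂ) 𝓘(ℂ, F →L[ℂ] ℂ) ω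
      (fun y => (trivializationAt (F →L[ℂ] ℂ) (fun x => E x →L[ℂ] Bundle.Trivial X ℂ x) (f y₀)
        (TotalSpace.mk' (F →L[ℂ] ℂ) (E := fun x => E x →L[ℂ] Bundle.Trivial X ℂ x)
          (f y) (v y))).2) y₀ := by
  refine (contMDiffAt_section y₀).trans (Filter.EventuallyEq.contMDiffAt_iff ?_)
  have h1 : f ⁻¹' (trivializationAt F E (f y₀)).baseSet ∈ 𝓝 y₀ :=
    ((trivializationAt F E (f y₀)).open_baseSet.preimage f.contMDiff.continuous).mem_nhds
      (FiberBundle.mem_baseSet_trivializationAt' (f y₀))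
  filter_upwards [h1] with y hy
  exact trivializationAt_hom_pullback_apply f y₀ y hy (v y)

omit [∀ x, AddCommGroup (E x)] [∀ x, Module ℂ (E x)] [VectorBundle ℂ F E] in
theorem IsHolomorphicSectionOn.contMDiffAt_comp {v : ∀ x, E x} {U : Set X} (hU : IsOpen U)
    (hv : IsHolomorphicSectionOn (n := n) F v U) {f : Y → X}
    (hf : ContMDiff 𝓘(ℂ, Fin m → ℂ) 𝓘(ℂ, Fin n → ℂ) ω f) {y₀ : Y} (hy : f y₀ ∈ U) :
    ContMDiffAt 𝓘(ℂ, Fin m → ℂ) 𝓘(ℂ, F) ω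
      (fun y => (trivializationAt F E (f y₀) ⟨f y, v (f y)⟩).2) y₀ := by
  have h1 := (contMDiffAt_section (f y₀)).1 (ContMDiffOn.contMDiffAt hv (hU.mem_nhds hy))
  exact h1.comp y₀ hf.contMDiffAt

variable [IsManifold 𝓘(ℂ, Fin n → ℂ) ω X] [IsManifold 𝓘(ℂ, Fin m → ℂ) ω Y]

omit [∀ x, AddCommGroup (E x)] [∀ x, Module ℂ (E x)] [VectorBundle ℂ F E] in
/-- Descent of semi-negative curvature. -/
theorem isSemiNegativelyCurvedOn_of_descent [SecondCountableTopology Y] [ConnectedSpace Y]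
    [ConnectedSpace X] {f : Y → X} (hf : ContMDiff 𝓘(ℂ, Fin m → ℂ) 𝓘(ℂ, Fin n → ℂ) ω f)
    (hproper : IsProperMap f) (hsurj : Function.Surjective f) {X₁ : Set X}
    (hX₁ : IsAnalyticZariskiOpen (n := n) X₁) (hne : X₁.Nonempty)
    {q q₁ : ∀ x, E x → ℝ≥0∞} {qY : ∀ y, E (f y) → ℝ≥0∞}
    (hq : ∀ x, ∃ y, f y = x ∧ ∀ s : ∀ x, E x, q x (s x) = qY y (s (f y)))
    (hq₁ : ∀ y, f y ∈ X₁ → qY y = q₁ (f y))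
    (hpsh : ∀ U, IsOpen U → ∀ s : ∀ x, E x, IsHolomorphicSectionOn (n := n) F s U →
      IsPshOn (n := m) (fun y => ENNReal.log (qY y (s (f y)))) (f ⁻¹' U)) :
    IsSemiNegativelyCurvedOn (n := n) F q univ := by
  intro U hU _ s hs
  obtain ⟨φ, hφ, hφu⟩ := (hpsh U hU s hs).exists_descent hf hproper hsurj (A := X₁ᶜ) hX₁
    (by rw [Ne, compl_univ_iff]; exact hne.ne_empty) hU (fun y y' hyy _ hyA => by
      have hy : f y ∈ X₁ := not_not.1 hyA
      rw [hq₁ y hy, hq₁ y' (hyy ▸ hy)]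
      exact congrArg (fun x => ENNReal.log (q₁ x (s x))) hyy)
  intro e he
  -- The identity `u = φ ∘ f` holds on entire fibres, so the arbitrary point `y` at which `q` was
  -- read off does not matter.
  refine (hφ e he).congr fun z hz => ?_
  obtain ⟨y, hy, h1⟩ := hq (e.symm z)
  have h2 := hφu y (by rw [mem_preimage, hy]; exact hz.2)
  change φ (e.symm z) = ENNReal.log (q (e.symm z) (s (e.symm z)))
  rw [h1]
  exact (congrArg φ hy).symm.trans h2.symm

omit [IsManifold 𝓘(ℂ, Fin n → ℂ) ω X] [VectorBundle ℂ F E] in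
/-- A singular Hermitian metric on the complement of a null set extends as such by any forms. -/
theorem IsSingularHermitianMetricOn.of_null_compl {h₁ h : ∀ x, E x → ℝ≥0∞} {Ω : Set X}
    (hh : IsSingularHermitianMetricOn (n := n) F h₁ Ω) (hΩ : IsOpen Ω)
    (hnull : IsNullInCharts (n := n) Ωᶜ) (hform : ∀ x, IsUnboundedHermitianForm (h x))
    (heq : ∀ x ∈ Ω, h x = h₁ x) : IsSingularHermitianMetricOn (n := n) F h univ := by
  refine ⟨fun x _ => hform x, fun U hU _ v hv e he => ?_, fun e he => ?_⟩
  · have h1 := hh.measurable (U ∩ Ω) (hU.inter hΩ) inter_subset_right v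
      (ContMDiffOn.mono hv inter_subset_left) e he
    have hO : IsOpen (e.target ∩ e.symm ⁻¹' (U ∩ Ω)) := e.isOpen_inter_preimage_symm (hU.inter hΩ)
    have h2 : AEMeasurable (fun z => h (e.symm z) (v (e.symm z)))
        (volume.restrict (e.target ∩ e.symm ⁻¹' (U ∩ Ω))) := by
      refine h1.congr ?_
      filter_upwards [ae_restrict_mem hO.measurableSet] with z hz
      rw [heq _ hz.2.2]
    have h3 : (e.target ∩ e.symm ⁻¹' U : Set (Fin n → ℂ)) ≤ᵐ[volume]
        (e.target ∩ e.symm ⁻¹' (U ∩ Ω) : Set (Fin n → ℂ)) := by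
      filter_upwards [measure_eq_zero_iff_ae_notMem.1 (hnull e he)] with z hz hzU
      exact ⟨hzU.1, hzU.2, not_not.1 fun h => hz ⟨hzU.1, h⟩⟩
    exact h2.mono_measure (Measure.restrict_mono_ae h3)
  · have h1 := hh.det e he
    have hO : MeasurableSet (e.target ∩ e.symm ⁻¹' Ω) :=
      (e.isOpen_inter_preimage_symm hΩ).measurableSet
    rw [preimage_univ, inter_univ, ae_restrict_iff' e.open_target.measurableSet]
    rw [ae_restrict_iff' hO] at h1
    filter_upwards [h1, measure_eq_zero_iff_ae_notMem.1 (hnull e he)] with z hz1 hz2 hz3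
    have hzΩ : e.symm z ∈ Ω := not_not.1 fun h => hz2 ⟨hz3, h⟩
    rw [heq _ hzΩ]
    exact hz1 ⟨hz3, hzΩ⟩

theorem IsSingularHermitianMetricOn.pullbackMetric [SecondCountableTopology Y] [ConnectedSpace Y]
    [Nonempty X] [FiniteDimensional ℂ F] [ContMDiffVectorBundle ω F E 𝓘(ℂ, Fin n → ℂ)]
    {h : ∀ x, E x → ℝ≥0∞} (hh : IsSingularHermitianMetricOn (n := n) F h univ)
    (hsurj : Function.Surjective f) :
    IsSingularHermitianMetricOn (n := m) F (pullbackMetric f h) univ := by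
  refine ⟨fun y _ => hh.form (f y) (mem_univ _), fun U hU _ v hv d hd => ?_, fun d hd => ?_⟩
  · exact hh.aemeasurable_comp f.contMDiff hsurj (v := v) (fun y hy =>
      (contMDiffAt_pullback_section_iff f v y).1 (ContMDiffOn.contMDiffAt hv (hU.mem_nhds hy))) hd
  · have hnull := (hh.isNullInCharts.preimage f.contMDiff hsurj) d hd
    rw [preimage_univ, inter_univ, ae_restrict_iff' d.open_target.measurableSet]
    filter_upwards [measure_eq_zero_iff_ae_notMem.1 hnull] with z hz hz'
    by_contra hcon
    exact hz ⟨hz', mem_univ _, hcon⟩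

end Sections

/-! ### The lemma -/

theorem mainTheorem7 {n m : ℕ}
    {X : Type*} [TopologicalSpace X] [T2Space X] [SecondCountableTopology X] [ConnectedSpace X]
    [ChartedSpace (Fin n → ℂ) X] [IsManifold 𝓘(ℂ, Fin n → ℂ) ω X]
    {Y : Type*} [TopologicalSpace Y] [T2Space Y] [SecondCountableTopology Y] [ConnectedSpace Y]
    [ChartedSpace (Fin m → ℂ) Y] [IsManifold 𝓘(ℂ, Fin m → ℂ) ω Y]
    {F : Type*} [NormedAddCommGroup F] [NormedSpace ℂ F] [FiniteDimensional ℂ F]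
    {E : X → Type*} [∀ x, AddCommGroup (E x)] [∀ x, Module ℂ (E x)]
    [∀ x, TopologicalSpace (E x)] [TopologicalSpace (TotalSpace F E)]
    [FiberBundle F E] [VectorBundle ℂ F E] [ContMDiffVectorBundle ω F E 𝓘(ℂ, Fin n → ℂ)]
    (f : C^ω⟮𝓘(ℂ, Fin m → ℂ), Y; 𝓘(ℂ, Fin n → ℂ), X⟯)
    (hproper : IsProperMap f) (hsurj : Function.Surjective f) :
    -- (1) pull-back of curved metrics
    (∀ h : ∀ x, E x → ℝ≥0∞, IsSingularHermitianMetricOn (n := n) F h univ →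
      (IsSemiNegativelyCurvedOn (n := n) F h univ →
        IsSingularHermitianMetricOn (n := m) F (pullbackMetric f h) univ ∧
        IsSemiNegativelyCurvedOn (n := m) F (pullbackMetric f h) univ) ∧
      (IsSemiPositivelyCurvedOn (n := n) F h univ →
        IsSingularHermitianMetricOn (n := m) F (pullbackMetric f h) univ ∧
        IsSemiPositivelyCurvedOn (n := m) F (pullbackMetric f h) univ)) ∧
    -- (2) extension of a metric whose pull-back extends
    (∀ X₁ : Set X, IsAnalyticZariskiOpen (n := n) X₁ → X₁.Nonempty →
      ∀ h₁ : ∀ x, E x → ℝ≥0∞, IsSingularHermitianMetricOn (n := n) F h₁ X₁ →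
      ∀ hY : ∀ y, (f *ᵖ E) y → ℝ≥0∞, IsSingularHermitianMetricOn (n := m) F hY univ →
        (∀ y ∈ f ⁻¹' X₁, hY y = pullbackMetric f h₁ y) →
        (IsSemiNegativelyCurvedOn (n := m) F hY univ →
          ∃ h : ∀ x, E x → ℝ≥0∞, IsSingularHermitianMetricOn (n := n) F h univ ∧
            IsSemiNegativelyCurvedOn (n := n) F h univ ∧ ∀ x ∈ X₁, h x = h₁ x) ∧
        (IsSemiPositivelyCurvedOn (n := m) F hY univ →
          ∃ h : ∀ x, E x → ℝ≥0∞, IsSingularHermitianMetricOn (n := n) F h univ ∧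
            IsSemiPositivelyCurvedOn (n := n) F h univ ∧ ∀ x ∈ X₁, h x = h₁ x)) := by
  have hf := f.contMDiff
  refine ⟨fun h hh => ⟨fun hneg => ⟨hh.pullbackMetric f hsurj, ?_⟩,
    fun hpos => ⟨hh.pullbackMetric f hsurj, ?_⟩⟩, ?_⟩
  · intro U hU _ v hv
    exact isPshOn_log_comp (fun x => (hh.form x (mem_univ _)).isSupForm) hneg hf hU (v := v)
      fun y hy => (contMDiffAt_pullback_section_iff f v y).1
        (ContMDiffOn.contMDiffAt hv (hU.mem_nhds hy))
  · intro U hU _ v hv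
    exact isPshOn_log_comp (E := fun x => E x →L[ℂ] Bundle.Trivial X ℂ x) (F := F →L[ℂ] ℂ)
      (q := fun x => dualForm (h x)) (fun x => isSupForm_dualForm (h x)) hpos hf hU (v := v)
      fun y hy => (contMDiffAt_hom_pullback_section_iff f v y).1
        (ContMDiffOn.contMDiffAt hv (hU.mem_nhds hy))
  intro X₁ hX₁ hne h₁ hh₁ hY hhY heq
  -- A merely set-theoretic section: `h` is the form of `hY` at one chosen point of each fibre. Over
  -- `X₁` the choice is immaterial by hypothesis, elsewhere by the descent.
  obtain ⟨σ, hσ⟩ : ∃ σ : X → Y, ∀ x, f (σ x) = x := ⟨_, Function.surjInv_eq hsurj⟩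
  set h : ∀ x, E x → ℝ≥0∞ := fun x => hσ x ▸ (hY (σ x) : E (f (σ x)) → ℝ≥0∞) with hdef
  -- The fibre over `f (σ x)` is the fibre over `x` only up to the equality `hσ x`; `tr` carries
  -- properties of forms across it.
  have tr : ∀ P : ∀ x, (E x → ℝ≥0∞) → Prop, ∀ x, P (f (σ x)) (hY (σ x)) → P x (h x) := by
    intro P x hP
    have gen : ∀ (x' : X) (hx' : f (σ x) = x'), P x' (hx' ▸ (hY (σ x) : E (f (σ x)) → ℝ≥0∞)) := by
      rintro _ rfl
      exact hP
    exact gen x (hσ x)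
  have hform : ∀ x, IsUnboundedHermitianForm (h x) := fun x =>
    tr (fun x H => IsUnboundedHermitianForm H) x (hhY.form (σ x) (mem_univ _))
  have hX : ∀ x ∈ X₁, h x = h₁ x := fun x hx =>
    tr (fun x H => x ∈ X₁ → H = h₁ x) x (fun hx => heq (σ x) hx) hx
  have hAne : X₁ᶜ ≠ univ := by
    rw [Ne, compl_univ_iff]
    exact hne.ne_empty
  have hopen : IsOpen X₁ := by
    have := IsClosedAnalyticSubset.isClosed (n := n) hX₁
    rwa [isClosed_compl_iff] at this
  have hmetric : IsSingularHermitianMetricOn (n := n) F h univ :=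
    hh₁.of_null_compl hopen (IsClosedAnalyticSubset.isThinInCharts hX₁ hAne).isNullInCharts hform hX
  refine ⟨fun hneg => ⟨h, hmetric, ?_, hX⟩, fun hpos => ⟨h, hmetric, ?_, hX⟩⟩
  · refine isSemiNegativelyCurvedOn_of_descent hf hproper hsurj hX₁ hne (q₁ := h₁) (qY := hY)
      (fun x => ⟨σ x, hσ x, fun s => ?_⟩) heq fun U hU s hs => ?_
    · exact tr (fun x' H => H (s x') = hY (σ x) (s (f (σ x)))) x rfl
    · exact hneg _ (hU.preimage hf.continuous) (subset_univ _) (fun y => s (f y)) fun y hy =>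
        ((contMDiffAt_pullback_section_iff f (fun y => s (f y)) y).2
          (hs.contMDiffAt_comp hU hf hy)).contMDiffWithinAt
  -- The dual form at `x` involves only the form on that fibre, so the dual of `h` is read off at
  -- the same points `σ x`.
  · refine isSemiNegativelyCurvedOn_of_descent (E := fun x => E x →L[ℂ] Bundle.Trivial X ℂ x)
      (F := F →L[ℂ] ℂ) hf hproper hsurj hX₁ hne (q := fun x => dualForm (h x))
      (q₁ := fun x => dualForm (h₁ x)) (qY := fun y => dualForm (hY y : E (f y) → ℝ≥0∞))
      (fun x => ⟨σ x, hσ x, fun s => ?_⟩) (fun y hy => congrArg dualForm (heq y hy))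
      fun U hU s hs => ?_
    · exact tr (fun x' H => dualForm H (s x') =
        dualForm (hY (σ x) : E (f (σ x)) → ℝ≥0∞) (s (f (σ x)))) x rfl
    · exact hpos _ (hU.preimage hf.continuous) (subset_univ _) (fun y => s (f y)) fun y hy =>
        ((contMDiffAt_hom_pullback_section_iff f (fun y => s (f y)) y).2
          (hs.contMDiffAt_comp hU hf hy)).contMDiffWithinAt
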